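/- Let $\varepsilon_k$, $k\in\mathbb Z$, be i.i.d. random vectors in $\mathbb R^m$, let $J_{i,n}:(\mathbb R^m)^{\mathbb N_0}\to\mathbb R$ be measurable and let $X_i=X_{i,n}=J_{i,n}(\varepsilon_i,\varepsilon_{i-1},\dots)$, $1\le i\le n$, $n\in\mathbb N$ (in particular, $X$ may be a locally stationary process of this form). For $\nu>0$ write $\|W\|_\nu=(\mathbb E|W|^\nu)^{1/\nu}$, let $X_i^{*(i-k)}$ be $X_i$ with $\varepsilon_{i-k}$ replaced by an independent copy, and let $\delta^X_\nu(k)=\delta^X_{\nu,n}(k)=\max_{1\le i\le n}\|X_i-X_i^{*(i-k)}\|_\nu$. Let $K:\mathbb R\to\mathbb R$ be bounded and Lipschitz continuous with $\int K(u)\,du=1$ and support contained in $[-\frac12,\frac12]$, put $K_h(u)=\frac1hK(\frac uh)$, let $h_1=h_{1,n}>0$ and $h_2=h_{2,n}>0$ be bounded sequences of bandwidths, and let $$\hat g_{n,h}(x,v)=\frac1n\sum_{i=1}^nK_{h_1}\Big(\frac in-v\Big)K_{h_2}(X_i-x),\qquad x\in\mathbb R,\ v\in[0,1].$$ Suppose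 that: * for some $0<s\le\frac12$ and $\alpha>s^{-1}$, $\sup_{n}\max_{1\le i\le n}\|X_{i,n}\|_{2s}<\infty$ and $\delta^X_{2s}(k)\le C k^{-\alpha}$ for all $k\ge1$ and $n\ge1$, with a constant $C$ that does not depend on $n$; * for $2\le i\le n$, the conditional distribution of $X_i$ given the past $X_1,\dots,X_{i-1}$ depends on $X_{i-1}$ only and has a Lebesgue density $x\mapsto g_{X_i|X_{i-1}=z}(x)$ on the event $\{X_{i-1}=z\}$, where $(z,x)\mapsto g_{X_i|X_{i-1}=z}(x)\geq 0$ is measurable; and there are constants $C_\infty,L_G$, independent of $i$ and $n$, such that $g_{X_i|X_{i-1}=z}(x)\le C_\infty$ for all $x,z\in\mathbb R$, and $z\mapsto g_{X_i|X_{i-1}=z}(x)$ is Lipschitz continuous with constant $L_G$ for every $x\in\mathbb R$. If $$\log(n)\Big(n\,h_2\,h_1^{\frac{\alpha s}{\alpha s-1}}\Big)^{-1}=O(1)\qquad(n\to\infty),$$ then $$\sup_{x\in\mathbb R,\,v\in[0,1]}\big|\hat g_{n,h}(x,v)-\mathbb E\,\hat g_{n,h}(x,v)\big|=O_p\Big(\sqrt{\tfrac{\log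 n}{n\,h_1h_2}}\Big)\qquad(n\to\infty).$$ -/

import Mathlib

open MeasureTheory ProbabilityTheory Filter Asymptotics
open scoped ENNReal NNReal

noncomputable section

namespace KernelDensity

/-- The sequence `(ε_i, ε_{i-1}, ε_{i-2}, …)` of innovations up to time `i`. -/
def pastInnovations {Ω E : Type*} (ε : ℤ → Ω → E) (i : ℤ) (ω : Ω) : ℕ → E :=
  fun j => ε (i - j) ω

/-- The triangular array of Bernoulli shifts `X_{i,n} = J_{i,n}(ε_i, ε_{i-1}, …)`. -/
def bernoulliShift {Ω E : Type*} (ε : ℤ → Ω → E) (J : ℕ → ℕ → (ℕ → E) → ℝ)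
    (n i : ℕ) (ω : Ω) : ℝ :=
  J n i (pastInnovations ε i ω)

/-- The coupled variable `X_{i,n}^{*(i-k)}`: in `X_{i,n}` the innovation `ε_{i-k}` is replaced
by an independent copy. It lives on `Ω × Ω` with the product measure: the second coordinate
carries the independent copy. -/
def coupledShift {Ω E : Type*} (ε : ℤ → Ω → E) (J : ℕ → ℕ → (ℕ → E) → ℝ)
    (n i k : ℕ) (ω : Ω × Ω) : ℝ :=
  J n i (Function.update (pastInnovations ε i ω.1) k (ε ((i : ℤ) - k) ω.2))

/-- The uniform functional dependence measure
`δ_ν(k) = sup_{1 ≤ i ≤ n} ‖X_{i,n} - X_{i,n}^{*(i-k)}‖_ν`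
of the `n`-th row of the array, where `‖W‖_ν = (E |W|^ν)^{1/ν}`. -/
def functionalDependence {Ω E : Type*} [MeasurableSpace Ω] (μ : Measure Ω)
    (ε : ℤ → Ω → E) (J : ℕ → ℕ → (ℕ → E) → ℝ) (ν : ℝ) (n k : ℕ) : ℝ≥0∞ :=
  ⨆ i ∈ Finset.Icc 1 n,
    eLpNorm (fun ω : Ω × Ω => bernoulliShift ε J n i ω.1 - coupledShift ε J n i k ω)
      (ENNReal.ofReal ν) (μ.prod μ)

/-- The sigma-algebra `σ(X_1, …, X_{i-1})` generated by the observations before time `i`. -/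
abbrev observedPast {Ω : Type*} (X : ℕ → Ω → ℝ) (i : ℕ) : MeasurableSpace Ω :=
  ⨆ j ∈ Finset.Ico 1 i, MeasurableSpace.comap (X j) inferInstance

/-- `x ↦ g z x` is a conditional Lebesgue density of `X_i` given the past `X_1, …, X_{i-1}`, on
the event `X_{i-1} = z`: for all `A ∈ σ(X_1, …, X_{i-1})` and all Borel sets `B`,
`P(A ∩ {X_i ∈ B}) = E[1_A ∫_B g(X_{i-1}, x) dx]`. -/
structure IsTransitionDensity {Ω : Type*} [MeasurableSpace Ω] (μ : Measure Ω)
    (X : ℕ → Ω → ℝ) (i : ℕ) (g : ℝ → ℝ → ℝ) : Prop where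
  measurable : Measurable (Function.uncurry g)
  nonneg : ∀ z x, 0 ≤ g z x
  measure_inter : ∀ A : Set Ω, MeasurableSet[observedPast X i] A →
    ∀ B : Set ℝ, MeasurableSet B →
      μ (A ∩ X i ⁻¹' B) = ∫⁻ ω in A, (∫⁻ x in B, ENNReal.ofReal (g (X (i - 1) ω) x)) ∂μ

/-- The class of kernel functions: bounded, Lipschitz continuous, with integral one and support
in `[-1/2, 1/2]`. -/
structure IsKernel (K : ℝ → ℝ) : Prop where
  bounded : ∃ M : ℝ, ∀ u, |K u| ≤ M
  lipschitz : ∃ L : ℝ≥0, LipschitzWith L K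
  integral_eq_one : ∫ u, K u = 1
  support_subset : Function.support K ⊆ Set.Icc (-(1 / 2)) (1 / 2)

/-- `K_h(u) = K(u / h) / h`. -/
def scaledKernel (K : ℝ → ℝ) (h u : ℝ) : ℝ := 1 / h * K (u / h)

/-- The localized kernel density estimator
`ĝ_{n,h}(x, v) = n⁻¹ ∑_{i=1}^n K_{h₁}(i/n - v) K_{h₂}(X_i - x)`. -/
def densityEstimator {Ω : Type*} (K : ℝ → ℝ) (n : ℕ) (h₁ h₂ : ℝ) (X : ℕ → Ω → ℝ)
    (x v : ℝ) (ω : Ω) : ℝ :=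
  1 / (n : ℝ) * ∑ i ∈ Finset.Icc 1 n,
    scaledKernel K h₁ ((i : ℝ) / n - v) * scaledKernel K h₂ (X i ω - x)

/-- `sup_{x ∈ ℝ, v ∈ [0,1]} |ĝ_{n,h}(x, v) - E ĝ_{n,h}(x, v)|`, as an element of `[0, ∞]`. -/
def supDeviation {Ω : Type*} [MeasurableSpace Ω] (μ : Measure Ω) (K : ℝ → ℝ) (n : ℕ)
    (h₁ h₂ : ℝ) (X : ℕ → Ω → ℝ) (ω : Ω) : ℝ≥0∞ :=
  ⨆ x : ℝ, ⨆ v ∈ Set.Icc (0 : ℝ) 1,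
    ‖densityEstimator K n h₁ h₂ X x v ω - ∫ ω', densityEstimator K n h₁ h₂ X x v ω' ∂μ‖ₑ

/-- `Y_n = O_p(a_n)` as `n → ∞`, for nonnegative random variables `Y_n`. -/
def IsBigOInProbability {Ω : Type*} [MeasurableSpace Ω] (μ : Measure Ω)
    (Y : ℕ → Ω → ℝ≥0∞) (a : ℕ → ℝ) : Prop :=
  ∀ η : ℝ, 0 < η → ∃ M : ℝ, 0 < M ∧
    ∀ᶠ n in atTop, μ {ω | ENNReal.ofReal (M * a n) < Y n ω} ≤ ENNReal.ofReal η

end KernelDensity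

end

/-!
Write `r = log n / (n h₁ h₂)`, `a_i = n⁻¹ K_{h₁}(i/n - v)` and
`f_{i,x}(z) = E[K_{h₂}(X_i - x) | X_{i-1} = z] = ∫ K_{h₂}(y - x) g_i(z, y) dy`. Up to the summand
`i = 1`, which is of order `1 / (n h₁ h₂) ≤ r`, the deviation `ĝ - E ĝ` at a fixed `(x, v)` splits
into

* the martingale part `∑ a_i (K_{h₂}(X_i - x) - f_{i,x}(X_{i-1}))`, with increments of order
  `1 / (n h₁ h₂)` and, the conditional densities being bounded, conditional variance of that order;
* the dependent part `∑ a_i (f_{i,x}(X_{i-1}) - E f_{i,x}(X_{i-1}))`, where the `f_{i,x}` are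
  bounded and Lipschitz with constants free of `x` and of the bandwidths: the kernel `K_{h₂}` has
  been integrated out.

The martingale part satisfies a Bernstein bound for its moment generating function
(`hasBernsteinMGF_martingale`). In the dependent part each summand is replaced by its conditional
expectation given the last `q` innovations. The error is at most a constant times
`(n h₁)⁻¹ ∑_i E[min(1, |X_i - X_i'|) | ε_i, ε_{i-1}, …]`, with `X_i'` obtained from `X_i` by
resampling all innovations older than `q` steps; this bound does not depend on `x`, so that the
supremum over `x` costs nothing (`enorm_sub_smooth_le`). As `min(1, |d|) ≤ |d|^{2s}` for `2s ≤ 1`,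
resampling the innovations one at a time bounds its expectation by a multiple of
`h₁⁻¹ ∑_{k ≥ q} k^{-2αs}`, hence of `h₁⁻¹ q^{1-2αs}` (`spliceDist_le_tsum`,
`updateDist_le_functionalDependence`).
Resampling one at a time reaches the whole remote past in the limit because every integrable
function of the infinite past is approximated in `L¹` by functions of finitely many innovations
(`tendsto_lintegral_enorm_sub_splice`).

The smoothed summands are grouped into blocks of `q` consecutive indices. Blocks with even number
are independent, and so are those with odd number; within a block the covariances at lag `k` are of
order `k^{1-2αs}`, which is summable since `αs > 1`. This gives a Bernstein bound with range of
order `q / (n h₁)` and variance of order `1 / (n h₁)` (`hasBernsteinMGF_alternateBlocks`).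

With `q` about `r^{-1/2}` and `θ = αs - 1` the range is `O(√r / log n)`, and the coupling error is
`O(h₁⁻¹ r^θ √r)`. The bandwidth condition says exactly that `r^θ = O(h₁)` (`eventually_rate_le`),
so both are as small as needed. All exponential bounds at level `T √r` then carry a probability
`n^{-c(T)}` with `c(T) → ∞`, which beats the cardinality of a grid in `(x, v)` of mesh `n⁻⁴`
covering `|x| ≤ 2 n^A` (`supDeviation_le`, `measure_supDeviation_gt_le`). For larger `|x|` the
estimator vanishes unless some `|X_i|` exceeds `n^A`, which the moment bound excludes with
probability tending to one.
-/

namespace KernelDensity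

/-! ### Path space and resampling of innovations -/

/-- The path that agrees with `e` in the first `k` entries (the `k` most recent innovations) and
with `e'` afterwards. -/
def splice {E : Type*} (k : ℕ) (e e' : ℕ → E) : ℕ → E := fun l => if l < k then e l else e' l

section PathSpace
variable {E : Type*}

/-- Resampling everything from entry `k` on differs from resampling everything from entry `k + 1`
on in the entry `k` alone. -/
lemma splice_succ (k : ℕ) (e e' : ℕ → E) :
    splice k e e' = Function.update (splice (k + 1) e e') k (splice (k + 1) e' e k) := by
  ext l
  rcases eq_or_ne l k with rfl | h
  · simp [splice]
  · rw [Function.update_of_ne h]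
    have : l < k ↔ l < k + 1 := by omega
    simp [splice, this]

variable [MeasurableSpace E]

@[fun_prop]
lemma measurable_splice (k : ℕ) :
    Measurable (fun p : (ℕ → E) × (ℕ → E) => splice k p.1 p.2) := by
  refine measurable_pi_iff.2 fun l => ?_
  unfold splice
  split_ifs <;> fun_prop

variable (P : Measure E) [IsProbabilityMeasure P]

/-- The law of the sequence `(ε_i, ε_{i-1}, …)` when the innovations are i.i.d. with law `P`. -/
noncomputable abbrev pathLaw : Measure (ℕ → E) := Measure.infinitePi (fun _ : ℕ => P)

/-- A pair of independent paths, coded as one family indexed by `Bool × ℕ`. -/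
lemma map_infinitePi_bool :
    (Measure.infinitePi (fun _ : Bool × ℕ => P)).map
      (fun w => ((fun l => w (false, l)), (fun l => w (true, l)))) =
    (pathLaw P).prod (pathLaw P) := by
  have h := Measure.infinitePi_map_curry (ι := Bool) (κ := ℕ) (fun _ _ => P)
  have h2 := Measure.infinitePi_map_eval_prod (ι := Bool) (P := fun _ => pathLaw P)
    (i := false) (j := true) (by simp)
  rw [← h2, ← h, Measure.map_map (by fun_prop) (by fun_prop)]
  rfl

/-- Exchanging the entries from `k` on between two independent paths does not change their joint
law: it permutes the coordinates of an i.i.d. family. -/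
lemma measurePreserving_swapTail (k : ℕ) :
    MeasurePreserving (fun p : (ℕ → E) × (ℕ → E) => (splice k p.1 p.2, splice k p.2 p.1))
      ((pathLaw P).prod (pathLaw P)) ((pathLaw P).prod (pathLaw P)) := by
  have hm : Measurable (fun p : (ℕ → E) × (ℕ → E) => (splice k p.1 p.2, splice k p.2 p.1)) :=
    (measurable_splice k).prodMk ((measurable_splice k).comp measurable_swap)
  refine ⟨hm, ?_⟩
  -- The exchange of tails is the permutation of coordinates that flips the path index beyond `k`.
  set σ : Bool × ℕ → Bool × ℕ := fun p => if p.2 < k then p else (!p.1, p.2) with hσ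
  have hσi : Function.Injective σ := by
    rintro ⟨a, l⟩ ⟨b, l'⟩ h
    simp only [hσ] at h
    split_ifs at h <;> simp_all <;> omega
  have h := Measure.map_infinitePi_infinitePi_of_inj (P := fun _ : Bool × ℕ => P) hσi
  rw [← map_infinitePi_bool, Measure.map_map hm (by fun_prop)]
  nth_rewrite 2 [← h]
  rw [Measure.map_map (by fun_prop) (by fun_prop)]
  congr 1
  ext w l <;> simp only [Function.comp, splice, hσ] <;> split_ifs <;> simp_all

lemma measurePreserving_splice (k : ℕ) :
    MeasurePreserving (fun p : (ℕ → E) × (ℕ → E) => splice k p.1 p.2)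
      ((pathLaw P).prod (pathLaw P)) (pathLaw P) :=
  measurePreserving_fst.comp (measurePreserving_swapTail P k)

end PathSpace

/-- The distance on `ℝ` truncated at one. -/
noncomputable def truncDist (a b : ℝ) : ℝ≥0∞ := min 1 (edist a b)

@[fun_prop]
lemma measurable_truncDist {α : Type*} [MeasurableSpace α] {f g : α → ℝ} (hf : Measurable f)
    (hg : Measurable g) : Measurable (fun x => truncDist (f x) (g x)) :=
  measurable_const.min (hf.edist hg)

lemma truncDist_le_one (a b : ℝ) : truncDist a b ≤ 1 := min_le_left _ _

lemma truncDist_self (a : ℝ) : truncDist a a = 0 := by simp [truncDist]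

lemma truncDist_triangle (a b c : ℝ) : truncDist a c ≤ truncDist a b + truncDist b c := by
  unfold truncDist
  rcases le_total 1 (edist a b) with h | h
  · rw [min_eq_left h]; exact (min_le_left _ _).trans le_self_add
  rcases le_total 1 (edist b c) with h' | h'
  · rw [min_eq_left h']; exact (min_le_left _ _).trans le_add_self
  rw [min_eq_right h, min_eq_right h']
  exact (min_le_right _ _).trans (edist_triangle _ _ _)

section Coupling
variable {E : Type*} [MeasurableSpace E] (P : Measure E) [IsProbabilityMeasure P]

/-- The expected truncated distance between `J` at a random path and at the same path with entry
`k` replaced by an independent copy. -/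
noncomputable def updateDist (J : (ℕ → E) → ℝ) (k : ℕ) : ℝ≥0∞ :=
  ∫⁻ p, truncDist (J p.1) (J (Function.update p.1 k (p.2 k))) ∂((pathLaw P).prod (pathLaw P))

/-- The expected truncated distance between `J` at a random path and at the same path with all
entries from `k` on replaced by independent copies. -/
noncomputable def spliceDist (J : (ℕ → E) → ℝ) (k : ℕ) : ℝ≥0∞ :=
  ∫⁻ p, truncDist (J p.1) (J (splice k p.1 p.2)) ∂((pathLaw P).prod (pathLaw P))

variable {J : (ℕ → E) → ℝ}

/-- By exchangeability, the cost of resampling entry `k` is the same whether or not the later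
entries have been resampled already. -/
lemma lintegral_truncDist_splice_succ (hJ : Measurable J) (k : ℕ) :
    ∫⁻ p, truncDist (J (splice (k + 1) p.1 p.2)) (J (splice k p.1 p.2))
      ∂((pathLaw P).prod (pathLaw P)) = updateDist P J k := by
  have h := (measurePreserving_swapTail P (k + 1)).lintegral_comp
    (f := fun p => truncDist (J p.1) (J (Function.update p.1 k (p.2 k)))) (by
      refine measurable_truncDist (by fun_prop) (hJ.comp ?_)
      refine measurable_pi_iff.2 fun l => ?_
      rcases eq_or_ne l k with rfl | hl
      · simp; fun_prop
      · simp only [Function.update_of_ne hl]; fun_prop)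
  rw [updateDist, ← h]
  simp only [← splice_succ]

lemma lintegral_truncDist_splice_le (hJ : Measurable J) {k q : ℕ} (hkq : k ≤ q) :
    ∫⁻ p, truncDist (J (splice q p.1 p.2)) (J (splice k p.1 p.2))
      ∂((pathLaw P).prod (pathLaw P)) ≤ ∑ l ∈ Finset.Ico k q, updateDist P J l := by
  induction q, hkq using Nat.le_induction with
  | base => simp [truncDist_self]
  | succ q hkq ih =>
    rw [Finset.sum_Ico_succ_top hkq, ← lintegral_truncDist_splice_succ P hJ q]
    calc ∫⁻ p, truncDist (J (splice (q + 1) p.1 p.2)) (J (splice k p.1 p.2))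
          ∂((pathLaw P).prod (pathLaw P))
        ≤ ∫⁻ p, (truncDist (J (splice q p.1 p.2)) (J (splice k p.1 p.2)) +
            truncDist (J (splice (q + 1) p.1 p.2)) (J (splice q p.1 p.2)))
            ∂((pathLaw P).prod (pathLaw P)) :=
          lintegral_mono fun p => (truncDist_triangle _ _ _).trans (add_comm _ _).le
      _ = _ := lintegral_add_right _
          (measurable_truncDist (hJ.comp (measurable_splice _)) (hJ.comp (measurable_splice _)))
      _ ≤ _ := by gcongr

end Coupling

/-! ### Approximation by functions of finitely many innovations -/

section Limit
variable {E : Type*} [MeasurableSpace E] (P : Measure E) [IsProbabilityMeasure P]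

lemma eq_of_measurable_comap {α β : Type*} {mβ : MeasurableSpace β} {f : α → β} {φ : α → ℝ}
    (hφ : Measurable[mβ.comap f] φ) {x y : α} (h : f x = f y) : φ x = φ y := by
  obtain ⟨B, -, hB⟩ := hφ (measurableSet_singleton (φ y))
  have hy : y ∈ f ⁻¹' B := by rw [hB]; simp
  have hx : x ∈ f ⁻¹' B := by simpa [Set.mem_preimage, h] using hy
  rw [hB] at hx
  simpa using hx

/-- An integrable function of the path is asymptotically unaffected, in `L¹`, by resampling the
entries from `k` on: by the upward martingale convergence theorem it is the `L¹` limit of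
functions of finitely many entries, and resampling preserves the law. -/
lemma tendsto_lintegral_enorm_sub_splice {ψ : (ℕ → E) → ℝ} (hψ : Measurable ψ)
    (hint : Integrable ψ (pathLaw P)) :
    Tendsto (fun k => ∫⁻ p, ‖ψ p.1 - ψ (splice k p.1 p.2)‖ₑ ∂((pathLaw P).prod (pathLaw P)))
      atTop (nhds 0) := by
  set ℱ : Filtration ℕ (MeasurableSpace.pi : MeasurableSpace (ℕ → E)) :=
    Filtration.piLE (X := fun _ : ℕ => E) with hℱ
  have hsup : (⨆ n, ℱ n) = MeasurableSpace.pi := by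
    refine le_antisymm (iSup_le fun n => ℱ.le n) ?_
    refine iSup_le fun l => ?_
    refine le_trans ?_ (le_iSup _ l)
    have : (fun e : ℕ → E => e l) =
        (fun x : (i : Set.Iic l) → E => x ⟨l, Set.mem_Iic.2 le_rfl⟩) ∘ Preorder.restrictLe l := rfl
    change MeasurableSpace.comap (fun e : ℕ → E => e l) _ ≤
      MeasurableSpace.comap (Preorder.restrictLe l) _
    rw [this, ← MeasurableSpace.comap_comp]
    exact MeasurableSpace.comap_mono (Measurable.comap_le (by fun_prop))
  have hlim := hint.tendsto_eLpNorm_condExp (ℱ := ℱ)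
    (by rw [hsup]; exact hψ.stronglyMeasurable)
  rw [← tendsto_add_atTop_iff_nat 1]
  have hlim2 := hlim.add hlim
  rw [add_zero] at hlim2
  refine tendsto_of_tendsto_of_tendsto_of_le_of_le tendsto_const_nhds hlim2
    (fun _ => zero_le) fun k => ?_
  -- `G` depends on the entries up to `k` only, so it is not changed by the splice at `k + 1`.
  set G : (ℕ → E) → ℝ := (pathLaw P)[ψ | ℱ k] with hG
  have hGk : Measurable[ℱ k] G := stronglyMeasurable_condExp.measurable
  have hGm : Measurable G := hGk.mono (ℱ.le k) le_rfl
  have hGs : ∀ e e', G (splice (k + 1) e e') = G e := fun e e' => by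
    refine eq_of_measurable_comap hGk ?_
    ext ⟨l, hl⟩
    have hl' : l < k + 1 := Nat.lt_succ_of_le hl
    simp [Preorder.restrictLe, splice, hl']
  have hm : Measurable fun e => ‖G e - ψ e‖ₑ := (hGm.sub hψ).enorm
  calc ∫⁻ p, ‖ψ p.1 - ψ (splice (k + 1) p.1 p.2)‖ₑ ∂((pathLaw P).prod (pathLaw P))
      ≤ ∫⁻ p, (‖G p.1 - ψ p.1‖ₑ + ‖G (splice (k + 1) p.1 p.2) - ψ (splice (k + 1) p.1 p.2)‖ₑ)
          ∂((pathLaw P).prod (pathLaw P)) := by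
        refine lintegral_mono fun p => ?_
        rw [hGs]
        calc ‖ψ p.1 - ψ (splice (k + 1) p.1 p.2)‖ₑ
            = ‖-(G p.1 - ψ p.1) + (G p.1 - ψ (splice (k + 1) p.1 p.2))‖ₑ := by congr 1; ring
          _ ≤ _ := (enorm_add_le _ _).trans (by rw [enorm_neg])
    _ = ∫⁻ p, ‖G p.1 - ψ p.1‖ₑ ∂((pathLaw P).prod (pathLaw P)) +
        ∫⁻ p, ‖G (splice (k + 1) p.1 p.2) - ψ (splice (k + 1) p.1 p.2)‖ₑ
          ∂((pathLaw P).prod (pathLaw P)) :=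
        lintegral_add_left (hm.comp measurable_fst) _
    _ = eLpNorm (G - ψ) 1 (pathLaw P) + eLpNorm (G - ψ) 1 (pathLaw P) := by
        rw [(measurePreserving_splice P (k + 1)).lintegral_comp hm,
          (measurePreserving_fst (μ := pathLaw P) (ν := pathLaw P)).lintegral_comp hm,
          eLpNorm_one_eq_lintegral_enorm]
        rfl

lemma tendsto_measure_abs_gt {α : Type*} [MeasurableSpace α] (ν : Measure α) [IsFiniteMeasure ν]
    {J : α → ℝ} (hJ : Measurable J) :
    Tendsto (fun N : ℕ => ν {e | (N : ℝ) < |J e|}) atTop (nhds 0) := by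
  have h := tendsto_measure_iInter_atTop (μ := ν) (s := fun N : ℕ => {e | (N : ℝ) < |J e|})
    (fun N => (measurableSet_lt measurable_const hJ.abs).nullMeasurableSet)
    (fun a b hab e (he : (b : ℝ) < |J e|) =>
      show (a : ℝ) < |J e| from lt_of_le_of_lt (by exact_mod_cast hab) he) ⟨0, measure_ne_top _ _⟩
  have he : (⋂ N : ℕ, {e | (N : ℝ) < |J e|}) = ∅ := by
    ext e
    simp only [Set.mem_iInter, Set.mem_ofPred_eq, Set.mem_empty_iff_false, iff_false, not_forall,
      not_lt]
    exact exists_nat_ge _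
  rw [he, measure_empty] at h
  exact h

/-- No integrability of `J` is needed, since the distance is truncated: `J` is cut off at a level
exceeded with small probability. -/
lemma tendsto_spliceDist {J : (ℕ → E) → ℝ} (hJ : Measurable J) :
    Tendsto (spliceDist P J) atTop (nhds 0) := by
  rw [ENNReal.tendsto_nhds_zero]
  intro δ hδ
  have h3 : 0 < δ / 3 := ENNReal.div_pos hδ.ne' (by norm_num)
  obtain ⟨N, hN⟩ := ((ENNReal.tendsto_nhds_zero.1
    (tendsto_measure_abs_gt (pathLaw P) hJ)) _ h3).exists
  set ψ : (ℕ → E) → ℝ := fun e => max (-N) (min N (J e)) with hψ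
  have hψm : Measurable ψ := by fun_prop
  have hψi : Integrable ψ (pathLaw P) := by
    refine Integrable.of_bound hψm.aestronglyMeasurable N (ae_of_all _ fun e => ?_)
    rw [Real.norm_eq_abs, abs_le]
    exact ⟨le_max_left _ _, max_le (by linarith [N.cast_nonneg (α := ℝ)]) (min_le_left _ _)⟩
  have hlim := ENNReal.tendsto_nhds_zero.1 (tendsto_lintegral_enorm_sub_splice P hψm hψi) _ h3
  filter_upwards [hlim] with k hk
  set S : Set (ℕ → E) := {e | (N : ℝ) < |J e|} with hS
  have hSm : MeasurableSet S := measurableSet_lt measurable_const hJ.abs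
  have hψJ : ∀ e, e ∉ S → ψ e = J e := fun e he => by
    have : |J e| ≤ N := not_lt.1 he
    rw [abs_le] at this
    rw [hψ]; simp only
    rw [min_eq_right this.2, max_eq_right this.1]
  have hind : Measurable (S.indicator (1 : (ℕ → E) → ℝ≥0∞)) := measurable_one.indicator hSm
  calc spliceDist P J k
      ≤ ∫⁻ p, (S.indicator 1 p.1 + S.indicator 1 (splice k p.1 p.2) +
          ‖ψ p.1 - ψ (splice k p.1 p.2)‖ₑ) ∂((pathLaw P).prod (pathLaw P)) := by
        refine lintegral_mono fun p => ?_
        by_cases h1 : p.1 ∈ S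
        · refine (truncDist_le_one _ _).trans ?_
          rw [add_assoc]
          simp [h1]
        by_cases h2 : splice k p.1 p.2 ∈ S
        · refine (truncDist_le_one _ _).trans ?_
          simp [h1, h2]
        rw [hψJ _ h1, hψJ _ h2]
        refine (min_le_right _ _).trans ?_
        rw [edist_eq_enorm_sub]
        exact le_add_self
    _ = pathLaw P S + pathLaw P S +
        ∫⁻ p, ‖ψ p.1 - ψ (splice k p.1 p.2)‖ₑ ∂((pathLaw P).prod (pathLaw P)) := by
        rw [lintegral_add_left, lintegral_add_left,
          (measurePreserving_splice P k).lintegral_comp hind,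
          (measurePreserving_fst (μ := pathLaw P) (ν := pathLaw P)).lintegral_comp hind,
          lintegral_indicator_one hSm]
        · exact hind.comp measurable_fst
        · exact (hind.comp measurable_fst).add (hind.comp (measurable_splice k))
    _ ≤ δ / 3 + δ / 3 + δ / 3 := by gcongr
    _ = δ := ENNReal.add_thirds δ

/-- Resampling the remote past all at once costs no more than resampling its entries one at a
time. -/
lemma spliceDist_le_tsum {J : (ℕ → E) → ℝ} (hJ : Measurable J) (q : ℕ) :
    spliceDist P J q ≤ ∑' l, updateDist P J (q + l) := by
  have h : ∀ N, spliceDist P J q ≤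
      spliceDist P J (q + N) + ∑' l, updateDist P J (q + l) := fun N => by
    calc spliceDist P J q
        ≤ ∫⁻ p, (truncDist (J p.1) (J (splice (q + N) p.1 p.2)) +
            truncDist (J (splice (q + N) p.1 p.2)) (J (splice q p.1 p.2)))
            ∂((pathLaw P).prod (pathLaw P)) :=
          lintegral_mono fun p => truncDist_triangle _ _ _
      _ = spliceDist P J (q + N) +
          ∫⁻ p, truncDist (J (splice (q + N) p.1 p.2)) (J (splice q p.1 p.2))
            ∂((pathLaw P).prod (pathLaw P)) :=
          lintegral_add_left (measurable_truncDist (hJ.comp measurable_fst)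
            (hJ.comp (measurable_splice _))) _
      _ ≤ _ := by
          gcongr
          refine (lintegral_truncDist_splice_le P hJ (Nat.le_add_right q N)).trans ?_
          rw [Finset.sum_Ico_eq_sum_range, Nat.add_sub_cancel_left]
          exact ENNReal.sum_le_tsum _
  have hl := ((tendsto_spliceDist P hJ).comp (tendsto_add_atTop_nat q)).add_const
    (∑' l, updateDist P J (q + l))
  rw [zero_add] at hl
  refine ge_of_tendsto' hl fun N => ?_
  simpa [add_comm] using h N

end Limit

/-! ### Relation to the functional dependence measure -/

section Dependence
variable {Ω E : Type*} [MeasurableSpace Ω] [MeasurableSpace E] {μ : Measure Ω}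
  {ε : ℤ → Ω → E}

lemma measurable_pastInnovations (hε : ∀ k, Measurable (ε k)) (i : ℤ) :
    Measurable (pastInnovations ε i) :=
  measurable_pi_iff.2 fun j => hε (i - j)

/-- The law of the innovation path does not depend on the time index. -/
lemma map_pastInnovations (hε : ∀ k, Measurable (ε k)) (hind : iIndepFun ε μ)
    (hident : ∀ k, IdentDistrib (ε k) (ε 0) μ μ) (i : ℤ) :
    μ.map (pastInnovations ε i) = pathLaw (μ.map (ε 0)) := by
  have hinj : Function.Injective (fun j : ℕ => i - (j : ℤ)) := fun a b h => by
    simpa using h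
  have h := (hind.precomp hinj).map_fun_eq_infinitePi_map (fun j : ℕ => hε (i - (j : ℤ)))
  have h2 : ∀ j : ℕ, μ.map (ε (i - j)) = μ.map (ε 0) := fun j => (hident _).map_eq
  simp only [h2] at h
  exact h

lemma truncDist_le_rpow {p : ℝ} (hp : 0 < p) (hp1 : p ≤ 1) (a b : ℝ) :
    truncDist a b ≤ ‖a - b‖ₑ ^ p := by
  rw [truncDist, edist_eq_enorm_sub]
  rcases le_total 1 ‖a - b‖ₑ with h | h
  · exact (min_le_left _ _).trans (ENNReal.one_le_rpow h hp)
  · refine (min_le_right _ _).trans ?_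
    simpa using ENNReal.rpow_le_rpow_of_exponent_ge h hp1

/-- For `p ≤ 1` the truncated distance is at most `|·| ^ p`, so the functional dependence measure
in `L^p` controls the truncated distances in expectation. -/
lemma updateDist_le_functionalDependence [IsProbabilityMeasure μ]
    (hε : ∀ k, Measurable (ε k)) (hind : iIndepFun ε μ)
    (hident : ∀ k, IdentDistrib (ε k) (ε 0) μ μ) {J : ℕ → ℕ → (ℕ → E) → ℝ}
    {n i : ℕ} (hJ : Measurable (J n i)) (hi : i ∈ Finset.Icc 1 n) {p : ℝ} (hp : 0 < p)
    (hp1 : p ≤ 1) (k : ℕ) :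
    haveI := Measure.isProbabilityMeasure_map (μ := μ) (hε 0).aemeasurable
    updateDist (μ.map (ε 0)) (J n i) k ≤ functionalDependence μ ε J p n k ^ p := by
  have := Measure.isProbabilityMeasure_map (μ := μ) (hε 0).aemeasurable
  have hpm := measurable_pastInnovations hε (i : ℤ)
  have hupd : Measurable (fun q : (ℕ → E) × (ℕ → E) => Function.update q.1 k (q.2 k)) := by
    refine measurable_pi_iff.2 fun l => ?_
    rcases eq_or_ne l k with rfl | hl
    · simp only [Function.update_self]; fun_prop
    · simp only [Function.update_of_ne hl]; fun_prop
  have h1 : updateDist (μ.map (ε 0)) (J n i) k =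
      ∫⁻ ω, truncDist (bernoulliShift ε J n i ω.1) (coupledShift ε J n i k ω) ∂(μ.prod μ) := by
    rw [updateDist, ← map_pastInnovations hε hind hident i,
      Measure.map_prod_map _ _ hpm hpm, lintegral_map]
    · rfl
    · exact measurable_truncDist (hJ.comp measurable_fst) (hJ.comp hupd)
    · exact hpm.prodMap hpm
  rw [h1]
  calc ∫⁻ ω, truncDist (bernoulliShift ε J n i ω.1) (coupledShift ε J n i k ω) ∂(μ.prod μ)
      ≤ ∫⁻ ω, ‖bernoulliShift ε J n i ω.1 - coupledShift ε J n i k ω‖ₑ ^ p ∂(μ.prod μ) :=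
        lintegral_mono fun ω => truncDist_le_rpow hp hp1 _ _
    _ = eLpNorm (fun ω : Ω × Ω => bernoulliShift ε J n i ω.1 - coupledShift ε J n i k ω)
          (ENNReal.ofReal p) (μ.prod μ) ^ p := by
        rw [eLpNorm_eq_lintegral_rpow_enorm_toReal (by simpa using hp) (by simp),
          ENNReal.toReal_ofReal hp.le, ← ENNReal.rpow_mul, one_div_mul_cancel hp.ne',
          ENNReal.rpow_one]
    _ ≤ _ := by
        gcongr
        exact le_iSup₂ (f := fun i (_ : i ∈ Finset.Icc 1 n) =>
          eLpNorm (fun ω : Ω × Ω => bernoulliShift ε J n i ω.1 - coupledShift ε J n i k ω)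
          (ENNReal.ofReal p) (μ.prod μ)) i hi

end Dependence

/-- The tail of `∑ k ^ (-(γ + 1))`, compared with that of `∑ k ^ (-2)`. -/
lemma tsum_rpow_tail_le {γ : ℝ} (hγ : 1 ≤ γ) {q : ℕ} (hq : 1 ≤ q) :
    ∑' l : ℕ, ENNReal.ofReal (((q + l : ℕ) : ℝ) ^ (-(γ + 1))) ≤
      ENNReal.ofReal (4 * (q : ℝ) ^ (-γ)) := by
  have hq0 : (0 : ℝ) < q := by exact_mod_cast hq
  refine ENNReal.tsum_le_of_sum_range_le fun N => ?_
  rw [← ENNReal.ofReal_sum_of_nonneg (fun _ _ => by positivity)]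
  refine ENNReal.ofReal_le_ofReal ?_
  have hterm : ∀ l : ℕ, ((q + l : ℕ) : ℝ) ^ (-(γ + 1)) ≤
      (q : ℝ) ^ (-(γ - 1)) * (((q + l : ℕ) : ℝ) ^ 2)⁻¹ := fun l => by
    have hl : (0 : ℝ) < ((q + l : ℕ) : ℝ) := by exact_mod_cast (by omega : 0 < q + l)
    have : -(γ + 1) = -(γ - 1) + -(2 : ℕ) := by push_cast; ring
    rw [this, Real.rpow_add hl, Real.rpow_neg hl.le ((2 : ℕ) : ℝ), Real.rpow_natCast]
    gcongr ?_ * _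
    refine Real.rpow_le_rpow_of_nonpos hq0 (by simp) (by linarith)
  calc ∑ l ∈ Finset.range N, ((q + l : ℕ) : ℝ) ^ (-(γ + 1))
      ≤ ∑ l ∈ Finset.range N, (q : ℝ) ^ (-(γ - 1)) * (((q + l : ℕ) : ℝ) ^ 2)⁻¹ :=
        Finset.sum_le_sum fun l _ => hterm l
    _ = (q : ℝ) ^ (-(γ - 1)) * ∑ k ∈ Finset.Ico q (q + N), (((k : ℕ) : ℝ) ^ 2)⁻¹ := by
        rw [Finset.mul_sum, Finset.sum_Ico_eq_sum_range, Nat.add_sub_cancel_left]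
    _ ≤ (q : ℝ) ^ (-(γ - 1)) * (2 / (((q - 1 : ℕ) : ℝ) + 1)) := by
        gcongr
        have h := sum_Ioo_inv_sq_le (α := ℝ) (q - 1) (q + N)
        rwa [show Finset.Ioo (q - 1) (q + N) = Finset.Ico q (q + N) by
          ext x; simp only [Finset.mem_Ioo, Finset.mem_Ico]; omega] at h
    _ ≤ 4 * (q : ℝ) ^ (-γ) := by
        rw [Nat.cast_sub hq, Nat.cast_one, sub_add_cancel]
        have : (q : ℝ) ^ (-(γ - 1)) = (q : ℝ) ^ (-γ) * q := by
          rw [show -(γ - 1) = -γ + 1 by ring, Real.rpow_add hq0, Real.rpow_one]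
        rw [this]
        have h0 : (0 : ℝ) ≤ (q : ℝ) ^ (-γ) := by positivity
        field_simp
        linarith

/-! ### Bernstein bounds for moment generating functions -/

section Exponential
variable {α : Type*} [MeasurableSpace α] {μ : Measure α}

lemma integrable_of_abs_le [IsFiniteMeasure μ] {Y : α → ℝ} {b : ℝ} (hY : Measurable Y)
    (hb : ∀ x, |Y x| ≤ b) : Integrable Y μ :=
  Integrable.of_bound hY.aestronglyMeasurable b (ae_of_all _ hb)

/-- The moment generating function of `S` is at most `exp (t² V)` as long as `|t| b ≤ 1`. Here `b`
is of the order of the range of a single independent summand of `S` and `V` of the order of the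
variance of `S`. The expectation is a lower integral, so that no integrability has to be carried
along. -/
def HasBernsteinMGF (μ : Measure α) (S : α → ℝ) (b V : ℝ) : Prop :=
  ∀ t : ℝ, |t| * b ≤ 1 → ∫⁻ x, ENNReal.ofReal (Real.exp (t * S x)) ∂μ ≤
    ENNReal.ofReal (Real.exp (t ^ 2 * V))

lemma HasBernsteinMGF.mono {S : α → ℝ} {b V W : ℝ} (h : HasBernsteinMGF μ S b V) (hVW : V ≤ W) :
    HasBernsteinMGF μ S b W :=
  fun t ht => (h t ht).trans (by gcongr)

/-- From `eˣ ≤ 1 + x + x²` for `|x| ≤ 1`. -/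
lemma HasBernsteinMGF.of_bounded [IsProbabilityMeasure μ] {Y : α → ℝ} {b v : ℝ}
    (hY : Measurable Y) (hb : ∀ x, |Y x| ≤ b) (h0 : ∫ x, Y x ∂μ = 0)
    (hv : ∫ x, Y x ^ 2 ∂μ ≤ v) : HasBernsteinMGF μ Y b v := by
  intro t ht
  have hbd : ∀ x, |t * Y x| ≤ 1 := fun x => by
    rw [abs_mul]
    exact (mul_le_mul_of_nonneg_left (hb x) (abs_nonneg _)).trans ht
  have hYi := integrable_of_abs_le (μ := μ) hY hb
  have hY2 : Integrable (fun x => Y x ^ 2) μ :=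
    integrable_of_abs_le (b := b ^ 2) (hY.pow_const 2) fun x => by
      rw [abs_pow]; exact pow_le_pow_left₀ (abs_nonneg _) (hb x) 2
  have hexp : Integrable (fun x => Real.exp (t * Y x)) μ :=
    integrable_of_abs_le (b := Real.exp 1) (by fun_prop) fun x => by
      rw [abs_of_pos (Real.exp_pos _)]
      exact Real.exp_le_exp.2 ((le_abs_self _).trans (hbd x))
  rw [← ofReal_integral_eq_lintegral_ofReal hexp (ae_of_all _ fun x => (Real.exp_pos _).le)]
  refine ENNReal.ofReal_le_ofReal ?_
  calc ∫ x, Real.exp (t * Y x) ∂μ ≤ ∫ x, (1 + t * Y x + t ^ 2 * Y x ^ 2) ∂μ := by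
        refine integral_mono hexp (((integrable_const 1).add (hYi.const_mul t)).add
          (hY2.const_mul _)) fun x => ?_
        have := (abs_le.1 (Real.abs_exp_sub_one_sub_id_le (hbd x))).2
        simp only
        nlinarith
    _ = 1 + t ^ 2 * ∫ x, Y x ^ 2 ∂μ := by
        have hlin : Integrable (fun x => 1 + t * Y x) μ :=
          (integrable_const 1).add (hYi.const_mul t)
        rw [integral_add hlin (hY2.const_mul _),
          integral_add (integrable_const 1) (hYi.const_mul t), integral_const_mul,
          integral_const_mul, h0]
        simp
    _ ≤ 1 + t ^ 2 * v := by gcongr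
    _ ≤ Real.exp (t ^ 2 * v) := by linarith [Real.add_one_le_exp (t ^ 2 * v)]

/-- The Chernoff bound, for `S` and for `-S`. -/
lemma HasBernsteinMGF.measure_abs_gt_le {S : α → ℝ} {b V : ℝ} (h : HasBernsteinMGF μ S b V)
    (hS : Measurable S) {t u : ℝ} (ht : 0 ≤ t) (htb : t * b ≤ 1) :
    μ {x | u < |S x|} ≤ 2 * ENNReal.ofReal (Real.exp (t ^ 2 * V - t * u)) := by
  have key : ∀ a : ℝ, |a| = t → μ {x | t * u ≤ a * S x} ≤
      ENNReal.ofReal (Real.exp (t ^ 2 * V - t * u)) := fun a ha => by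
    have h1 := h a (by rwa [ha])
    have h2 := mul_meas_ge_le_lintegral₀ (μ := μ)
      (f := fun x => ENNReal.ofReal (Real.exp (a * S x)))
      (by fun_prop) (ENNReal.ofReal (Real.exp (t * u)))
    have h3 : {x | t * u ≤ a * S x} ⊆
        {x | ENNReal.ofReal (Real.exp (t * u)) ≤ ENNReal.ofReal (Real.exp (a * S x))} :=
      fun x (hx : t * u ≤ a * S x) => ENNReal.ofReal_le_ofReal (Real.exp_le_exp.2 hx)
    have h4 := ((mul_le_mul_right (measure_mono h3) _).trans h2).trans h1
    rw [Real.exp_sub, ENNReal.ofReal_div_of_pos (Real.exp_pos _),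
      ENNReal.le_div_iff_mul_le (Or.inl (by simpa using Real.exp_pos _)) (Or.inl (by simp)),
      mul_comm]
    rwa [← sq_abs, ha] at h4
  have hsub : {x | u < |S x|} ⊆ {x | t * u ≤ t * S x} ∪ {x | t * u ≤ (-t) * S x} := by
    intro x (hx : u < |S x|)
    rcases abs_choice (S x) with h' | h'
    · left; rw [h'] at hx; exact mul_le_mul_of_nonneg_left hx.le ht
    · right; rw [h'] at hx
      change t * u ≤ -t * S x
      rw [neg_mul, ← mul_neg]; exact mul_le_mul_of_nonneg_left hx.le ht
  refine (measure_mono hsub).trans ((measure_union_le _ _).trans ?_)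
  rw [two_mul]
  exact add_le_add (key t (abs_of_nonneg ht)) (key (-t) (by rw [abs_neg, abs_of_nonneg ht]))

lemma HasBernsteinMGF.add_of_indepFun {S T : α → ℝ} {b V W : ℝ}
    (hS : HasBernsteinMGF μ S b V) (hT : HasBernsteinMGF μ T b W) (hSm : Measurable S)
    (hTm : Measurable T) (hi : IndepFun S T μ) :
    HasBernsteinMGF μ (fun x => S x + T x) b (V + W) := by
  intro t ht
  have hmeas : Measurable fun y : ℝ => ENNReal.ofReal (Real.exp (t * y)) := by fun_prop
  have h := lintegral_mul_eq_lintegral_mul_lintegral_of_indepFun''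
    (hmeas.comp hSm).aemeasurable (hmeas.comp hTm).aemeasurable (hi.comp hmeas hmeas)
  calc ∫⁻ x, ENNReal.ofReal (Real.exp (t * (S x + T x))) ∂μ
      = ∫⁻ x, ENNReal.ofReal (Real.exp (t * S x)) * ENNReal.ofReal (Real.exp (t * T x)) ∂μ := by
        refine lintegral_congr fun x => ?_
        rw [mul_add, Real.exp_add, ENNReal.ofReal_mul (Real.exp_pos _).le]
    _ = (∫⁻ x, ENNReal.ofReal (Real.exp (t * S x)) ∂μ) *
          ∫⁻ x, ENNReal.ofReal (Real.exp (t * T x)) ∂μ := h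
    _ ≤ ENNReal.ofReal (Real.exp (t ^ 2 * V)) * ENNReal.ofReal (Real.exp (t ^ 2 * W)) :=
        mul_le_mul' (hS t ht) (hT t ht)
    _ = _ := by rw [← ENNReal.ofReal_mul (Real.exp_pos _).le, ← Real.exp_add, mul_add]

lemma HasBernsteinMGF.sum_range_of_indepFun [IsProbabilityMeasure μ] {B : ℕ → α → ℝ} {b : ℝ}
    {V : ℕ → ℝ} (hB : ∀ l, HasBernsteinMGF μ (B l) b (V l)) (hBm : ∀ l, Measurable (B l))
    (hi : ∀ N, IndepFun (fun x => ∑ l ∈ Finset.range N, B l x) (B N) μ) (N : ℕ) :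
    HasBernsteinMGF μ (fun x => ∑ l ∈ Finset.range N, B l x) b (∑ l ∈ Finset.range N, V l) := by
  induction N with
  | zero => intro t _; simp
  | succ N ih =>
    simp only [Finset.sum_range_succ]
    exact ih.add_of_indepFun (hB N) (by fun_prop) (hBm N) (hi N)

end Exponential

section Martingale
variable {Ω : Type*} {X : ℕ → Ω → ℝ}

lemma measurable_observedPast {i j : ℕ} (hj : j ∈ Finset.Ico 1 i) :
    Measurable[observedPast X i] (X j) :=
  (comap_measurable (X j)).mono
    (le_iSup₂ (f := fun j (_ : j ∈ Finset.Ico 1 i) => MeasurableSpace.comap (X j) inferInstance)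
      j hj) le_rfl

variable [MeasurableSpace Ω] {μ : Measure Ω} {i : ℕ} {g : ℝ → ℝ → ℝ}

lemma observedPast_le (hX : ∀ j, Measurable (X j)) (i : ℕ) :
    observedPast X i ≤ (inferInstance : MeasurableSpace Ω) :=
  iSup₂_le fun j _ => (hX j).comap_le

/-- The conditional law of `X_i` given `X_{i-1} = z`, as the measure with density `g z`. -/
noncomputable def transitionMeasure (g : ℝ → ℝ → ℝ) (z : ℝ) : Measure ℝ :=
  volume.withDensity fun x => ENNReal.ofReal (g z x)

lemma measurable_transitionMeasure (hg : Measurable (Function.uncurry g)) :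
    Measurable (transitionMeasure g) := by
  refine Measure.measurable_of_measurable_coe _ fun B hB => ?_
  simp only [transitionMeasure, withDensity_apply _ hB]
  exact Measurable.lintegral_prod_right' (f := fun p : ℝ × ℝ => ENNReal.ofReal (g p.1 p.2))
    hg.ennreal_ofReal

namespace IsTransitionDensity

/-- The disintegration formula for products of a function of the past and a function of `X_i`. -/
lemma lintegral_mul (hX : ∀ j, Measurable (X j))
    (h : IsTransitionDensity μ X i g) {H : Ω → ℝ≥0∞} (hH : Measurable[observedPast X i] H)
    {ψ : ℝ → ℝ≥0∞} (hψ : Measurable ψ) :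
    ∫⁻ ω, H ω * ψ (X i ω) ∂μ =
      ∫⁻ ω, H ω * ∫⁻ y, ψ y ∂(transitionMeasure g (X (i - 1) ω)) ∂μ := by
  have hle := observedPast_le hX i
  have hκ : Measurable fun ω => transitionMeasure g (X (i - 1) ω) :=
    (measurable_transitionMeasure h.measurable).comp (hX _)
  have hset : ∀ A, MeasurableSet[observedPast X i] A → ∫⁻ ω in A, ψ (X i ω) ∂μ =
      ∫⁻ ω in A, ∫⁻ y, ψ y ∂(transitionMeasure g (X (i - 1) ω)) ∂μ := fun A hA => by
    -- Restricted to `A`, the law of `X i` is the mixture of the transition measures.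
    have hm : (μ.restrict A).map (X i) =
        (μ.restrict A).bind fun ω => transitionMeasure g (X (i - 1) ω) := by
      ext B hB
      rw [Measure.map_apply (hX i) hB, Measure.restrict_apply (hX i hB), Set.inter_comm,
        h.measure_inter A hA B hB, Measure.bind_apply hB hκ.aemeasurable]
      simp [transitionMeasure, withDensity_apply _ hB]
    rw [← lintegral_map hψ (hX i), hm, Measure.lintegral_bind hκ.aemeasurable hψ.aemeasurable]
  have hΨ : Measurable fun ω => ∫⁻ y, ψ y ∂(transitionMeasure g (X (i - 1) ω)) :=
    (Measure.measurable_lintegral hψ).comp hκ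
  -- The two weighted measures agree on the past, hence give the same integral to `H`.
  have htrim : (μ.withDensity fun ω => ψ (X i ω)).trim hle =
      (μ.withDensity fun ω => ∫⁻ y, ψ y ∂(transitionMeasure g (X (i - 1) ω))).trim hle := by
    refine @Measure.ext _ (observedPast X i) _ _ fun A hA => ?_
    rw [trim_measurableSet_eq hle hA, trim_measurableSet_eq hle hA, withDensity_apply _ (hle _ hA),
      withDensity_apply _ (hle _ hA), hset A hA]
  have hH' : Measurable H := hH.mono hle le_rfl
  have h1 := lintegral_withDensity_eq_lintegral_mul μ (hψ.comp (hX i)) hH'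
  have h2 := lintegral_withDensity_eq_lintegral_mul μ hΨ hH'
  have h3 : ∀ ν : Measure Ω, ∫⁻ ω, H ω ∂(ν.trim hle) = ∫⁻ ω, H ω ∂ν := fun ν =>
    lintegral_trim hle hH
  have h4 := h3 (μ.withDensity fun ω => ψ (X i ω))
  rw [htrim, h3, h2] at h4
  simp only [Function.comp_def] at h1
  rw [h1] at h4
  simp only [Pi.mul_apply, mul_comm _ (H _)] at h4
  exact h4.symm

/-- That `g z` has total mass one is not required for every `z`, but holds at almost every value
of `X_{i-1}`. -/
lemma ae_isProbabilityMeasure [IsFiniteMeasure μ] (hX : ∀ j, Measurable (X j)) (hi : 2 ≤ i)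
    (h : IsTransitionDensity μ X i g) :
    ∀ᵐ ω ∂μ, IsProbabilityMeasure (transitionMeasure g (X (i - 1) ω)) := by
  have hle := observedPast_le hX i
  have hG : Measurable[observedPast X i]
      fun ω => transitionMeasure g (X (i - 1) ω) Set.univ :=
    ((Measure.measurable_coe MeasurableSet.univ).comp
      (measurable_transitionMeasure h.measurable)).comp
      (measurable_observedPast (Finset.mem_Ico.2 ⟨by omega, by omega⟩))
  have := isFiniteMeasure_trim (μ := μ) hle
  have hae : (fun ω => transitionMeasure g (X (i - 1) ω) Set.univ) =ᵐ[μ.trim hle]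
      fun _ => (1 : ℝ≥0∞) := by
    refine ae_eq_of_forall_setLIntegral_eq_of_sigmaFinite (m0 := observedPast X i)
      hG measurable_const fun A hA _ => ?_
    rw [restrict_trim hle _ hA, lintegral_trim hle hG, lintegral_trim hle measurable_const]
    have := h.measure_inter A hA Set.univ MeasurableSet.univ
    simp only [Set.preimage_univ, Set.inter_univ, Measure.restrict_univ] at this
    simp [transitionMeasure, this]
  filter_upwards [ae_eq_of_ae_eq_trim hae] with ω hω
  exact ⟨hω⟩

lemma integral_transitionMeasure (h : IsTransitionDensity μ X i g) (w : ℝ → ℝ) (z : ℝ) :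
    ∫ y, w y ∂(transitionMeasure g z) = ∫ y, w y * g z y := by
  have hm : Measurable (g z) := h.measurable.comp measurable_prodMk_left
  rw [transitionMeasure, integral_withDensity_eq_integral_toReal_smul (by fun_prop) (by simp)]
  refine integral_congr_ae (ae_of_all _ fun y => ?_)
  simp [ENNReal.toReal_ofReal (h.nonneg z y), mul_comm]

end IsTransitionDensity
end Martingale

section Martingale
variable {Ω : Type*} [MeasurableSpace Ω] {μ : Measure Ω}
  {X : ℕ → Ω → ℝ} {i : ℕ} {g : ℝ → ℝ → ℝ}

lemma lintegral_ofReal_add_const {α : Type*} [MeasurableSpace α] {κ : Measure α}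
    [IsProbabilityMeasure κ] {f : α → ℝ} (hf : Integrable f κ) {b : ℝ}
    (hb : ∀ᵐ x ∂κ, |f x| ≤ b) :
    0 ≤ (∫ x, f x ∂κ) + b ∧
      ∫⁻ x, ENNReal.ofReal (f x + b) ∂κ = ENNReal.ofReal ((∫ x, f x ∂κ) + b) := by
  have hfb : Integrable (fun x => f x + b) κ := hf.add (integrable_const b)
  have h0 : 0 ≤ᵐ[κ] fun x => f x + b := by
    filter_upwards [hb] with x hx
    change 0 ≤ f x + b
    linarith [(abs_le.1 hx).1]
  have hint : ∫ x, (f x + b) ∂κ = (∫ x, f x ∂κ) + b := by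
    rw [integral_add hf (integrable_const b)]; simp
  rw [← hint]
  exact ⟨integral_nonneg_of_ae h0, (ofReal_integral_eq_lintegral_ofReal hfb h0).symm⟩

namespace IsTransitionDensity

lemma measurable_integral (h : IsTransitionDensity μ X i g) {w : ℝ → ℝ} (hw : Measurable w) :
    Measurable fun z => ∫ y, w y * g z y := by
  have : StronglyMeasurable fun p : ℝ × ℝ => w p.2 * g p.1 p.2 :=
    ((hw.comp measurable_snd).mul h.measurable).stronglyMeasurable
  exact this.integral_prod_right'.measurable

lemma integral_comp [IsProbabilityMeasure μ] (hX : ∀ j, Measurable (X j)) (hi : 2 ≤ i)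
    (h : IsTransitionDensity μ X i g) {w : ℝ → ℝ} (hw : Measurable w) {b : ℝ}
    (hb : ∀ y, |w y| ≤ b) :
    ∫ ω, w (X i ω) ∂μ = ∫ ω, (∫ y, w y * g (X (i - 1) ω) y) ∂μ := by
  have hm := (h.measurable_integral hw).comp (hX (i - 1))
  have hprob := h.ae_isProbabilityMeasure hX hi
  have hmb : ∀ᵐ ω ∂μ, |∫ y, w y * g (X (i - 1) ω) y| ≤ b := by
    filter_upwards [hprob] with ω hω
    rw [← h.integral_transitionMeasure]
    have := norm_integral_le_of_norm_le_const (μ := transitionMeasure g (X (i - 1) ω))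
      (f := w) (C := b) (ae_of_all _ hb)
    simpa using this
  have hi1 : Integrable (fun ω => w (X i ω)) μ :=
    integrable_of_abs_le (hw.comp (hX i)) fun ω => hb _
  have hi2 : Integrable (fun ω => ∫ y, w y * g (X (i - 1) ω) y) μ :=
    Integrable.of_bound hm.aestronglyMeasurable b hmb
  -- Shifting `w` by `b` makes it nonnegative, so that the formula for lower integrals applies.
  have hl := h.lintegral_mul hX (H := fun _ => 1) measurable_const
    (ψ := fun y => ENNReal.ofReal (w y + b)) (by fun_prop)
  simp only [one_mul] at hl
  have hr : ∫⁻ ω, ∫⁻ y, ENNReal.ofReal (w y + b) ∂(transitionMeasure g (X (i - 1) ω)) ∂μ =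
      ∫⁻ ω, ENNReal.ofReal ((∫ y, w y * g (X (i - 1) ω) y) + b) ∂μ := by
    refine lintegral_congr_ae ?_
    filter_upwards [hprob] with ω hω
    have hwi : Integrable w (transitionMeasure g (X (i - 1) ω)) := integrable_of_abs_le hw hb
    rw [(lintegral_ofReal_add_const hwi (ae_of_all _ hb)).2, h.integral_transitionMeasure]
  obtain ⟨h1, h1'⟩ := lintegral_ofReal_add_const hi1 (ae_of_all _ fun ω => hb (X i ω))
  obtain ⟨h2, h2'⟩ := lintegral_ofReal_add_const hi2 hmb
  rw [hr, h1', h2', ENNReal.ofReal_eq_ofReal_iff h1 h2] at hl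
  linarith

/-- A conditional Bernstein bound: given the past, the variable `w(X_i)`, centred at its
conditional expectation, has moment generating function at most `exp (t² v)`. -/
lemma lintegral_mul_exp_le [IsProbabilityMeasure μ] (hX : ∀ j, Measurable (X j)) (hi : 2 ≤ i)
    (h : IsTransitionDensity μ X i g) {w : ℝ → ℝ} (hw : Measurable w) {b v : ℝ}
    (hb : ∀ y, |w y| ≤ b) (hv : ∀ z, ∫ y, w y ^ 2 * g z y ≤ v) {t : ℝ} (ht : |t| * (2 * b) ≤ 1)
    {H : Ω → ℝ≥0∞} (hH : Measurable[observedPast X i] H) :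
    ∫⁻ ω, H ω * ENNReal.ofReal
        (Real.exp (t * (w (X i ω) - ∫ y, w y * g (X (i - 1) ω) y))) ∂μ ≤
      (∫⁻ ω, H ω ∂μ) * ENNReal.ofReal (Real.exp (t ^ 2 * v)) := by
  set m : ℝ → ℝ := fun z => ∫ y, w y * g z y with hmdef
  have hm : Measurable m := h.measurable_integral hw
  have hmp : Measurable[observedPast X i] fun ω => m (X (i - 1) ω) :=
    hm.comp (measurable_observedPast (Finset.mem_Ico.2 ⟨by omega, by omega⟩))
  have hH' : Measurable[observedPast X i]
      fun ω => H ω * ENNReal.ofReal (Real.exp (-(t * m (X (i - 1) ω)))) :=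
    hH.mul ((Measurable.exp (hmp.const_mul t).neg).ennreal_ofReal)
  have hl := h.lintegral_mul hX hH' (ψ := fun y => ENNReal.ofReal (Real.exp (t * w y)))
    (by fun_prop)
  calc ∫⁻ ω, H ω * ENNReal.ofReal (Real.exp (t * (w (X i ω) - m (X (i - 1) ω)))) ∂μ
      = ∫⁻ ω, H ω * ENNReal.ofReal (Real.exp (-(t * m (X (i - 1) ω)))) *
          ENNReal.ofReal (Real.exp (t * w (X i ω))) ∂μ := by
        refine lintegral_congr fun ω => ?_
        rw [mul_assoc, ← ENNReal.ofReal_mul (Real.exp_pos _).le, ← Real.exp_add]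
        congr 3; ring
    _ = _ := hl
    _ ≤ ∫⁻ ω, H ω * ENNReal.ofReal (Real.exp (t ^ 2 * v)) ∂μ := by
        refine lintegral_mono_ae ?_
        filter_upwards [h.ae_isProbabilityMeasure hX hi] with ω hω
        set z := X (i - 1) ω
        have hmz : m z = ∫ y, w y ∂(transitionMeasure g z) :=
          (h.integral_transitionMeasure w z).symm
        have hwi : Integrable w (transitionMeasure g z) := integrable_of_abs_le hw hb
        have hw2i : Integrable (fun y => w y ^ 2) (transitionMeasure g z) :=
          integrable_of_abs_le (b := b ^ 2) (hw.pow_const 2) fun x => by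
            rw [abs_pow]; exact pow_le_pow_left₀ (abs_nonneg _) (hb x) 2
        have hmb : |m z| ≤ b := by
          rw [hmz]
          simpa using norm_integral_le_of_norm_le_const (μ := transitionMeasure g z)
            (f := w) (C := b) (ae_of_all _ hb)
        have hB : HasBernsteinMGF (transitionMeasure g z) (fun y => w y - m z) (2 * b) v := by
          refine HasBernsteinMGF.of_bounded (hw.sub_const _) (fun y => ?_) ?_ ?_
          · linarith [abs_sub (w y) (m z), hb y]
          · rw [integral_sub hwi (integrable_const _), hmz]; simp
          · calc ∫ y, (w y - m z) ^ 2 ∂(transitionMeasure g z)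
                = ∫ y, (w y ^ 2 - (2 * m z) * w y + m z ^ 2) ∂(transitionMeasure g z) := by
                  congr 1; ext y; ring
              _ = (∫ y, w y ^ 2 ∂(transitionMeasure g z)) - m z ^ 2 := by
                  have hlin : Integrable (fun y => w y ^ 2 - (2 * m z) * w y)
                    (transitionMeasure g z) := hw2i.sub (hwi.const_mul _)
                  rw [integral_add hlin (integrable_const _),
                    integral_sub hw2i (hwi.const_mul _), integral_const_mul, ← hmz]
                  simp
                  ring
              _ ≤ ∫ y, w y ^ 2 ∂(transitionMeasure g z) := by linarith [sq_nonneg (m z)]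
              _ ≤ v := by rw [h.integral_transitionMeasure]; exact hv z
        rw [mul_assoc, ← lintegral_const_mul _ (by fun_prop)]
        gcongr
        refine le_trans (le_of_eq ?_) (hB t ht)
        refine lintegral_congr fun y => ?_
        rw [← ENNReal.ofReal_mul (Real.exp_pos _).le, ← Real.exp_add]
        congr 2; ring
    _ = _ := lintegral_mul_const _ (hH.mono (observedPast_le hX i) le_rfl)

end IsTransitionDensity

/-- A Bernstein bound for sums of martingale differences, by conditioning on the past of the last
summand. -/
lemma hasBernsteinMGF_martingale [IsProbabilityMeasure μ]
    (hX : ∀ j, Measurable (X j)) {n : ℕ} {g : ℕ → ℝ → ℝ → ℝ}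
    (hg : ∀ i ∈ Finset.Icc 2 n, IsTransitionDensity μ X i (g i)) {w : ℕ → ℝ → ℝ}
    (hw : ∀ i, Measurable (w i)) {b : ℝ} {v : ℕ → ℝ} (hb : ∀ i y, |w i y| ≤ b)
    (hv : ∀ i ∈ Finset.Icc 2 n, ∀ z, ∫ y, w i y ^ 2 * g i z y ≤ v i) :
    HasBernsteinMGF μ
      (fun ω => ∑ i ∈ Finset.Icc 2 n, (w i (X i ω) - ∫ y, w i y * g i (X (i - 1) ω) y))
      (2 * b) (∑ i ∈ Finset.Icc 2 n, v i) := by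
  intro t ht
  induction n with
  | zero => simp
  | succ n ih =>
    rcases Nat.lt_or_ge n 1 with hn | hn
    · obtain rfl : n = 0 := by omega
      simp
    have hsub : ∀ i ∈ Finset.Icc 2 n, i ∈ Finset.Icc 2 (n + 1) := fun i hi => by
      simp only [Finset.mem_Icc] at hi ⊢; omega
    have hmem : n + 1 ∈ Finset.Icc 2 (n + 1) := by simp only [Finset.mem_Icc]; omega
    have ih' := ih (fun i hi => hg i (hsub i hi)) (fun i hi => hv i (hsub i hi))
    have hmeas : Measurable[observedPast X (n + 1)] fun ω => ENNReal.ofReal (Real.exp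
        (t * ∑ i ∈ Finset.Icc 2 n, (w i (X i ω) - ∫ y, w i y * g i (X (i - 1) ω) y))) := by
      refine Measurable.ennreal_ofReal (Measurable.exp (Measurable.const_mul ?_ t))
      refine Finset.measurable_sum _ fun i hi => ?_
      have hi' := Finset.mem_Icc.1 hi
      refine ((hw i).comp (measurable_observedPast (Finset.mem_Ico.2 ⟨by omega, by omega⟩))).sub
        (((hg i (hsub i hi)).measurable_integral (hw i)).comp
          (measurable_observedPast (Finset.mem_Ico.2 ⟨by omega, by omega⟩)))
    have hstep := (hg (n + 1) hmem).lintegral_mul_exp_le hX (by omega) (hw (n + 1)) (hb (n + 1))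
      (hv (n + 1) hmem) ht hmeas
    have hIcc : ∀ f : ℕ → ℝ, ∑ i ∈ Finset.Icc 2 (n + 1), f i =
        ∑ i ∈ Finset.Icc 2 n, f i + f (n + 1) := fun f =>
      Finset.sum_Icc_succ_top (by omega) f
    simp only [hIcc, mul_add, Real.exp_add]
    simp only [ENNReal.ofReal_mul (Real.exp_pos _).le]
    exact hstep.trans (by gcongr)

end Martingale

/-! ### Averaging over the remote past -/

section Smoothing
variable {E : Type*} [MeasurableSpace E] (P : Measure E)

/-- `φ` averaged over all entries of the path but the first `q`, that is, the conditional
expectation of `φ` given the last `q` innovations. -/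
noncomputable def smooth (q : ℕ) (φ : (ℕ → E) → ℝ) (e : ℕ → E) : ℝ :=
  ∫ e', φ (splice q e e') ∂(pathLaw P)

/-- The conditional expectation, given the path `e`, of the truncated distance between `J` at `e`
and `J` at the path with the entries from `q` on resampled. -/
noncomputable def spliceErr (J : (ℕ → E) → ℝ) (q : ℕ) (e : ℕ → E) : ℝ≥0∞ :=
  ∫⁻ e', truncDist (J e) (J (splice q e e')) ∂(pathLaw P)

lemma smooth_congr {q : ℕ} (φ : (ℕ → E) → ℝ) {e f : ℕ → E} (h : ∀ l < q, e l = f l) :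
    smooth P q φ e = smooth P q φ f := by
  have : splice q e = splice q f := by
    ext e' l
    simp only [splice]
    split_ifs with hl
    · exact h l hl
    · rfl
  simp only [smooth, this]

variable [IsProbabilityMeasure P] {φ : (ℕ → E) → ℝ} {C : ℝ}

lemma measurable_smooth (q : ℕ) (hφ : Measurable φ) : Measurable (smooth P q φ) :=
  (hφ.comp (measurable_splice q)).stronglyMeasurable.integral_prod_right'.measurable

lemma measurable_spliceErr {J : (ℕ → E) → ℝ} (hJ : Measurable J) (q : ℕ) :
    Measurable (spliceErr P J q) :=
  Measurable.lintegral_prod_right' (f := fun p => truncDist (J p.1) (J (splice q p.1 p.2)))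
    (measurable_truncDist (hJ.comp measurable_fst) (hJ.comp (measurable_splice q)))

lemma lintegral_spliceErr {J : (ℕ → E) → ℝ} (hJ : Measurable J) (q : ℕ) :
    ∫⁻ e, spliceErr P J q e ∂(pathLaw P) = spliceDist P J q :=
  (lintegral_prod _ (measurable_truncDist (hJ.comp measurable_fst)
    (hJ.comp (measurable_splice q))).aemeasurable).symm

lemma abs_smooth_le (q : ℕ) (hb : ∀ e, |φ e| ≤ C) (e : ℕ → E) : |smooth P q φ e| ≤ C := by
  simpa [smooth] using norm_integral_le_of_norm_le_const (μ := pathLaw P)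
    (f := fun e' => φ (splice q e e')) (C := C) (ae_of_all _ fun _ => hb _)

lemma integral_smooth (q : ℕ) (hφ : Measurable φ) (hb : ∀ e, |φ e| ≤ C) :
    ∫ e, smooth P q φ e ∂(pathLaw P) = ∫ e, φ e ∂(pathLaw P) := by
  have hint : Integrable (fun p : (ℕ → E) × (ℕ → E) => φ (splice q p.1 p.2))
      ((pathLaw P).prod (pathLaw P)) :=
    integrable_of_abs_le (hφ.comp (measurable_splice q)) fun _ => hb _
  have h := integral_prod _ hint
  have h2 := integral_map (μ := (pathLaw P).prod (pathLaw P)) (measurable_splice q).aemeasurable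
    (f := φ) hφ.aestronglyMeasurable
  rw [(measurePreserving_splice P q).map_eq] at h2
  rw [h2, h]
  rfl

lemma integrable_comp_splice (q : ℕ) (hφ : Measurable φ) (hb : ∀ e, |φ e| ≤ C) (e : ℕ → E) :
    Integrable (fun e' => φ (splice q e e')) (pathLaw P) :=
  integrable_of_abs_le (hφ.comp ((measurable_splice q).comp measurable_prodMk_left))
    fun _ => hb _

/-- The error of averaging `f ∘ J` is controlled by a quantity that involves `f` only through its
bound and its Lipschitz constant. -/
lemma enorm_sub_smooth_le {J : (ℕ → E) → ℝ} (hJ : Measurable J) {f : ℝ → ℝ} (hf : Measurable f)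
    (hb : ∀ x, |f x| ≤ C) {L : ℝ} (hL : ∀ a b, ‖f a - f b‖ₑ ≤ ENNReal.ofReal L * truncDist a b)
    (q : ℕ) (e : ℕ → E) :
    ‖f (J e) - smooth P q (f ∘ J) e‖ₑ ≤ ENNReal.ofReal L * spliceErr P J q e := by
  have hint := integrable_comp_splice P q (hf.comp hJ) (fun e => hb (J e)) e
  have h : f (J e) - smooth P q (f ∘ J) e =
      ∫ e', (f (J e) - (f ∘ J) (splice q e e')) ∂(pathLaw P) := by
    rw [integral_sub (integrable_const _) hint]; simp [smooth]
  rw [h]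
  refine (enorm_integral_le_lintegral_enorm _).trans ?_
  rw [spliceErr, ← lintegral_const_mul]
  · exact lintegral_mono fun e' => hL _ _
  · exact measurable_truncDist measurable_const
      (hJ.comp ((measurable_splice q).comp measurable_prodMk_left))

/-- Averages that keep `q` and `k` innovations are close in `L¹`. -/
lemma lintegral_enorm_smooth_sub_smooth_le {J : (ℕ → E) → ℝ} (hJ : Measurable J) {f : ℝ → ℝ}
    (hf : Measurable f) (hb : ∀ x, |f x| ≤ C) {L : ℝ}
    (hL : ∀ a b, ‖f a - f b‖ₑ ≤ ENNReal.ofReal L * truncDist a b) {k q : ℕ} (hkq : k ≤ q) :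
    ∫⁻ e, ‖smooth P q (f ∘ J) e - smooth P k (f ∘ J) e‖ₑ ∂(pathLaw P) ≤
      ENNReal.ofReal L * ∑ l ∈ Finset.Ico k q, updateDist P J l := by
  have hmeas : Measurable fun p : (ℕ → E) × (ℕ → E) =>
      truncDist (J (splice q p.1 p.2)) (J (splice k p.1 p.2)) :=
    measurable_truncDist (hJ.comp (measurable_splice q)) (hJ.comp (measurable_splice k))
  calc ∫⁻ e, ‖smooth P q (f ∘ J) e - smooth P k (f ∘ J) e‖ₑ ∂(pathLaw P)
      ≤ ∫⁻ e, ENNReal.ofReal L *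
          ∫⁻ e', truncDist (J (splice q e e')) (J (splice k e e')) ∂(pathLaw P) ∂(pathLaw P) := by
        refine lintegral_mono fun e => ?_
        have hint := fun q => integrable_comp_splice P q (hf.comp hJ) (fun e => hb (J e)) e
        have h : smooth P q (f ∘ J) e - smooth P k (f ∘ J) e =
            ∫ e', ((f ∘ J) (splice q e e') - (f ∘ J) (splice k e e')) ∂(pathLaw P) := by
          rw [integral_sub (hint q) (hint k)]; rfl
        rw [h]
        refine (enorm_integral_le_lintegral_enorm _).trans ?_
        rw [← lintegral_const_mul]
        · exact lintegral_mono fun e' => hL (J (splice q e e')) (J (splice k e e'))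
        · exact measurable_truncDist
            (hJ.comp ((measurable_splice q).comp measurable_prodMk_left))
            (hJ.comp ((measurable_splice k).comp measurable_prodMk_left))
    _ = ENNReal.ofReal L * ∫⁻ p, truncDist (J (splice q p.1 p.2)) (J (splice k p.1 p.2))
          ∂((pathLaw P).prod (pathLaw P)) := by
        rw [lintegral_const_mul _ hmeas.lintegral_prod_right', lintegral_prod _ hmeas.aemeasurable]
    _ ≤ _ := by gcongr; exact lintegral_truncDist_splice_le P hJ hkq

end Smoothing

section Innovations
variable {Ω E : Type*} [MeasurableSpace E]

/-- The sigma-algebra generated by the innovations with time index in `A`. -/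
abbrev innovationSigma (ε : ℤ → Ω → E) (A : Set ℤ) : MeasurableSpace Ω :=
  ⨆ a ∈ A, MeasurableSpace.comap (ε a) inferInstance

variable {ε : ℤ → Ω → E}

lemma measurable_innovationSigma {A : Set ℤ} {a : ℤ} (ha : a ∈ A) :
    Measurable[innovationSigma ε A] (ε a) :=
  (comap_measurable (ε a)).mono
    (le_iSup₂ (f := fun a (_ : a ∈ A) => MeasurableSpace.comap (ε a) inferInstance) a ha) le_rfl

lemma measurable_smooth_pastInnovations (P : Measure E) [IsProbabilityMeasure P] {A : Set ℤ}
    {j : ℤ} {q : ℕ} (hA : ∀ l : ℕ, l < q → j - l ∈ A) {φ : (ℕ → E) → ℝ} (hφ : Measurable φ) :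
    Measurable[innovationSigma ε A] fun ω => smooth P q φ (pastInnovations ε j ω) := by
  obtain ⟨e₀⟩ := nonempty_of_isProbabilityMeasure P
  -- Entries from `q` on do not matter and may be frozen at an arbitrary point.
  set T : Ω → ℕ → E := fun ω l => if l < q then ε (j - l) ω else e₀ with hT
  have hTm : Measurable[innovationSigma ε A] T := by
    refine @measurable_pi_lambda _ _ _ (innovationSigma ε A) _ _ fun l => ?_
    by_cases hl : l < q
    · simp only [hT, hl, if_true]
      exact measurable_innovationSigma (hA l hl)
    · simp only [hT, hl, if_false]
      exact measurable_const
  have h : (fun ω => smooth P q φ (pastInnovations ε j ω)) = fun ω => smooth P q φ (T ω) := by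
    ext ω
    refine smooth_congr P φ fun l hl => ?_
    simp [hT, hl, pastInnovations]
  rw [h]
  exact (measurable_smooth P q hφ).comp hTm

variable [MeasurableSpace Ω] {μ : Measure Ω}

lemma innovationSigma_le (hε : ∀ k, Measurable (ε k)) (A : Set ℤ) :
    innovationSigma ε A ≤ (inferInstance : MeasurableSpace Ω) :=
  iSup₂_le fun a _ => (hε a).comap_le

lemma indepFun_of_disjoint (hε : ∀ k, Measurable (ε k)) (hind : iIndepFun ε μ) {A B : Set ℤ}
    (hAB : Disjoint A B) {Y Z : Ω → ℝ} (hY : Measurable[innovationSigma ε A] Y)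
    (hZ : Measurable[innovationSigma ε B] Z) : IndepFun Y Z μ := by
  have h : Indep (innovationSigma ε A) (innovationSigma ε B) μ :=
    indep_iSup_of_disjoint (fun k => (hε k).comap_le) hind hAB
  exact indep_of_indep_of_le_left (indep_of_indep_of_le_right h hZ.comap_le) hY.comap_le

end Innovations

/-! ### Independent blocks -/

/-- In an interval of length `q`, every distance from a given point occurs at most twice.
Truncated subtraction makes `(i - j) + (j - i)` the distance of `i` and `j`. -/
lemma sum_comp_natDist_le {I : Finset ℕ} {u q : ℕ} (hI : I ⊆ Finset.Ico u (u + q)) {c : ℕ → ℝ}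
    (hc : ∀ k, 0 ≤ c k) {j : ℕ} (hj : j ∈ I) :
    ∑ i ∈ I, c ((i - j) + (j - i)) ≤ 2 * ∑ k ∈ Finset.range q, c k := by
  have key : ∀ (s : Finset ℕ) (h : ℕ → ℕ), Set.InjOn h s → (∀ i ∈ s, h i ∈ Finset.range q) →
      ∑ i ∈ s, c (h i) ≤ ∑ k ∈ Finset.range q, c k := fun s h hinj hmem => by
    rw [← Finset.sum_image (f := c) (g := h) hinj]
    exact Finset.sum_le_sum_of_subset_of_nonneg (Finset.image_subset_iff.2 hmem)
      fun k _ _ => hc k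
  have hj' := Finset.mem_Ico.1 (hI hj)
  rw [← Finset.sum_filter_add_sum_filter_not I (fun i => i ≤ j), two_mul]
  refine add_le_add (key _ _ (fun a ha b hb hab => ?_) fun i hi => ?_)
    (key _ _ (fun a ha b hb hab => ?_) fun i hi => ?_)
  · simp only [Finset.coe_filter, Set.mem_ofPred_eq] at ha hb hab; omega
  · have h1 := Finset.mem_filter.1 hi
    have h2 := Finset.mem_Ico.1 (hI h1.1)
    rw [Finset.mem_range]; omega
  · simp only [Finset.coe_filter, Set.mem_ofPred_eq] at ha hb hab; omega
  · have h1 := Finset.mem_filter.1 hi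
    have h2 := Finset.mem_Ico.1 (hI h1.1)
    rw [Finset.mem_range]; omega

section Blocks
variable {Ω E : Type*} [MeasurableSpace E] {ε : ℤ → Ω → E} (P : Measure E) [IsProbabilityMeasure P]

/-- The centred smoothed variable at time `j`: a function of `ε_j, …, ε_{j-q+1}`. -/
noncomputable def smoothDev (ε : ℤ → Ω → E) (q : ℕ) (φ : (ℕ → E) → ℝ) (j : ℤ) (ω : Ω) : ℝ :=
  smooth P q φ (pastInnovations ε j ω) - ∫ e, φ e ∂(pathLaw P)

variable {φ ψ : (ℕ → E) → ℝ} {C : ℝ} {q : ℕ}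

lemma abs_smoothDev_le (hb : ∀ e, |φ e| ≤ C) (j : ℤ) (ω : Ω) :
    |smoothDev P ε q φ j ω| ≤ 2 * C := by
  have h1 := abs_smooth_le P q hb (pastInnovations ε j ω)
  have h2 : |∫ e, φ e ∂(pathLaw P)| ≤ C := by
    simpa using norm_integral_le_of_norm_le_const (μ := pathLaw P) (f := φ) (C := C)
      (ae_of_all _ hb)
  rw [smoothDev]
  linarith [abs_sub (smooth P q φ (pastInnovations ε j ω)) (∫ e, φ e ∂(pathLaw P))]

lemma measurable_smoothDev_innovationSigma (hφ : Measurable φ) {A : Set ℤ} {j : ℤ}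
    (hA : ∀ l : ℕ, l < q → j - l ∈ A) :
    Measurable[innovationSigma ε A] (smoothDev P ε q φ j) :=
  (measurable_smooth_pastInnovations P hA hφ).sub measurable_const

variable [MeasurableSpace Ω] {μ : Measure Ω} [IsProbabilityMeasure μ]

lemma measurable_smoothDev (hε : ∀ k, Measurable (ε k)) (hφ : Measurable φ) (j : ℤ) :
    Measurable (smoothDev P ε q φ j) :=
  (measurable_smoothDev_innovationSigma P hφ (A := Set.univ) fun _ _ => trivial).mono
    (innovationSigma_le hε _) le_rfl

lemma integral_smoothDev (hε : ∀ k, Measurable (ε k))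
    (hlaw : ∀ i, μ.map (pastInnovations ε i) = pathLaw P) (hφ : Measurable φ)
    (hb : ∀ e, |φ e| ≤ C) (j : ℤ) : ∫ ω, smoothDev P ε q φ j ω ∂μ = 0 := by
  have hs := measurable_smooth P q hφ
  have hp := measurable_pastInnovations hε j
  have hi : Integrable (fun ω => smooth P q φ (pastInnovations ε j ω)) μ :=
    integrable_of_abs_le (hs.comp hp) fun ω => abs_smooth_le P q hb _
  have h := integral_map (μ := μ) hp.aemeasurable (f := smooth P q φ) hs.aestronglyMeasurable
  rw [hlaw, integral_smooth P q hφ hb] at h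
  simp only [smoothDev]
  rw [integral_sub hi (integrable_const _), ← h]
  simp

/-- The covariance at lag `k`: averaging the later variable over all but its last `k` innovations
makes it independent of the earlier one. -/
lemma abs_integral_smoothDev_mul_le (hε : ∀ k, Measurable (ε k)) (hind : iIndepFun ε μ)
    (hlaw : ∀ i, μ.map (pastInnovations ε i) = pathLaw P) (hφ : Measurable φ)
    (hψ : Measurable ψ) (hφb : ∀ e, |φ e| ≤ C) (hψb : ∀ e, |ψ e| ≤ C) {i j : ℤ} {k : ℕ}
    (hij : j = i + k) {τ : ℝ} (hτ0 : 0 ≤ τ)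
    (hτ : ∫⁻ e, ‖smooth P q ψ e - smooth P k ψ e‖ₑ ∂(pathLaw P) ≤ ENNReal.ofReal τ) :
    |∫ ω, smoothDev P ε q φ i ω * smoothDev P ε q ψ j ω ∂μ| ≤ 2 * C * τ := by
  set Y := smoothDev P ε q φ i with hY
  set Z := smoothDev P ε q ψ j with hZ
  -- `W` uses innovations after time `i` only, hence is independent of `Y`.
  set W := smoothDev P ε k ψ j with hW
  have hYm : Measurable Y := measurable_smoothDev P hε hφ i
  have hZm : Measurable Z := measurable_smoothDev P hε hψ j
  have hWm : Measurable W := measurable_smoothDev P hε hψ j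
  have hYb : ∀ ω, |Y ω| ≤ 2 * C := abs_smoothDev_le P hφb i
  have hZb : ∀ ω, |Z ω| ≤ 2 * C := abs_smoothDev_le P hψb j
  have hWb : ∀ ω, |W ω| ≤ 2 * C := abs_smoothDev_le P hψb j
  have hindep : IndepFun Y W μ := by
    refine indepFun_of_disjoint hε hind (A := Set.Iic i) (B := Set.Ioi i) ?_
      (measurable_smoothDev_innovationSigma P hφ fun l _ => ?_)
      (measurable_smoothDev_innovationSigma P hψ fun l hl => ?_)
    · exact (Set.Iic_disjoint_Ioi le_rfl)
    · simp
    · rw [Set.mem_Ioi, hij]; omega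
  have hC0 : 0 ≤ 2 * C := by
    obtain ⟨ω⟩ := nonempty_of_isProbabilityMeasure μ
    exact (abs_nonneg _).trans (hYb ω)
  have hprod : ∫ ω, Y ω * W ω ∂μ = 0 := by
    have := hindep.integral_fun_mul_eq_mul_integral hYm.aestronglyMeasurable
      hWm.aestronglyMeasurable
    rw [this, integral_smoothDev P hε hlaw hφ hφb, zero_mul]
  have hmulb : ∀ {U V : Ω → ℝ}, (∀ ω, |U ω| ≤ 2 * C) → (∀ ω, |V ω| ≤ 2 * C) →
      ∀ ω, |U ω * V ω| ≤ (2 * C) * (2 * C) := fun hU hV ω => by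
    rw [abs_mul]; exact mul_le_mul (hU ω) (hV ω) (abs_nonneg _) hC0
  have hYZ : Integrable (fun ω => Y ω * Z ω) μ :=
    integrable_of_abs_le (hYm.mul hZm) (hmulb hYb hZb)
  have hYW : Integrable (fun ω => Y ω * W ω) μ :=
    integrable_of_abs_le (hYm.mul hWm) (hmulb hYb hWb)
  have heq : ∫ ω, Y ω * Z ω ∂μ = ∫ ω, Y ω * (Z ω - W ω) ∂μ := by
    simp only [mul_sub]
    rw [integral_sub hYZ hYW, hprod, sub_zero]
  have hdiff : Integrable (fun ω => Z ω - W ω) μ :=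
    (integrable_of_abs_le hZm hZb).sub (integrable_of_abs_le hWm hWb)
  have hL1 : ∫ ω, |Z ω - W ω| ∂μ ≤ τ := by
    have hsm : Measurable fun e => ‖smooth P q ψ e - smooth P k ψ e‖ₑ :=
      ((measurable_smooth P q hψ).sub (measurable_smooth P k hψ)).enorm
    rw [← hlaw j, lintegral_map hsm (measurable_pastInnovations hε j)] at hτ
    have h1 : ∫ ω, |Z ω - W ω| ∂μ = (∫⁻ ω, ‖Z ω - W ω‖ₑ ∂μ).toReal :=
      integral_norm_eq_lintegral_enorm hdiff.aestronglyMeasurable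
    rw [h1]
    refine ENNReal.toReal_le_of_le_ofReal hτ0 (le_trans (le_of_eq ?_) hτ)
    refine lintegral_congr fun ω => ?_
    simp [hZ, hW, smoothDev]
  rw [heq]
  calc |∫ ω, Y ω * (Z ω - W ω) ∂μ| ≤ ∫ ω, |Y ω * (Z ω - W ω)| ∂μ := abs_integral_le_integral_abs
    _ ≤ ∫ ω, 2 * C * |Z ω - W ω| ∂μ := by
        refine integral_mono_of_nonneg (ae_of_all _ fun _ => abs_nonneg _)
          (hdiff.abs.const_mul _) (ae_of_all _ fun ω => ?_)
        simp only [abs_mul]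
        exact mul_le_mul_of_nonneg_right (hYb ω) (abs_nonneg _)
    _ ≤ 2 * C * τ := by rw [integral_const_mul]; gcongr

variable {I : Finset ℕ} {φ : ℕ → (ℕ → E) → ℝ} {a τ : ℕ → ℝ} {A₀ Γ : ℝ}

/-- Within a block of length `q` only boundedness and the variance are used; the latter is bounded
by summing the covariances. -/
lemma hasBernsteinMGF_block (hε : ∀ k, Measurable (ε k)) (hind : iIndepFun ε μ)
    (hlaw : ∀ i, μ.map (pastInnovations ε i) = pathLaw P) {u : ℕ}
    (hI : I ⊆ Finset.Ico u (u + q)) (hφ : ∀ j ∈ I, Measurable (φ j)) (hC : 0 ≤ C)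
    (hφb : ∀ j ∈ I, ∀ e, |φ j e| ≤ C) (hτ0 : ∀ k, 0 ≤ τ k)
    (hτ : ∀ j ∈ I, ∀ k ∈ Finset.Ico 1 q,
      ∫⁻ e, ‖smooth P q (φ j) e - smooth P k (φ j) e‖ₑ ∂(pathLaw P) ≤ ENNReal.ofReal (τ k))
    (ha : ∀ j ∈ I, |a j| ≤ A₀) (hA₀ : 0 ≤ A₀)
    (hΓ : 4 * C ^ 2 + 2 * C * ∑ k ∈ Finset.Ico 1 q, τ k ≤ Γ) :
    HasBernsteinMGF μ (fun ω => ∑ j ∈ I, a j * smoothDev P ε q (φ j) j ω)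
      (q * A₀ * (2 * C)) (A₀ * (2 * Γ) * ∑ j ∈ I, |a j|) := by
  have hYm : ∀ j ∈ I, Measurable (smoothDev P ε q (φ j) j) := fun j hj =>
    measurable_smoothDev P hε (hφ j hj) j
  have hYb : ∀ j ∈ I, ∀ ω, |smoothDev P ε q (φ j) j ω| ≤ 2 * C := fun j hj =>
    abs_smoothDev_le P (hφb j hj) j
  have hYi : ∀ j ∈ I, Integrable (smoothDev P ε q (φ j) j) μ := fun j hj =>
    integrable_of_abs_le (hYm j hj) (hYb j hj)
  -- `c k` bounds the covariance at lag `k`.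
  set c : ℕ → ℝ := fun k => if k = 0 then 4 * C ^ 2 else 2 * C * τ k with hc
  have hc0 : ∀ k, 0 ≤ c k := fun k => by
    have := hτ0 k
    simp only [hc]; split_ifs <;> positivity
  have hmulb : ∀ i ∈ I, ∀ j ∈ I, ∀ ω,
      |smoothDev P ε q (φ i) i ω * smoothDev P ε q (φ j) j ω| ≤ 4 * C ^ 2 := fun i hi j hj ω => by
    rw [abs_mul]
    calc _ ≤ (2 * C) * (2 * C) :=
          mul_le_mul (hYb i hi ω) (hYb j hj ω) (abs_nonneg _) (by positivity)
      _ = _ := by ring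
  have hmuli : ∀ i ∈ I, ∀ j ∈ I,
      Integrable (fun ω => smoothDev P ε q (φ i) i ω * smoothDev P ε q (φ j) j ω) μ :=
    fun i hi j hj => integrable_of_abs_le ((hYm i hi).mul (hYm j hj)) (hmulb i hi j hj)
  have hcov' : ∀ i ∈ I, ∀ j ∈ I, i < j →
      |∫ ω, smoothDev P ε q (φ i) i ω * smoothDev P ε q (φ j) j ω ∂μ| ≤ c (j - i) := by
    intro i hi j hj h
    have h1 := Finset.mem_Ico.1 (hI hi)
    have h2 := Finset.mem_Ico.1 (hI hj)
    have hne : j - i ≠ 0 := by omega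
    simp only [hc, if_neg hne]
    exact abs_integral_smoothDev_mul_le P hε hind hlaw (hφ i hi) (hφ j hj) (hφb i hi) (hφb j hj)
      (k := j - i) (by omega) (hτ0 _) (hτ j hj _ (Finset.mem_Ico.2 ⟨by omega, by omega⟩))
  have hcov : ∀ i ∈ I, ∀ j ∈ I,
      |∫ ω, smoothDev P ε q (φ i) i ω * smoothDev P ε q (φ j) j ω ∂μ| ≤
        c ((j - i) + (i - j)) := by
    intro i hi j hj
    rcases lt_trichotomy i j with h | rfl | h
    · rw [show (j - i) + (i - j) = j - i by omega]; exact hcov' i hi j hj h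
    · simp only [Nat.sub_self, add_zero, hc, if_true]
      simpa using norm_integral_le_of_norm_le_const (μ := μ)
        (f := fun ω => smoothDev P ε q (φ i) i ω * smoothDev P ε q (φ i) i ω)
        (ae_of_all _ (hmulb i hi i hi))
    · rw [show (j - i) + (i - j) = i - j by omega]
      simp only [mul_comm (smoothDev P ε q (φ i) i _)]
      exact hcov' j hj i hi h
  have hΓ' : ∑ k ∈ Finset.range q, c k ≤ Γ := by
    refine le_trans ?_ hΓ
    rcases Nat.eq_zero_or_pos q with rfl | hq
    · simp; positivity
    · rw [Finset.range_eq_Ico, Finset.sum_eq_sum_Ico_succ_bot hq, Finset.mul_sum]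
      refine add_le_add (by simp [hc]) (Finset.sum_le_sum fun k hk => ?_)
      have : k ≠ 0 := by have := Finset.mem_Ico.1 hk; omega
      simp [hc, this]
  refine HasBernsteinMGF.of_bounded
    (Finset.measurable_sum _ fun j hj => (hYm j hj).const_mul _) (fun ω => ?_) ?_ ?_
  · calc |∑ j ∈ I, a j * smoothDev P ε q (φ j) j ω|
        ≤ ∑ j ∈ I, |a j * smoothDev P ε q (φ j) j ω| := Finset.abs_sum_le_sum_abs _ _
      _ ≤ ∑ j ∈ I, A₀ * (2 * C) := Finset.sum_le_sum fun j hj => by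
          rw [abs_mul]; exact mul_le_mul (ha j hj) (hYb j hj ω) (abs_nonneg _) hA₀
      _ = I.card * (A₀ * (2 * C)) := by simp
      _ ≤ q * (A₀ * (2 * C)) := by
          gcongr
          simpa using Finset.card_le_card hI
      _ = _ := by ring
  · rw [integral_finsetSum _ fun j hj => (hYi j hj).const_mul _]
    refine Finset.sum_eq_zero fun j hj => ?_
    rw [integral_const_mul, integral_smoothDev P hε hlaw (hφ j hj) (hφb j hj), mul_zero]
  · have hsq : ∀ ω, (∑ j ∈ I, a j * smoothDev P ε q (φ j) j ω) ^ 2 =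
        ∑ i ∈ I, ∑ j ∈ I, (a i * a j) *
          (smoothDev P ε q (φ i) i ω * smoothDev P ε q (φ j) j ω) := fun ω => by
      rw [sq, Finset.sum_mul_sum]
      exact Finset.sum_congr rfl fun i _ => Finset.sum_congr rfl fun j _ => by ring
    simp only [hsq]
    rw [integral_finsetSum _ fun i hi => integrable_finsetSum _ fun j hj =>
      (hmuli i hi j hj).const_mul _, mul_comm, Finset.sum_mul]
    refine Finset.sum_le_sum fun i hi => ?_
    rw [integral_finsetSum _ fun j hj => (hmuli i hi j hj).const_mul _]
    calc ∑ j ∈ I, ∫ ω, (a i * a j) *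
          (smoothDev P ε q (φ i) i ω * smoothDev P ε q (φ j) j ω) ∂μ
        ≤ ∑ j ∈ I, (|a i| * A₀) * c ((j - i) + (i - j)) := by
          refine Finset.sum_le_sum fun j hj => (le_abs_self _).trans ?_
          rw [integral_const_mul, abs_mul, abs_mul]
          have := ha j hj
          have := hcov i hi j hj
          gcongr
      _ = (|a i| * A₀) * ∑ j ∈ I, c ((j - i) + (i - j)) := by rw [Finset.mul_sum]
      _ ≤ (|a i| * A₀) * (2 * ∑ k ∈ Finset.range q, c k) := by
          gcongr
          exact sum_comp_natDist_le hI hc0 hi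
      _ ≤ (|a i| * A₀) * (2 * Γ) := by gcongr
      _ = |a i| * (A₀ * (2 * Γ)) := by ring

/-- The blocks `[l q, (l + 1) q)` with `l` of parity `p` use disjoint sets of innovations, so
their Bernstein bounds add up. -/
lemma hasBernsteinMGF_alternateBlocks (hε : ∀ k, Measurable (ε k)) (hind : iIndepFun ε μ)
    (hlaw : ∀ i, μ.map (pastInnovations ε i) = pathLaw P) (hq : 1 ≤ q)
    (hφ : ∀ j ∈ I, Measurable (φ j)) (hC : 0 ≤ C)
    (hφb : ∀ j ∈ I, ∀ e, |φ j e| ≤ C) (hτ0 : ∀ k, 0 ≤ τ k)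
    (hτ : ∀ j ∈ I, ∀ k ∈ Finset.Ico 1 q,
      ∫⁻ e, ‖smooth P q (φ j) e - smooth P k (φ j) e‖ₑ ∂(pathLaw P) ≤ ENNReal.ofReal (τ k))
    (ha : ∀ j ∈ I, |a j| ≤ A₀) (hA₀ : 0 ≤ A₀)
    (hΓ : 4 * C ^ 2 + 2 * C * ∑ k ∈ Finset.Ico 1 q, τ k ≤ Γ) {A₁ : ℝ}
    (hA₁ : ∑ j ∈ I, |a j| ≤ A₁) (p : ℕ) :
    HasBernsteinMGF μ
      (fun ω => ∑ j ∈ I with j / q % 2 = p, a j * smoothDev P ε q (φ j) j ω)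
      (q * A₀ * (2 * C)) (A₀ * (2 * Γ) * A₁) := by
  rcases Nat.lt_or_ge p 2 with hp | hp
  swap
  · have hemp : I.filter (fun j => j / q % 2 = p) = ∅ :=
      Finset.filter_eq_empty_iff.2 fun j _ => by
        have := Nat.mod_lt (j / q) (y := 2) (by simp)
        omega
    have hΓ0 : 0 ≤ Γ := le_trans (by
      have := Finset.sum_nonneg fun k (_ : k ∈ Finset.Ico 1 q) => hτ0 k
      positivity) hΓ
    have hA₁0 : 0 ≤ A₁ := (Finset.sum_nonneg fun j _ => abs_nonneg (a j)).trans hA₁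
    intro t _
    rw [hemp]
    simp only [Finset.sum_empty, mul_zero, Real.exp_zero, lintegral_const, measure_univ, mul_one]
    exact ENNReal.ofReal_le_ofReal (Real.one_le_exp (by positivity))
  set N := I.sup id + 1 with hN
  -- The `l`-th block of parity `p`.
  set blk : ℕ → Finset ℕ := fun l => I.filter fun j => j / q = 2 * l + p with hblk
  have hmap : ∀ j ∈ I.filter (fun j => j / q % 2 = p), j / q / 2 ∈ Finset.range N := by
    intro j hj
    have h1 : j ≤ I.sup id := Finset.le_sup (f := id) (Finset.mem_filter.1 hj).1
    have h2 : j / q / 2 ≤ j := (Nat.div_le_self _ _).trans (Nat.div_le_self _ _)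
    rw [Finset.mem_range]; omega
  have hfib : ∀ l, (I.filter (fun j => j / q % 2 = p)).filter (fun j => j / q / 2 = l) = blk l := by
    intro l
    ext j
    simp only [hblk, Finset.mem_filter, and_assoc]
    refine and_congr_right fun _ => ?_
    omega
  have hsum : ∀ f : ℕ → ℝ, ∑ j ∈ I with j / q % 2 = p, f j =
      ∑ l ∈ Finset.range N, ∑ j ∈ blk l, f j := fun f => by
    rw [← Finset.sum_fiberwise_of_maps_to hmap]
    simp only [hfib]
  have hmem : ∀ {l j}, j ∈ blk l → j ∈ I ∧ (2 * l + p) * q ≤ j ∧ j < (2 * l + p) * q + q := by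
    intro l j hj
    obtain ⟨h1, h2⟩ := Finset.mem_filter.1 hj
    refine ⟨h1, ?_, ?_⟩
    · rw [← h2]; exact Nat.div_mul_le_self j q
    · rw [← h2]
      calc j < (j / q + 1) * q := by
            rw [mul_comm]; exact Nat.lt_mul_div_succ j (by omega)
        _ = _ := by ring
  have hB : ∀ l, HasBernsteinMGF μ (fun ω => ∑ j ∈ blk l, a j * smoothDev P ε q (φ j) j ω)
      (q * A₀ * (2 * C)) (A₀ * (2 * Γ) * ∑ j ∈ blk l, |a j|) := fun l =>
    hasBernsteinMGF_block P hε hind hlaw (u := (2 * l + p) * q)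
      (fun j hj => Finset.mem_Ico.2 (hmem hj).2) (fun j hj => hφ j (hmem hj).1) hC
      (fun j hj => hφb j (hmem hj).1) hτ0 (fun j hj => hτ j (hmem hj).1)
      (fun j hj => ha j (hmem hj).1) hA₀ hΓ
  have hm : ∀ l, Measurable fun ω => ∑ j ∈ blk l, a j * smoothDev P ε q (φ j) j ω := fun l =>
    Finset.measurable_sum _ fun j hj =>
      (measurable_smoothDev P hε (hφ j (hmem hj).1) j).const_mul _
  have hi : ∀ M, IndepFun
      (fun ω => ∑ l ∈ Finset.range M, ∑ j ∈ blk l, a j * smoothDev P ε q (φ j) j ω)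
      (fun ω => ∑ j ∈ blk M, a j * smoothDev P ε q (φ j) j ω) μ := by
    intro M
    -- The `M`-th block uses innovations after time `s`, the earlier ones those up to time `s`.
    set s : ℤ := (2 * M + p) * q - q with hs
    refine indepFun_of_disjoint hε hind (A := Set.Iic s) (B := Set.Ioi s)
      (Set.Iic_disjoint_Ioi le_rfl)
      (Finset.measurable_sum _ fun l hl => Finset.measurable_sum _ fun j hj =>
        (measurable_smoothDev_innovationSigma P (hφ j (hmem hj).1) fun k hk => ?_).const_mul _)
      (Finset.measurable_sum _ fun j hj =>
        (measurable_smoothDev_innovationSigma P (hφ j (hmem hj).1) fun k hk => ?_).const_mul _)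
    · have h1 := (hmem hj).2.2
      have h2 : (2 * l + p + 2) * q ≤ (2 * M + p) * q :=
        Nat.mul_le_mul_right _ (by have := Finset.mem_range.1 hl; omega)
      rw [Set.mem_Iic, hs]
      zify at h1 h2
      linarith [(Int.natCast_nonneg k)]
    · have h1 := (hmem hj).2.1
      rw [Set.mem_Ioi, hs]
      zify at h1 hk
      linarith
  simp only [hsum]
  refine (HasBernsteinMGF.sum_range_of_indepFun hB hm hi N).mono ?_
  have hΓ0 : 0 ≤ Γ := le_trans (by
    have := Finset.sum_nonneg fun k (_ : k ∈ Finset.Ico 1 q) => hτ0 k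
    positivity) hΓ
  rw [← Finset.mul_sum, ← hsum]
  gcongr
  exact (Finset.sum_le_sum_of_subset_of_nonneg (Finset.filter_subset _ _)
    fun j _ _ => abs_nonneg _).trans hA₁

end Blocks

/-! ### Kernel estimates -/

lemma abs_integral_le_of_support {F : ℝ → ℝ} {x h D : ℝ} (hh : 0 ≤ h)
    (h0 : ∀ y, h / 2 < |y - x| → F y = 0) (hD : ∀ y, |F y| ≤ D) : |∫ y, F y| ≤ D * h := by
  have hs : ∀ y, y ∉ Set.Icc (x - h / 2) (x + h / 2) → F y = 0 := fun y hy => by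
    refine h0 y ?_
    by_contra hc
    rw [not_lt, abs_le] at hc
    exact hy ⟨by linarith, by linarith⟩
  rw [← setIntegral_eq_integral_of_forall_compl_eq_zero hs]
  have := norm_setIntegral_le_of_norm_le_const (μ := volume) (f := F) (C := D)
    (s := Set.Icc (x - h / 2) (x + h / 2)) (by simp) (fun y _ => hD y)
  refine this.trans (le_of_eq ?_)
  rw [Real.volume_real_Icc_of_le (by linarith)]
  ring

lemma integrable_of_support {F : ℝ → ℝ} {x h D : ℝ} (hF : Measurable F)
    (h0 : ∀ y, h / 2 < |y - x| → F y = 0) (hD : ∀ y, |F y| ≤ D) : Integrable F := by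
  have hs : Function.support F ⊆ Set.Icc (x - h / 2) (x + h / 2) := fun y hy => by
    by_contra hc
    refine hy (h0 y ?_)
    by_contra hc'
    rw [not_lt, abs_le] at hc'
    exact hc ⟨by linarith, by linarith⟩
  rw [← integrableOn_iff_integrable_of_support_subset hs]
  exact Measure.integrableOn_of_bounded (M := D) (by simp) hF.aestronglyMeasurable
    (ae_of_all _ hD)

section Kernel
variable {K : ℝ → ℝ} {M h : ℝ}

lemma abs_scaledKernel_le (hM : ∀ u, |K u| ≤ M) (hh : 0 < h) (u : ℝ) :
    |scaledKernel K h u| ≤ M / h := by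
  rw [scaledKernel, abs_mul, abs_of_pos (by positivity : (0 : ℝ) < 1 / h)]
  calc 1 / h * |K (u / h)| ≤ 1 / h * M := by gcongr; exact hM _
    _ = M / h := by ring

lemma scaledKernel_eq_zero (hK : Function.support K ⊆ Set.Icc (-(1 / 2)) (1 / 2)) (hh : 0 < h)
    {u : ℝ} (hu : h / 2 < |u|) : scaledKernel K h u = 0 := by
  have : K (u / h) = 0 := by
    by_contra hne
    have h1 := hK hne
    rw [Set.mem_Icc, ← abs_le, abs_div, abs_of_pos hh, div_le_iff₀ hh] at h1
    linarith
  rw [scaledKernel, this, mul_zero]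

lemma measurable_scaledKernel (hK : IsKernel K) (h : ℝ) : Measurable (scaledKernel K h) := by
  obtain ⟨L, hL⟩ := hK.lipschitz
  have := hL.continuous.measurable
  unfold scaledKernel
  fun_prop

lemma abs_scaledKernel_sub_le {L : ℝ≥0} (hL : LipschitzWith L K) (hh : 0 < h) (u u' : ℝ) :
    |scaledKernel K h u - scaledKernel K h u'| ≤ L / h ^ 2 * |u - u'| := by
  have h1 := hL.dist_le_mul (u / h) (u' / h)
  rw [Real.dist_eq, Real.dist_eq, ← sub_div, abs_div, abs_of_pos hh] at h1
  rw [scaledKernel, scaledKernel, ← mul_sub, abs_mul, abs_of_pos (by positivity : (0 : ℝ) < 1 / h)]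
  calc 1 / h * |K (u / h) - K (u' / h)| ≤ 1 / h * (L * (|u - u'| / h)) := by gcongr
    _ = _ := by field_simp

/-- A time window of width `h` holds at most `n h + 1` of the points `i / n`. -/
lemma card_filter_abs_div_sub_le {s : Finset ℕ} {n : ℕ} (hn : 0 < n) (hh : 0 ≤ h) (v : ℝ) :
    ((s.filter fun i : ℕ => |(i : ℝ) / n - v| ≤ h / 2).card : ℝ) ≤ n * h + 1 := by
  have hn' : (0 : ℝ) < n := by exact_mod_cast hn
  have hsub : ((s.filter fun i : ℕ => |(i : ℝ) / n - v| ≤ h / 2).image (fun i : ℕ => (i : ℤ))) ⊆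
      Finset.Icc ⌈n * (v - h / 2)⌉ ⌊n * (v + h / 2)⌋ := by
    intro k hk
    obtain ⟨i, hi, rfl⟩ := Finset.mem_image.1 hk
    have h1 := abs_le.1 (Finset.mem_filter.1 hi).2
    have h2 : (n : ℝ) * (i / n) = i := by field_simp
    rw [Finset.mem_Icc, Int.ceil_le, Int.le_floor]
    push_cast
    constructor <;> nlinarith
  have hcard := Finset.card_le_card hsub
  rw [Finset.card_image_of_injective _ Nat.cast_injective, Int.card_Icc] at hcard
  have h3 : (((⌊n * (v + h / 2)⌋ + 1 - ⌈n * (v - h / 2)⌉).toNat : ℤ) : ℝ) ≤ n * h + 1 := by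
    rw [Int.toNat_eq_max]
    push_cast
    refine max_le ?_ (by positivity)
    have := Int.floor_le (n * (v + h / 2))
    have := Int.le_ceil (n * (v - h / 2))
    nlinarith
  refine le_trans ?_ h3
  exact_mod_cast hcard

/-- The weight `n⁻¹ K_h(i/n - v)` of the `i`-th observation at time `v`. -/
noncomputable def timeWeight (K : ℝ → ℝ) (n : ℕ) (h v : ℝ) (i : ℕ) : ℝ :=
  1 / (n : ℝ) * scaledKernel K h ((i : ℝ) / n - v)

lemma abs_timeWeight_le (hM : ∀ u, |K u| ≤ M) (hh : 0 < h) (n : ℕ) (v : ℝ) (i : ℕ) :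
    |timeWeight K n h v i| ≤ M / (n * h) := by
  rw [timeWeight, abs_mul, abs_of_nonneg (by positivity : (0 : ℝ) ≤ 1 / n)]
  calc 1 / (n : ℝ) * |scaledKernel K h (i / n - v)| ≤ 1 / (n : ℝ) * (M / h) := by
        gcongr; exact abs_scaledKernel_le hM hh _
    _ = _ := by rw [div_mul_div_comm, one_mul]

lemma sum_abs_timeWeight_le (hM : ∀ u, |K u| ≤ M)
    (hK : Function.support K ⊆ Set.Icc (-(1 / 2)) (1 / 2)) (hh : 0 < h) {n : ℕ} (hn : 0 < n)
    (v : ℝ) (s : Finset ℕ) :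
    ∑ i ∈ s, |timeWeight K n h v i| ≤ M * (1 + 1 / (n * h)) := by
  have hM0 : 0 ≤ M := (abs_nonneg _).trans (hM 0)
  have hn' : (0 : ℝ) < n := by exact_mod_cast hn
  rw [← Finset.sum_filter_add_sum_filter_not s fun i : ℕ => |(i : ℝ) / n - v| ≤ h / 2]
  have h2 : ∑ i ∈ s.filter (fun i : ℕ => ¬ |(i : ℝ) / n - v| ≤ h / 2), |timeWeight K n h v i| = 0 :=
    Finset.sum_eq_zero fun i hi => by
      rw [timeWeight, scaledKernel_eq_zero hK hh (not_le.1 (Finset.mem_filter.1 hi).2)]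
      simp
  rw [h2, add_zero]
  calc ∑ i ∈ s.filter (fun i : ℕ => |(i : ℝ) / n - v| ≤ h / 2), |timeWeight K n h v i|
      ≤ ∑ i ∈ s.filter (fun i : ℕ => |(i : ℝ) / n - v| ≤ h / 2), M / (n * h) :=
        Finset.sum_le_sum fun i _ => abs_timeWeight_le hM hh n v i
    _ = ((s.filter fun i : ℕ => |(i : ℝ) / n - v| ≤ h / 2).card : ℝ) * (M / (n * h)) := by simp
    _ ≤ (n * h + 1) * (M / (n * h)) := by
        gcongr; exact card_filter_abs_div_sub_le hn hh.le v
    _ = _ := by field_simp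

end Kernel

/-- The conditional expectation of `K_h(X_i - x)` given `X_{i-1} = z`. -/
noncomputable def kernelMean (K : ℝ → ℝ) (h : ℝ) (g : ℝ → ℝ → ℝ) (x z : ℝ) : ℝ :=
  ∫ y, scaledKernel K h (y - x) * g z y

section KernelMean
variable {K : ℝ → ℝ} {M h C : ℝ} {g : ℝ → ℝ → ℝ}

lemma abs_kernelMean_le (hM : ∀ u, |K u| ≤ M)
    (hK : Function.support K ⊆ Set.Icc (-(1 / 2)) (1 / 2)) (hh : 0 < h)
    (hg0 : ∀ z x, 0 ≤ g z x) (hgC : ∀ z x, g z x ≤ C) (x z : ℝ) :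
    |kernelMean K h g x z| ≤ M * C := by
  have hM0 : 0 ≤ M := (abs_nonneg _).trans (hM 0)
  refine (abs_integral_le_of_support (x := x) (h := h) (D := M / h * C) hh.le (fun y hy => ?_)
    fun y => ?_).trans (le_of_eq (by field_simp))
  · rw [scaledKernel_eq_zero hK hh hy, zero_mul]
  · rw [abs_mul, abs_of_nonneg (hg0 z y)]
    exact mul_le_mul (abs_scaledKernel_le hM hh _) (hgC z y) (hg0 z y) (by positivity)

/-- The Lipschitz constant in `z` is independent of `x` and of the bandwidth: the support of `K_h`
has length `h`, which compensates the factor `1 / h`. -/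
lemma abs_kernelMean_sub_le (hK : IsKernel K) (hM : ∀ u, |K u| ≤ M) (hh : 0 < h)
    (hgm : Measurable (Function.uncurry g))
    (hg0 : ∀ z x, 0 ≤ g z x) (hgC : ∀ z x, g z x ≤ C) {L : ℝ≥0}
    (hL : ∀ x, LipschitzWith L fun z => g z x) (x a b : ℝ) :
    |kernelMean K h g x a - kernelMean K h g x b| ≤ M * L * |a - b| := by
  have hM0 : 0 ≤ M := (abs_nonneg _).trans (hM 0)
  have hint : ∀ z, Integrable fun y => scaledKernel K h (y - x) * g z y := fun z => by
    refine integrable_of_support (x := x) (h := h) (D := M / h * C) ?_ (fun y hy => ?_)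
      fun y => ?_
    · exact ((measurable_scaledKernel hK h).comp (measurable_id.sub_const x)).mul
        (hgm.comp measurable_prodMk_left)
    · rw [scaledKernel_eq_zero hK.support_subset hh hy, zero_mul]
    · rw [abs_mul, abs_of_nonneg (hg0 z y)]
      exact mul_le_mul (abs_scaledKernel_le hM hh _) (hgC z y) (hg0 z y) (by positivity)
  rw [kernelMean, kernelMean, ← integral_sub (hint a) (hint b)]
  refine (abs_integral_le_of_support (x := x) (h := h) (D := M / h * (L * |a - b|)) hh.le
    (fun y hy => ?_) fun y => ?_).trans (le_of_eq (by field_simp))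
  · rw [scaledKernel_eq_zero hK.support_subset hh hy, zero_mul, zero_mul, sub_zero]
  · rw [← mul_sub, abs_mul]
    exact mul_le_mul (abs_scaledKernel_le hM hh _) ((hL y).dist_le_mul a b) (abs_nonneg _)
      (by positivity)

lemma enorm_sub_le_mul_truncDist {f : ℝ → ℝ} {A L : ℝ} (hA : 0 ≤ A) (hL : 0 ≤ L)
    (hb : ∀ z, |f z| ≤ A) (hf : ∀ a b, |f a - f b| ≤ L * |a - b|) (a b : ℝ) :
    ‖f a - f b‖ₑ ≤ ENNReal.ofReal (2 * A + L) * truncDist a b := by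
  rw [truncDist, edist_dist, Real.dist_eq, Real.enorm_eq_ofReal_abs]
  rcases le_total 1 |a - b| with h | h
  · rw [min_eq_left (by simpa using h), mul_one]
    refine ENNReal.ofReal_le_ofReal ?_
    linarith [abs_sub (f a) (f b), hb a, hb b]
  · rw [min_eq_right (by simpa using h), ← ENNReal.ofReal_mul (by positivity)]
    refine ENNReal.ofReal_le_ofReal ((hf a b).trans ?_)
    gcongr
    linarith

/-- One of the two factors `M / h` in the second moment of `K_h(X_i - x)` is compensated by the
length `h` of the support. -/
lemma hasBernsteinMGF_kernel {Ω : Type*} [MeasurableSpace Ω] {μ : Measure Ω}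
    [IsProbabilityMeasure μ] {X : ℕ → Ω → ℝ} (hX : ∀ j, Measurable (X j)) {n : ℕ}
    {g : ℕ → ℝ → ℝ → ℝ} (hg : ∀ i ∈ Finset.Icc 2 n, IsTransitionDensity μ X i (g i))
    (hgC : ∀ i ∈ Finset.Icc 2 n, ∀ z x, g i z x ≤ C) (hC : 0 ≤ C) (hK : IsKernel K)
    (hM : ∀ u, |K u| ≤ M) (hh : 0 < h) {a : ℕ → ℝ} {A₀ A₁ : ℝ} (ha : ∀ i, |a i| ≤ A₀)
    (hA₁ : ∑ i ∈ Finset.Icc 2 n, |a i| ≤ A₁) (x : ℝ) :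
    HasBernsteinMGF μ
      (fun ω => ∑ i ∈ Finset.Icc 2 n,
        a i * (scaledKernel K h (X i ω - x) - kernelMean K h (g i) x (X (i - 1) ω)))
      (2 * (A₀ * (M / h))) (A₀ * (M ^ 2 * C / h) * A₁) := by
  have hM0 : 0 ≤ M := (abs_nonneg _).trans (hM 0)
  have hA₀ : 0 ≤ A₀ := (abs_nonneg _).trans (ha 0)
  have hwb : ∀ i y, |a i * scaledKernel K h (y - x)| ≤ A₀ * (M / h) := fun i y => by
    rw [abs_mul]
    exact mul_le_mul (ha i) (abs_scaledKernel_le hM hh _) (abs_nonneg _) hA₀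
  have h1 := hasBernsteinMGF_martingale (μ := μ) hX hg
    (w := fun i y => a i * scaledKernel K h (y - x)) (b := A₀ * (M / h))
    (v := fun i => A₀ * (M ^ 2 * C / h) * |a i|)
    (fun i => ((measurable_scaledKernel hK h).comp (measurable_id.sub_const x)).const_mul _)
    hwb (fun i hi z => by
      refine (le_abs_self _).trans ((abs_integral_le_of_support (x := x) (h := h)
        (D := (A₀ * |a i|) * (M / h) ^ 2 * C) hh.le (fun y hy => ?_) fun y => ?_).trans
        (le_of_eq (by field_simp)))
      · rw [scaledKernel_eq_zero hK.support_subset hh hy]; simp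
      · rw [abs_mul, abs_of_nonneg ((hg i hi).nonneg z y), abs_pow, abs_mul, mul_pow, sq |a i|]
        have h2 := ha i
        have h3 := abs_scaledKernel_le hM hh (y - x)
        have h4 := hgC i hi z y
        have h5 := (hg i hi).nonneg z y
        gcongr)
  have h2 : ∀ ω, ∑ i ∈ Finset.Icc 2 n, (a i * scaledKernel K h (X i ω - x) -
      ∫ y, a i * scaledKernel K h (y - x) * g i (X (i - 1) ω) y) =
      ∑ i ∈ Finset.Icc 2 n,
        a i * (scaledKernel K h (X i ω - x) - kernelMean K h (g i) x (X (i - 1) ω)) := fun ω =>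
    Finset.sum_congr rfl fun i _ => by
      simp only [kernelMean, mul_assoc, integral_const_mul, mul_sub]
  simp only [h2] at h1
  refine h1.mono ?_
  rw [← Finset.mul_sum]
  gcongr

end KernelMean

/-! ### Decomposition of the estimator -/

section Row
variable {Ω E : Type*}

lemma densityEstimator_eq_sum (K : ℝ → ℝ) (n : ℕ) (h₁ h₂ : ℝ) (X : ℕ → Ω → ℝ) (x v : ℝ) (ω : Ω) :
    densityEstimator K n h₁ h₂ X x v ω =
      ∑ i ∈ Finset.Icc 1 n, timeWeight K n h₁ v i * scaledKernel K h₂ (X i ω - x) := by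
  rw [densityEstimator, Finset.mul_sum]
  exact Finset.sum_congr rfl fun i _ => by rw [timeWeight, mul_assoc]

/-- The sum of the martingale differences in the estimator. -/
noncomputable def martingalePart (K : ℝ → ℝ) (n : ℕ) (h₁ h₂ : ℝ) (X : ℕ → Ω → ℝ)
    (g : ℕ → ℝ → ℝ → ℝ) (x v : ℝ) (ω : Ω) : ℝ :=
  ∑ i ∈ Finset.Icc 2 n, timeWeight K n h₁ v i *
    (scaledKernel K h₂ (X i ω - x) - kernelMean K h₂ (g i) x (X (i - 1) ω))

variable [MeasurableSpace E]

/-- The part of the smoothed conditional means that belongs to the blocks of parity `p`. The index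
`j = i - 1` is the time of the conditioning variable. -/
noncomputable def blockPart (P : Measure E) (K : ℝ → ℝ) (n : ℕ) (h₁ h₂ : ℝ) (ε : ℤ → Ω → E)
    (J : ℕ → ℕ → (ℕ → E) → ℝ) (g : ℕ → ℝ → ℝ → ℝ) (q p : ℕ) (x v : ℝ) (ω : Ω) : ℝ :=
  ∑ j ∈ Finset.Icc 1 (n - 1) with j / q % 2 = p, timeWeight K n h₁ v (j + 1) *
    smoothDev P ε q (kernelMean K h₂ (g (j + 1)) x ∘ J n j) j ω

/-- The sum of the splice errors over the row. Up to the factor `M (2 M C + M L) / (n h₁)` it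
bounds the error of averaging over the innovations older than `q` steps, and it depends neither on
`x` nor on `v`. -/
noncomputable def couplingRemainder (P : Measure E) (ε : ℤ → Ω → E)
    (J : ℕ → ℕ → (ℕ → E) → ℝ) (n q : ℕ) (ω : Ω) : ℝ≥0∞ :=
  ∑ j ∈ Finset.Icc 1 (n - 1), spliceErr P (J n j) q (pastInnovations ε j ω)

variable [MeasurableSpace Ω] {μ : Measure Ω}
  {P : Measure E} {ε : ℤ → Ω → E} {J : ℕ → ℕ → (ℕ → E) → ℝ}
  {K : ℝ → ℝ} {M h₁ h₂ C : ℝ} {L : ℝ≥0} {n : ℕ} {g : ℕ → ℝ → ℝ → ℝ}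

lemma measurable_kernelMean {X : ℕ → Ω → ℝ} {i : ℕ} {g : ℝ → ℝ → ℝ}
    (hg : IsTransitionDensity μ X i g) (hK : IsKernel K) (h x : ℝ) :
    Measurable (kernelMean K h g x) :=
  hg.measurable_integral ((measurable_scaledKernel hK h).comp (measurable_id.sub_const x))

lemma measurable_bernoulliShift (hε : ∀ k, Measurable (ε k)) (hJ : ∀ n i, Measurable (J n i))
    (n i : ℕ) : Measurable (bernoulliShift ε J n i) :=
  (hJ n i).comp (measurable_pastInnovations hε i)

/-- The decomposition of the deviation, at a single point of the sample space. The number `u`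
stands for the coupling error. -/
lemma abs_densityEstimator_sub_integral_le [IsProbabilityMeasure μ]
    [IsProbabilityMeasure P] (hε : ∀ k, Measurable (ε k))
    (hJ : ∀ n i, Measurable (J n i)) (hlaw : ∀ i, μ.map (pastInnovations ε i) = pathLaw P)
    (hK : IsKernel K) (hM : ∀ u, |K u| ≤ M) (hh₁ : 0 < h₁) (hh₂ : 0 < h₂)
    (hg : ∀ i ∈ Finset.Icc 2 n, IsTransitionDensity μ (bernoulliShift ε J n) i (g i))
    (hgC : ∀ i ∈ Finset.Icc 2 n, ∀ z x, g i z x ≤ C) (hC : 0 ≤ C)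
    (hgL : ∀ i ∈ Finset.Icc 2 n, ∀ x, LipschitzWith L fun z => g i z x) (hn : 1 ≤ n)
    (q : ℕ) (x v : ℝ) {ω : Ω} {u : ℝ}
    (hu : ENNReal.ofReal (M / (n * h₁) * (2 * (M * C) + M * L)) *
      couplingRemainder P ε J n q ω ≤ ENNReal.ofReal u) (hu0 : 0 ≤ u) :
    |densityEstimator K n h₁ h₂ (bernoulliShift ε J n) x v ω -
        ∫ ω', densityEstimator K n h₁ h₂ (bernoulliShift ε J n) x v ω' ∂μ| ≤
      M / (n * h₁) * (2 * (M / h₂)) +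
        |martingalePart K n h₁ h₂ (bernoulliShift ε J n) g x v ω| +
        (|blockPart P K n h₁ h₂ ε J g q 0 x v ω| + |blockPart P K n h₁ h₂ ε J g q 1 x v ω|) +
        u := by
  have hM0 : 0 ≤ M := (abs_nonneg _).trans (hM 0)
  have hn' : (0 : ℝ) < n := by exact_mod_cast hn
  set X := bernoulliShift ε J n with hXdef
  have hX : ∀ j, Measurable (X j) := measurable_bernoulliShift hε hJ n
  set a := timeWeight K n h₁ v with ha
  set A₀ := M / (n * h₁) with hA₀
  have hA₀0 : 0 ≤ A₀ := by positivity
  have haA : ∀ i, |a i| ≤ A₀ := abs_timeWeight_le hM hh₁ n v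
  set f : ℕ → ℝ → ℝ := fun i => kernelMean K h₂ (g i) x with hf
  have hker : Measurable fun y => scaledKernel K h₂ (y - x) :=
    (measurable_scaledKernel hK h₂).comp (measurable_id.sub_const x)
  have hkb : ∀ y, |scaledKernel K h₂ (y - x)| ≤ M / h₂ := fun y => abs_scaledKernel_le hM hh₂ _
  have hWi : ∀ i, Integrable (fun ω => scaledKernel K h₂ (X i ω - x)) μ := fun i =>
    integrable_of_abs_le (hker.comp (hX i)) fun ω => hkb _
  have hint : ∫ ω', densityEstimator K n h₁ h₂ X x v ω' ∂μ =
      ∑ i ∈ Finset.Icc 1 n, a i * ∫ ω', scaledKernel K h₂ (X i ω' - x) ∂μ := by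
    simp only [densityEstimator_eq_sum]
    rw [integral_finsetSum _ fun i _ => (hWi i).const_mul _]
    simp only [integral_const_mul, ha]
  have hsplit : ∀ F : ℕ → ℝ, ∑ i ∈ Finset.Icc 1 n, F i = F 1 + ∑ i ∈ Finset.Icc 2 n, F i :=
    fun F => by
      rw [← Finset.add_sum_Ioc_eq_sum_Icc hn]
      rfl
  have hmem : ∀ {j}, j ∈ Finset.Icc 1 (n - 1) → j + 1 ∈ Finset.Icc 2 n := fun hj => by
    simp only [Finset.mem_Icc] at hj ⊢; omega
  have hreindex : ∀ F : ℕ → ℝ, ∑ i ∈ Finset.Icc 2 n, F i =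
      ∑ j ∈ Finset.Icc 1 (n - 1), F (j + 1) := fun F => by
    have : Finset.Icc 2 n = (Finset.Icc 1 (n - 1)).map (addRightEmbedding 1) := by
      rw [Finset.map_add_right_Icc, Nat.sub_add_cancel hn]
    rw [this, Finset.sum_map]
    rfl
  have hfm : ∀ j ∈ Finset.Icc 1 (n - 1), Measurable (f (j + 1)) := fun j hj =>
    measurable_kernelMean (hg _ (hmem hj)) hK h₂ x
  have hfb : ∀ j ∈ Finset.Icc 1 (n - 1), ∀ z, |f (j + 1) z| ≤ M * C := fun j hj =>
    abs_kernelMean_le hM hK.support_subset hh₂ (hg _ (hmem hj)).nonneg (hgC _ (hmem hj)) x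
  have hfT : ∀ j ∈ Finset.Icc 1 (n - 1), ∀ b c, ‖f (j + 1) b - f (j + 1) c‖ₑ ≤
      ENNReal.ofReal (2 * (M * C) + M * L) * truncDist b c := fun j hj =>
    enorm_sub_le_mul_truncDist (by positivity) (by positivity) (hfb j hj)
      (abs_kernelMean_sub_le hK hM hh₂ (hg _ (hmem hj)).measurable (hg _ (hmem hj)).nonneg
        (hgC _ (hmem hj)) (hgL _ (hmem hj)) x)
  have hmean : ∀ j ∈ Finset.Icc 1 (n - 1), ∫ ω', scaledKernel K h₂ (X (j + 1) ω' - x) ∂μ =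
      ∫ e, (f (j + 1) ∘ J n j) e ∂(pathLaw P) := fun j hj => by
    have h1 := (hg _ (hmem hj)).integral_comp hX (by have := Finset.mem_Icc.1 hj; omega) hker hkb
    rw [← hlaw j, integral_map (measurable_pastInnovations hε j).aemeasurable
      ((hfm j hj).comp (hJ n j)).aestronglyMeasurable]
    exact h1
  -- the smoothed sum and its error
  set S : ℕ → ℝ := fun j => smoothDev P ε q (f (j + 1) ∘ J n j) j ω with hS
  set R : ℕ → ℝ := fun j => f (j + 1) (J n j (pastInnovations ε j ω)) -
    smooth P q (f (j + 1) ∘ J n j) (pastInnovations ε j ω) with hR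
  have hdecomp : densityEstimator K n h₁ h₂ X x v ω -
      ∫ ω', densityEstimator K n h₁ h₂ X x v ω' ∂μ =
      a 1 * (scaledKernel K h₂ (X 1 ω - x) - ∫ ω', scaledKernel K h₂ (X 1 ω' - x) ∂μ) +
      martingalePart K n h₁ h₂ X g x v ω + (∑ j ∈ Finset.Icc 1 (n - 1), a (j + 1) * S j) +
      ∑ j ∈ Finset.Icc 1 (n - 1), a (j + 1) * R j := by
    rw [hint, densityEstimator_eq_sum, ← Finset.sum_sub_distrib, hsplit, martingalePart,
      hreindex, hreindex, ← mul_sub, add_assoc, add_assoc, ← Finset.sum_add_distrib,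
      ← Finset.sum_add_distrib]
    congr 1
    refine Finset.sum_congr rfl fun j hj => ?_
    rw [hmean j hj]
    simp only [hS, hR, hf, smoothDev, Nat.add_sub_cancel, ha, hXdef, bernoulliShift]
    ring
  have hblocks : ∑ j ∈ Finset.Icc 1 (n - 1), a (j + 1) * S j =
      blockPart P K n h₁ h₂ ε J g q 0 x v ω + blockPart P K n h₁ h₂ ε J g q 1 x v ω := by
    have : ∀ j, j / q % 2 = 1 ↔ ¬ j / q % 2 = 0 := fun j => by omega
    rw [blockPart, blockPart]
    simp only [this]
    rw [Finset.sum_filter_add_sum_filter_not]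
  have h1 : |a 1 * (scaledKernel K h₂ (X 1 ω - x) - ∫ ω', scaledKernel K h₂ (X 1 ω' - x) ∂μ)| ≤
      A₀ * (2 * (M / h₂)) := by
    rw [abs_mul]
    have h2 : |∫ ω', scaledKernel K h₂ (X 1 ω' - x) ∂μ| ≤ M / h₂ := by
      simpa using norm_integral_le_of_norm_le_const (μ := μ)
        (f := fun ω' => scaledKernel K h₂ (X 1 ω' - x)) (ae_of_all _ fun ω' => hkb (X 1 ω'))
    refine mul_le_mul (haA 1) ?_ (abs_nonneg _) hA₀0
    linarith [abs_sub (scaledKernel K h₂ (X 1 ω - x)) (∫ ω', scaledKernel K h₂ (X 1 ω' - x) ∂μ),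
      hkb (X 1 ω)]
  have h2 : |∑ j ∈ Finset.Icc 1 (n - 1), a (j + 1) * R j| ≤ u := by
    rw [← ENNReal.ofReal_le_ofReal_iff hu0]
    refine le_trans ?_ hu
    rw [← Real.enorm_eq_ofReal_abs, couplingRemainder, Finset.mul_sum]
    refine (enorm_sum_le _ _).trans (Finset.sum_le_sum fun j hj => ?_)
    rw [enorm_mul, ENNReal.ofReal_mul hA₀0, mul_assoc]
    refine mul_le_mul' ?_ (enorm_sub_smooth_le P (hJ n j) (hfm j hj) (hfb j hj) (hfT j hj) q _)
    rw [Real.enorm_eq_ofReal_abs]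
    exact ENNReal.ofReal_le_ofReal (haA _)
  rw [hdecomp, hblocks]
  refine (abs_add_le _ _).trans (add_le_add ((abs_add_le _ _).trans (add_le_add
    ((abs_add_le _ _).trans (add_le_add h1 le_rfl)) (abs_add_le _ _))) h2)

end Row

/-! ### Discretization of the supremum -/

section Grid
variable {Ω : Type*} {X : ℕ → Ω → ℝ} {K : ℝ → ℝ} {M h₁ h₂ : ℝ} {L : ℝ≥0} {n : ℕ}

lemma abs_densityEstimator_sub_le (hL : LipschitzWith L K) (hM : ∀ u, |K u| ≤ M) (hh₁ : 0 < h₁)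
    (hh₂ : 0 < h₂) {x x' v v' δ : ℝ} (hx : |x - x'| ≤ δ) (hv : |v - v'| ≤ δ) (ω : Ω) :
    |densityEstimator K n h₁ h₂ X x v ω - densityEstimator K n h₁ h₂ X x' v' ω| ≤
      (L * M / (h₁ ^ 2 * h₂) + L * M / (h₁ * h₂ ^ 2)) * δ := by
  have hM0 : 0 ≤ M := (abs_nonneg _).trans (hM 0)
  have hδ : 0 ≤ δ := (abs_nonneg _).trans hx
  set B := (L * M / (h₁ ^ 2 * h₂) + L * M / (h₁ * h₂ ^ 2)) * δ with hB
  have hB0 : 0 ≤ B := by positivity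
  rw [densityEstimator, densityEstimator, ← mul_sub, ← Finset.sum_sub_distrib, abs_mul,
    abs_of_nonneg (by positivity : (0 : ℝ) ≤ 1 / n)]
  have hterm : ∀ i ∈ Finset.Icc 1 n,
      |scaledKernel K h₁ ((i : ℝ) / n - v) * scaledKernel K h₂ (X i ω - x) -
        scaledKernel K h₁ ((i : ℝ) / n - v') * scaledKernel K h₂ (X i ω - x')| ≤ B := by
    intro i _
    have h1 := abs_scaledKernel_sub_le hL hh₁ ((i : ℝ) / n - v) ((i : ℝ) / n - v')
    have h2 := abs_scaledKernel_sub_le hL hh₂ (X i ω - x) (X i ω - x')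
    rw [sub_sub_sub_cancel_left, abs_sub_comm v' v] at h1
    rw [sub_sub_sub_cancel_left, abs_sub_comm x' x] at h2
    have h3 := abs_scaledKernel_le hM hh₂ (X i ω - x)
    have h4 := abs_scaledKernel_le hM hh₁ ((i : ℝ) / n - v')
    set k₁ := scaledKernel K h₁ ((i : ℝ) / n - v)
    set k₁' := scaledKernel K h₁ ((i : ℝ) / n - v')
    set k₂ := scaledKernel K h₂ (X i ω - x)
    set k₂' := scaledKernel K h₂ (X i ω - x')
    calc |k₁ * k₂ - k₁' * k₂'| = |(k₁ - k₁') * k₂ + k₁' * (k₂ - k₂')| := by congr 1; ring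
      _ ≤ |k₁ - k₁'| * |k₂| + |k₁'| * |k₂ - k₂'| :=
          (abs_add_le _ _).trans (by rw [abs_mul, abs_mul])
      _ ≤ (L / h₁ ^ 2 * δ) * (M / h₂) + (M / h₁) * (L / h₂ ^ 2 * δ) := by
          have h1' := h1.trans (mul_le_mul_of_nonneg_left hv (by positivity))
          have h2' := h2.trans (mul_le_mul_of_nonneg_left hx (by positivity))
          gcongr
      _ = B := by rw [hB]; field_simp
  rcases Nat.eq_zero_or_pos n with rfl | hn
  · simpa using hB0
  have hn' : (0 : ℝ) < n := by exact_mod_cast hn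
  calc 1 / (n : ℝ) * |∑ i ∈ Finset.Icc 1 n, _|
      ≤ 1 / (n : ℝ) * ∑ i ∈ Finset.Icc 1 n, B := by
        gcongr
        exact (Finset.abs_sum_le_sum_abs _ _).trans (Finset.sum_le_sum hterm)
    _ = B := by simp; field_simp

/-- Outside the range of the observations the estimator vanishes. -/
lemma densityEstimator_eq_zero (hK : Function.support K ⊆ Set.Icc (-(1 / 2)) (1 / 2))
    (hh₂ : 0 < h₂) {R x : ℝ} (hR : h₂ / 2 < R) (hx : 2 * R < |x|) {ω : Ω}
    (hX : ∀ i ∈ Finset.Icc 1 n, |X i ω| ≤ R) (v : ℝ) :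
    densityEstimator K n h₁ h₂ X x v ω = 0 := by
  rw [densityEstimator, Finset.sum_eq_zero, mul_zero]
  intro i hi
  rw [scaledKernel_eq_zero hK hh₂, mul_zero]
  have h1 := abs_sub_abs_le_abs_sub x (X i ω)
  rw [abs_sub_comm] at h1
  linarith [hX i hi]

variable [MeasurableSpace Ω] {μ : Measure Ω} [IsProbabilityMeasure μ]

lemma integrable_densityEstimator (hX : ∀ j, Measurable (X j)) (hK : IsKernel K)
    (hM : ∀ u, |K u| ≤ M) (hh₂ : 0 < h₂) (x v : ℝ) :
    Integrable (densityEstimator K n h₁ h₂ X x v) μ := by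
  unfold densityEstimator
  refine (integrable_finsetSum _ fun i _ => Integrable.const_mul ?_ _).const_mul _
  exact integrable_of_abs_le ((measurable_scaledKernel hK h₂).comp ((hX i).sub_const x))
    fun ω => abs_scaledKernel_le hM hh₂ _

lemma abs_integral_densityEstimator_sub_le (hX : ∀ j, Measurable (X j)) (hK : IsKernel K)
    (hL : LipschitzWith L K) (hM : ∀ u, |K u| ≤ M) (hh₁ : 0 < h₁)
    (hh₂ : 0 < h₂) {x x' v v' δ : ℝ} (hx : |x - x'| ≤ δ) (hv : |v - v'| ≤ δ) :
    |(∫ ω, densityEstimator K n h₁ h₂ X x v ω ∂μ) -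
        ∫ ω, densityEstimator K n h₁ h₂ X x' v' ω ∂μ| ≤
      (L * M / (h₁ ^ 2 * h₂) + L * M / (h₁ * h₂ ^ 2)) * δ := by
  rw [← integral_sub (integrable_densityEstimator hX hK hM hh₂ x v)
    (integrable_densityEstimator hX hK hM hh₂ x' v')]
  have := norm_integral_le_of_norm_le_const (μ := μ) (f := fun ω =>
    densityEstimator K n h₁ h₂ X x v ω - densityEstimator K n h₁ h₂ X x' v' ω)
    (ae_of_all _ fun ω => abs_densityEstimator_sub_le hL hM hh₁ hh₂ hx hv ω)
  simpa using this

lemma abs_integral_densityEstimator_le (hX : ∀ j, Measurable (X j)) (hK : IsKernel K)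
    (hM : ∀ u, |K u| ≤ M) (hh₁ : 0 < h₁) (hh₂ : 0 < h₂) {R x ρ : ℝ} (hR : h₂ / 2 < R)
    (hx : 2 * R < |x|) (hρ0 : 0 ≤ ρ)
    (hρ : ∀ i ∈ Finset.Icc 1 n, μ {ω | R < |X i ω|} ≤ ENNReal.ofReal ρ) (v : ℝ) :
    |∫ ω, densityEstimator K n h₁ h₂ X x v ω ∂μ| ≤ M / h₁ * (M / h₂) * ρ := by
  have hM0 : 0 ≤ M := (abs_nonneg _).trans (hM 0)
  have hWi : ∀ i, Integrable (fun ω => scaledKernel K h₂ (X i ω - x)) μ := fun i =>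
    integrable_of_abs_le ((measurable_scaledKernel hK h₂).comp ((hX i).sub_const x))
      fun ω => abs_scaledKernel_le hM hh₂ _
  have hW : ∀ i ∈ Finset.Icc 1 n, |∫ ω, scaledKernel K h₂ (X i ω - x) ∂μ| ≤ M / h₂ * ρ := by
    intro i hi
    have hS : MeasurableSet {ω | R < |X i ω|} := measurableSet_lt measurable_const (hX i).abs
    rw [← setIntegral_eq_integral_of_forall_compl_eq_zero (s := {ω | R < |X i ω|})]
    · have := norm_setIntegral_le_of_norm_le_const (μ := μ) (s := {ω | R < |X i ω|})
        (f := fun ω => scaledKernel K h₂ (X i ω - x)) (C := M / h₂) (measure_lt_top _ _)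
        (fun ω _ => abs_scaledKernel_le hM hh₂ _)
      refine this.trans ?_
      gcongr
      exact ENNReal.toReal_le_of_le_ofReal hρ0 (hρ i hi)
    · intro ω hω
      refine scaledKernel_eq_zero hK.support_subset hh₂ ?_
      have h1 := abs_sub_abs_le_abs_sub x (X i ω)
      rw [abs_sub_comm] at h1
      have h2 : |X i ω| ≤ R := not_lt.1 hω
      linarith
  simp only [densityEstimator]
  rw [integral_const_mul, integral_finsetSum _ fun i _ => (hWi i).const_mul _, abs_mul,
    abs_of_nonneg (by positivity : (0 : ℝ) ≤ 1 / n)]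
  rcases Nat.eq_zero_or_pos n with rfl | hn
  · simp; positivity
  have hn' : (0 : ℝ) < n := by exact_mod_cast hn
  calc 1 / (n : ℝ) * |∑ i ∈ Finset.Icc 1 n, _|
      ≤ 1 / (n : ℝ) * ∑ i ∈ Finset.Icc 1 n, M / h₁ * (M / h₂ * ρ) := by
        gcongr
        refine (Finset.abs_sum_le_sum_abs _ _).trans (Finset.sum_le_sum fun i hi => ?_)
        rw [integral_const_mul, abs_mul]
        exact mul_le_mul (abs_scaledKernel_le hM hh₁ _) (hW i hi) (abs_nonneg _) (by positivity)
    _ = _ := by simp; field_simp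

/-- The integers `k` for which `k / n⁴` is a grid point; the grid covers `[-2 n^A, 2 n^A]` with
mesh `n⁻⁴`. -/
noncomputable def gridIndices (A n : ℕ) : Finset ℤ :=
  Finset.Icc (-(n : ℤ) ^ (A + 5)) ((n : ℤ) ^ (A + 5))

lemma card_gridIndices_le (A : ℕ) (hn : 3 ≤ n) : (gridIndices A n).card ≤ n ^ (A + 6) := by
  have h1 : 1 ≤ n ^ (A + 5) := Nat.one_le_pow _ _ (by omega)
  have h2 : 3 * n ^ (A + 5) ≤ n ^ (A + 6) := by
    rw [pow_succ n (A + 5), mul_comm]; exact Nat.mul_le_mul_left _ hn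
  rw [gridIndices, Int.card_Icc]
  zify at h1 h2
  have h3 : ((n : ℤ) ^ (A + 5) + 1 - -(n : ℤ) ^ (A + 5)) ≤ ((n ^ (A + 6) : ℕ) : ℤ) := by
    push_cast; linarith
  omega

lemma exists_gridIndices {A : ℕ} (hn : 3 ≤ n) {x : ℝ} (hx : |x| ≤ 2 * (n : ℝ) ^ A) :
    ∃ k ∈ gridIndices A n, |x - k / (n : ℝ) ^ 4| ≤ 1 / (n : ℝ) ^ 4 := by
  have hn' : (3 : ℝ) ≤ n := by exact_mod_cast hn
  have hn4 : (0 : ℝ) < (n : ℝ) ^ 4 := by positivity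
  have hf1 := Int.floor_le (x * (n : ℝ) ^ 4)
  have hf2 := Int.lt_floor_add_one (x * (n : ℝ) ^ 4)
  refine ⟨⌊x * (n : ℝ) ^ 4⌋, ?_, ?_⟩
  · have h1 : |x * (n : ℝ) ^ 4| ≤ 2 * (n : ℝ) ^ (A + 4) := by
      rw [abs_mul, abs_of_pos hn4, pow_add, ← mul_assoc]; gcongr
    have h2 : (1 : ℝ) ≤ (n : ℝ) ^ (A + 4) := one_le_pow₀ (by linarith)
    have h3 : 3 * (n : ℝ) ^ (A + 4) ≤ (n : ℝ) ^ (A + 5) := by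
      rw [pow_succ (n : ℝ) (A + 4), mul_comm]; gcongr
    have h4 := abs_le.1 h1
    rw [gridIndices, Finset.mem_Icc]
    constructor
    · have : ((-(n : ℤ) ^ (A + 5) : ℤ) : ℝ) ≤ (⌊x * (n : ℝ) ^ 4⌋ : ℝ) := by push_cast; linarith
      exact_mod_cast this
    · have : (⌊x * (n : ℝ) ^ 4⌋ : ℝ) ≤ (((n : ℤ) ^ (A + 5) : ℤ) : ℝ) := by push_cast; linarith
      exact_mod_cast this
  · have : x - ⌊x * (n : ℝ) ^ 4⌋ / (n : ℝ) ^ 4 =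
        (x * (n : ℝ) ^ 4 - ⌊x * (n : ℝ) ^ 4⌋) / (n : ℝ) ^ 4 := by field_simp
    rw [this, abs_div, abs_of_pos hn4]
    gcongr
    rw [abs_le]; constructor <;> linarith

/-- Reduction of the supremum to a grid of polynomial size, on the event that all observations are
at most `n^A` in absolute value. -/
lemma supDeviation_le (hX : ∀ j, Measurable (X j)) (hK : IsKernel K)
    (hL : LipschitzWith L K) (hM : ∀ u, |K u| ≤ M) (hh₁ : 0 < h₁) (hh₂ : 0 < h₂) (hn : 3 ≤ n)
    {A : ℕ} (hA : h₂ / 2 < (n : ℝ) ^ A) {ρ U : ℝ} (hρ0 : 0 ≤ ρ)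
    (hρ : ∀ i ∈ Finset.Icc 1 n, μ {ω | (n : ℝ) ^ A < |X i ω|} ≤ ENNReal.ofReal ρ) (hU : 0 ≤ U)
    {ω : Ω} (hXω : ∀ i ∈ Finset.Icc 1 n, |X i ω| ≤ (n : ℝ) ^ A)
    (hgrid : ∀ k ∈ gridIndices A n, ∀ l ∈ gridIndices A n,
      |densityEstimator K n h₁ h₂ X (k / (n : ℝ) ^ 4) (l / (n : ℝ) ^ 4) ω -
        ∫ ω', densityEstimator K n h₁ h₂ X (k / (n : ℝ) ^ 4) (l / (n : ℝ) ^ 4) ω' ∂μ| ≤ U) :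
    supDeviation μ K n h₁ h₂ X ω ≤ ENNReal.ofReal (U +
      2 * ((L * M / (h₁ ^ 2 * h₂) + L * M / (h₁ * h₂ ^ 2)) * (1 / (n : ℝ) ^ 4)) +
      M / h₁ * (M / h₂) * ρ) := by
  have hM0 : 0 ≤ M := (abs_nonneg _).trans (hM 0)
  have hn' : (1 : ℝ) ≤ n := by exact_mod_cast (by omega : 1 ≤ n)
  refine iSup_le fun x => iSup₂_le fun v hv => ?_
  rw [Real.enorm_eq_ofReal_abs]
  refine ENNReal.ofReal_le_ofReal ?_
  have hlip0 : 0 ≤ (L * M / (h₁ ^ 2 * h₂) + L * M / (h₁ * h₂ ^ 2)) * (1 / (n : ℝ) ^ 4) := by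
    positivity
  have htail0 : 0 ≤ M / h₁ * (M / h₂) * ρ := by positivity
  rcases le_or_gt |x| (2 * (n : ℝ) ^ A) with hx | hx
  -- Near the origin: compare with the nearest grid point on its left, for `ĝ` and for its mean.
  · obtain ⟨k, hk, hxk⟩ := exists_gridIndices hn hx
    obtain ⟨l, hl, hvl⟩ := exists_gridIndices (A := A) hn (x := v) (by
      rw [abs_of_nonneg hv.1]
      have := one_le_pow₀ (n := A) hn'
      linarith [hv.2])
    have h1 := abs_densityEstimator_sub_le (n := n) (X := X) hL hM hh₁ hh₂ hxk hvl ω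
    have h2 := abs_integral_densityEstimator_sub_le (n := n) (μ := μ) hX hK hL hM hh₁ hh₂ hxk hvl
    have h3 := hgrid k hk l hl
    rw [abs_le] at h1 h2 h3 ⊢
    constructor <;> linarith [h1.1, h1.2, h2.1, h2.2, h3.1, h3.2]
  · rw [densityEstimator_eq_zero hK.support_subset hh₂ hA hx hXω, zero_sub, abs_neg]
    refine (abs_integral_densityEstimator_le hX hK hM hh₁ hh₂ hA hx hρ0 hρ v).trans ?_
    linarith

end Grid

/-- The inequality of Markov for `|X| ^ p`, for any `p > 0`. -/
lemma measure_abs_gt_le_of_eLpNorm_le {α : Type*} [MeasurableSpace α] {μ : Measure α} {X : α → ℝ}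
    (hX : Measurable X) {p C R : ℝ} (hp : 0 < p) (hC : 0 ≤ C) (hR : 0 < R)
    (h : eLpNorm X (ENNReal.ofReal p) μ ≤ ENNReal.ofReal C) :
    μ {x | R < |X x|} ≤ ENNReal.ofReal (C ^ p * R ^ (-p)) := by
  have h1 := meas_ge_le_mul_pow_eLpNorm_enorm μ (p := ENNReal.ofReal p) (by simpa using hp)
    (by simp) hX.aestronglyMeasurable (ε := ENNReal.ofReal R) (by simpa using hR) (by simp)
  rw [ENNReal.toReal_ofReal hp.le] at h1
  refine (measure_mono fun x (hx : R < |X x|) => ?_).trans (h1.trans ?_)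
  · change ENNReal.ofReal R ≤ ‖X x‖ₑ
    rw [Real.enorm_eq_ofReal_abs]
    exact ENNReal.ofReal_le_ofReal hx.le
  · calc (ENNReal.ofReal R)⁻¹ ^ p * eLpNorm X (ENNReal.ofReal p) μ ^ p
        ≤ (ENNReal.ofReal R)⁻¹ ^ p * ENNReal.ofReal C ^ p := by gcongr
      _ = ENNReal.ofReal (C ^ p * R ^ (-p)) := by
        rw [← ENNReal.ofReal_inv_of_pos hR, ENNReal.ofReal_rpow_of_nonneg (by positivity) hp.le,
          ENNReal.ofReal_rpow_of_nonneg hC hp.le, ← ENNReal.ofReal_mul (by positivity), mul_comm,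
          Real.inv_rpow hR.le, Real.rpow_neg hR.le]

/-- The tail bound in the form used here, with `ℓ = log n`: range of order `√r / ℓ` and variance
of order `r / ℓ` make the tail at `T √r` a power of `n`. The argument of the generating function
is `ℓ / (β √r)`. -/
lemma HasBernsteinMGF.measure_abs_gt_rate_le {α : Type*} [MeasurableSpace α] {μ : Measure α}
    {S : α → ℝ} {b V : ℝ} (h : HasBernsteinMGF μ S b V) (hS : Measurable S) {ℓ r β κ T : ℝ}
    (hℓ : 0 < ℓ) (hr : 0 < r) (hβ : 0 < β) (hb : b ≤ β * (√r / ℓ)) (hV : V ≤ κ * (r / ℓ)) :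
    μ {x | T * √r < |S x|} ≤
      2 * ENNReal.ofReal (Real.exp ((κ / β ^ 2 - T / β) * ℓ)) := by
  have hsr : 0 < √r := Real.sqrt_pos.2 hr
  have ht : 0 < ℓ / (β * √r) := by positivity
  refine (h.measure_abs_gt_le hS (t := ℓ / (β * √r)) ht.le ?_).trans ?_
  · calc ℓ / (β * √r) * b ≤ ℓ / (β * √r) * (β * (√r / ℓ)) := by gcongr
      _ = 1 := by field_simp
  · gcongr
    have h1 : (ℓ / (β * √r)) ^ 2 * V ≤ (ℓ / (β * √r)) ^ 2 * (κ * (r / ℓ)) := by gcongr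
    have h2 : (ℓ / (β * √r)) ^ 2 * (κ * (r / ℓ)) = κ / β ^ 2 * ℓ := by
      rw [div_pow, mul_pow, Real.sq_sqrt hr.le]; field_simp
    have h3 : ℓ / (β * √r) * (T * √r) = T / β * ℓ := by field_simp
    rw [h3]
    linarith

/-! ### Bounds for a fixed row of the array -/

section Row
variable {Ω E : Type*} [MeasurableSpace Ω] [MeasurableSpace E] {μ : Measure Ω}
  {P : Measure E} {ε : ℤ → Ω → E}
  {J : ℕ → ℕ → (ℕ → E) → ℝ} {K : ℝ → ℝ} {M h₁ h₂ C : ℝ} {L : ℝ≥0} {n : ℕ} {g : ℕ → ℝ → ℝ → ℝ}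

lemma tsum_updateDist_le {J : (ℕ → E) → ℝ} {D γ : ℝ} (hD0 : 0 ≤ D) (hγ : 1 ≤ γ)
    (hD : ∀ k : ℕ, 1 ≤ k → updateDist P J k ≤ ENNReal.ofReal (D * (k : ℝ) ^ (-(γ + 1))))
    {q : ℕ} (hq : 1 ≤ q) :
    ∑' l, updateDist P J (q + l) ≤ ENNReal.ofReal (D * (4 * (q : ℝ) ^ (-γ))) := by
  calc ∑' l, updateDist P J (q + l)
      ≤ ∑' l, ENNReal.ofReal D * ENNReal.ofReal (((q + l : ℕ) : ℝ) ^ (-(γ + 1))) :=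
        ENNReal.tsum_le_tsum fun l => by
          rw [← ENNReal.ofReal_mul hD0]; exact hD _ (by omega)
    _ = ENNReal.ofReal D * ∑' l, ENNReal.ofReal (((q + l : ℕ) : ℝ) ^ (-(γ + 1))) :=
        ENNReal.tsum_mul_left
    _ ≤ ENNReal.ofReal D * ENNReal.ofReal (4 * (q : ℝ) ^ (-γ)) := by
        gcongr; exact tsum_rpow_tail_le hγ hq
    _ = _ := (ENNReal.ofReal_mul hD0).symm

lemma lintegral_couplingRemainder_le [IsProbabilityMeasure P]
    (hε : ∀ k, Measurable (ε k))
    (hJ : ∀ n i, Measurable (J n i)) (hlaw : ∀ i, μ.map (pastInnovations ε i) = pathLaw P)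
    {D γ : ℝ} (hD0 : 0 ≤ D) (hγ : 1 ≤ γ)
    (hD : ∀ j ∈ Finset.Icc 1 (n - 1), ∀ k : ℕ, 1 ≤ k →
      updateDist P (J n j) k ≤ ENNReal.ofReal (D * (k : ℝ) ^ (-(γ + 1)))) {q : ℕ} (hq : 1 ≤ q) :
    ∫⁻ ω, couplingRemainder P ε J n q ω ∂μ ≤
      ENNReal.ofReal (n * (D * (4 * (q : ℝ) ^ (-γ)))) := by
  have hmeas : ∀ j, Measurable (spliceErr P (J n j) q) := fun j => measurable_spliceErr P (hJ n j) q
  have hmeas' : ∀ j : ℕ, Measurable fun ω => spliceErr P (J n j) q (pastInnovations ε j ω) :=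
    fun j => (hmeas j).comp (measurable_pastInnovations hε j)
  simp only [couplingRemainder]
  rw [lintegral_finsetSum _ fun j _ => hmeas' j]
  calc ∑ j ∈ Finset.Icc 1 (n - 1), ∫⁻ ω, spliceErr P (J n j) q (pastInnovations ε j ω) ∂μ
      ≤ ∑ j ∈ Finset.Icc 1 (n - 1), ENNReal.ofReal (D * (4 * (q : ℝ) ^ (-γ))) := by
        refine Finset.sum_le_sum fun j hj => ?_
        rw [← lintegral_map (hmeas j) (measurable_pastInnovations hε j), hlaw,
          lintegral_spliceErr P (hJ n j)]
        exact (spliceDist_le_tsum P (hJ n j) q).trans (tsum_updateDist_le hD0 hγ (hD j hj) hq)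
    _ = ((n - 1 : ℕ) : ℝ≥0∞) * ENNReal.ofReal (D * (4 * (q : ℝ) ^ (-γ))) := by simp
    _ ≤ (n : ℝ≥0∞) * ENNReal.ofReal (D * (4 * (q : ℝ) ^ (-γ))) := by
        gcongr; omega
    _ = _ := by rw [ENNReal.ofReal_mul (Nat.cast_nonneg n), ENNReal.ofReal_natCast]

lemma hasBernsteinMGF_martingalePart [IsProbabilityMeasure μ]
    (hε : ∀ k, Measurable (ε k))
    (hJ : ∀ n i, Measurable (J n i))
    (hK : IsKernel K) (hM : ∀ u, |K u| ≤ M) (hh₁ : 0 < h₁) (hh₂ : 0 < h₂)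
    (hg : ∀ i ∈ Finset.Icc 2 n, IsTransitionDensity μ (bernoulliShift ε J n) i (g i))
    (hgC : ∀ i ∈ Finset.Icc 2 n, ∀ z x, g i z x ≤ C) (hC : 0 ≤ C) (hn : 1 ≤ n) (x v : ℝ) :
    HasBernsteinMGF μ (martingalePart K n h₁ h₂ (bernoulliShift ε J n) g x v)
      (2 * (M / (n * h₁) * (M / h₂)))
      (M / (n * h₁) * (M ^ 2 * C / h₂) * (M * (1 + 1 / (n * h₁)))) :=
  hasBernsteinMGF_kernel (measurable_bernoulliShift hε hJ n) hg hgC hC hK hM hh₂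
    (abs_timeWeight_le hM hh₁ n v) (sum_abs_timeWeight_le hM hK.support_subset hh₁ hn v _) x

lemma measurable_martingalePart (hε : ∀ k, Measurable (ε k))
    (hJ : ∀ n i, Measurable (J n i)) (hK : IsKernel K)
    (hg : ∀ i ∈ Finset.Icc 2 n, IsTransitionDensity μ (bernoulliShift ε J n) i (g i)) (x v : ℝ) :
    Measurable (martingalePart K n h₁ h₂ (bernoulliShift ε J n) g x v) := by
  have hX := measurable_bernoulliShift hε hJ n
  refine Finset.measurable_sum _ fun i hi => Measurable.const_mul (Measurable.sub ?_ ?_) _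
  · exact (measurable_scaledKernel hK h₂).comp ((hX i).sub_const x)
  · exact (measurable_kernelMean (hg i hi) hK h₂ x).comp (hX _)

lemma hasBernsteinMGF_blockPart [IsProbabilityMeasure μ]
    [IsProbabilityMeasure P]
    (hε : ∀ k, Measurable (ε k)) (hind : iIndepFun ε μ)
    (hJ : ∀ n i, Measurable (J n i)) (hlaw : ∀ i, μ.map (pastInnovations ε i) = pathLaw P)
    (hK : IsKernel K) (hM : ∀ u, |K u| ≤ M) (hh₁ : 0 < h₁) (hh₂ : 0 < h₂)
    (hg : ∀ i ∈ Finset.Icc 2 n, IsTransitionDensity μ (bernoulliShift ε J n) i (g i))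
    (hgC : ∀ i ∈ Finset.Icc 2 n, ∀ z x, g i z x ≤ C) (hC : 0 ≤ C)
    (hgL : ∀ i ∈ Finset.Icc 2 n, ∀ x, LipschitzWith L fun z => g i z x) (hn : 1 ≤ n)
    {D γ : ℝ} (hD0 : 0 ≤ D) (hγ : 1 < γ)
    (hD : ∀ j ∈ Finset.Icc 1 (n - 1), ∀ k : ℕ, 1 ≤ k →
      updateDist P (J n j) k ≤ ENNReal.ofReal (D * (k : ℝ) ^ (-(γ + 1)))) {q : ℕ} (hq : 1 ≤ q)
    (p : ℕ) (x v : ℝ) :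
    HasBernsteinMGF μ (blockPart P K n h₁ h₂ ε J g q p x v)
      (q * (M / (n * h₁)) * (2 * (M * C)))
      (M / (n * h₁) * (2 * (4 * (M * C) ^ 2 + 2 * (M * C) *
        ((2 * (M * C) + M * L) * (D * 4) * ∑' k : ℕ, (k : ℝ) ^ (-γ)))) *
        (M * (1 + 1 / (n * h₁)))) := by
  have hM0 : 0 ≤ M := (abs_nonneg _).trans (hM 0)
  have hmem : ∀ {j}, j ∈ Finset.Icc 1 (n - 1) → j + 1 ∈ Finset.Icc 2 n := fun hj => by
    simp only [Finset.mem_Icc] at hj ⊢; omega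
  set f : ℕ → ℝ → ℝ := fun i => kernelMean K h₂ (g i) x with hf
  have hfm : ∀ j ∈ Finset.Icc 1 (n - 1), Measurable (f (j + 1)) := fun j hj =>
    measurable_kernelMean (hg _ (hmem hj)) hK h₂ x
  have hfb : ∀ j ∈ Finset.Icc 1 (n - 1), ∀ z, |f (j + 1) z| ≤ M * C := fun j hj =>
    abs_kernelMean_le hM hK.support_subset hh₂ (hg _ (hmem hj)).nonneg (hgC _ (hmem hj)) x
  have hfT : ∀ j ∈ Finset.Icc 1 (n - 1), ∀ b c, ‖f (j + 1) b - f (j + 1) c‖ₑ ≤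
      ENNReal.ofReal (2 * (M * C) + M * L) * truncDist b c := fun j hj =>
    enorm_sub_le_mul_truncDist (by positivity) (by positivity) (hfb j hj)
      (abs_kernelMean_sub_le hK hM hh₂ (hg _ (hmem hj)).measurable (hg _ (hmem hj)).nonneg
        (hgC _ (hmem hj)) (hgL _ (hmem hj)) x)
  set τ : ℕ → ℝ := fun k => (2 * (M * C) + M * L) * (D * 4) * (k : ℝ) ^ (-γ) with hτ
  have hτ0 : ∀ k, 0 ≤ τ k := fun k => by positivity
  have hsum : Summable fun k : ℕ => (k : ℝ) ^ (-γ) := Real.summable_nat_rpow.2 (by linarith)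
  refine hasBernsteinMGF_alternateBlocks P hε hind hlaw (φ := fun j => f (j + 1) ∘ J n j)
    (a := fun j => timeWeight K n h₁ v (j + 1)) (τ := τ) hq
    (fun j hj => (hfm j hj).comp (hJ n j)) (by positivity) (fun j hj e => hfb j hj _) hτ0
    (fun j hj k hk => ?_) (fun j _ => abs_timeWeight_le hM hh₁ n v _) (by positivity) ?_ ?_ p
  · obtain ⟨hk1, hkq⟩ := Finset.mem_Ico.1 hk
    refine (lintegral_enorm_smooth_sub_smooth_le P (hJ n j) (hfm j hj) (hfb j hj) (hfT j hj)
      hkq.le).trans ?_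
    have h1 : ∑ l ∈ Finset.Ico k q, updateDist P (J n j) l ≤
        ENNReal.ofReal (D * (4 * (k : ℝ) ^ (-γ))) := by
      refine le_trans ?_ (tsum_updateDist_le hD0 hγ.le (hD j hj) hk1)
      rw [Finset.sum_Ico_eq_sum_range]
      exact ENNReal.sum_le_tsum _
    refine (mul_le_mul' le_rfl h1).trans ?_
    rw [← ENNReal.ofReal_mul (by positivity)]
    refine ENNReal.ofReal_le_ofReal (le_of_eq ?_)
    simp only [hτ]; ring
  · rw [hτ, ← Finset.mul_sum]
    gcongr
    exact hsum.sum_le_tsum _ fun k _ => by positivity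
  · have h1 := sum_abs_timeWeight_le hM hK.support_subset hh₁ hn v
      ((Finset.Icc 1 (n - 1)).map (addRightEmbedding 1))
    rwa [Finset.sum_map] at h1

lemma measurable_blockPart [IsProbabilityMeasure P]
    (hε : ∀ k, Measurable (ε k))
    (hJ : ∀ n i, Measurable (J n i)) (hK : IsKernel K)
    (hg : ∀ i ∈ Finset.Icc 2 n, IsTransitionDensity μ (bernoulliShift ε J n) i (g i))
    (q p : ℕ) (x v : ℝ) : Measurable (blockPart P K n h₁ h₂ ε J g q p x v) := by
  refine Finset.measurable_sum _ fun j hj => Measurable.const_mul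
    (measurable_smoothDev P hε ((measurable_kernelMean (hg (j + 1) ?_) hK h₂ x).comp (hJ n j)) j) _
  have := Finset.mem_Icc.1 (Finset.mem_filter.1 hj).1
  rw [Finset.mem_Icc]; omega

/-- The union bound over the grid. -/
lemma measure_supDeviation_gt_le [IsProbabilityMeasure μ]
    [IsProbabilityMeasure P]
    (hε : ∀ k, Measurable (ε k))
    (hJ : ∀ n i, Measurable (J n i)) (hlaw : ∀ i, μ.map (pastInnovations ε i) = pathLaw P)
    (hK : IsKernel K) (hM : ∀ u, |K u| ≤ M) {Λ : ℝ≥0} (hΛ : LipschitzWith Λ K)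
    (hh₁ : 0 < h₁) (hh₂ : 0 < h₂)
    (hg : ∀ i ∈ Finset.Icc 2 n, IsTransitionDensity μ (bernoulliShift ε J n) i (g i))
    (hgC : ∀ i ∈ Finset.Icc 2 n, ∀ z x, g i z x ≤ C) (hC : 0 ≤ C)
    (hgL : ∀ i ∈ Finset.Icc 2 n, ∀ x, LipschitzWith L fun z => g i z x) (hn : 3 ≤ n)
    {q A : ℕ} (hA : h₂ / 2 < (n : ℝ) ^ A) {ρ u π ϑ : ℝ} (hρ0 : 0 ≤ ρ) (hu : 0 ≤ u)
    (hρ : ∀ i ∈ Finset.Icc 1 n,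
      μ {ω | (n : ℝ) ^ A < |bernoulliShift ε J n i ω|} ≤ ENNReal.ofReal ρ)
    (hmart : ∀ x v, μ {ω | u < |martingalePart K n h₁ h₂ (bernoulliShift ε J n) g x v ω|} ≤
      ENNReal.ofReal π)
    (hblock : ∀ p x v, μ {ω | u < |blockPart P K n h₁ h₂ ε J g q p x v ω|} ≤ ENNReal.ofReal π)
    (hrem : μ {ω | ENNReal.ofReal u < ENNReal.ofReal (M / (n * h₁) * (2 * (M * C) + M * L)) *
      couplingRemainder P ε J n q ω} ≤ ENNReal.ofReal ϑ) :
    μ {ω | ENNReal.ofReal (M / (n * h₁) * (2 * (M / h₂)) + 4 * u +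
      2 * ((Λ * M / (h₁ ^ 2 * h₂) + Λ * M / (h₁ * h₂ ^ 2)) * (1 / (n : ℝ) ^ 4)) +
      M / h₁ * (M / h₂) * ρ) < supDeviation μ K n h₁ h₂ (bernoulliShift ε J n) ω} ≤
    n * ENNReal.ofReal ρ + (n ^ (2 * A + 12) : ℕ) * (3 * ENNReal.ofReal π) +
      ENNReal.ofReal ϑ := by
  have hM0 : 0 ≤ M := (abs_nonneg _).trans (hM 0)
  set X := bernoulliShift ε J n with hXdef
  set G := gridIndices A n ×ˢ gridIndices A n with hG
  set xk : ℤ → ℝ := fun k => k / (n : ℝ) ^ 4 with hxk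
  -- The three exceptional events: a large observation, a large random sum at a grid point, a large
  -- coupling error.
  set B₁ : Set Ω := ⋃ i ∈ Finset.Icc 1 n, {ω | (n : ℝ) ^ A < |X i ω|} with hB₁
  set B₂ : Set Ω := ⋃ m ∈ G,
    ({ω | u < |martingalePart K n h₁ h₂ X g (xk m.1) (xk m.2) ω|} ∪
      {ω | u < |blockPart P K n h₁ h₂ ε J g q 0 (xk m.1) (xk m.2) ω|} ∪
      {ω | u < |blockPart P K n h₁ h₂ ε J g q 1 (xk m.1) (xk m.2) ω|}) with hB₂
  set B₃ : Set Ω := {ω | ENNReal.ofReal u <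
    ENNReal.ofReal (M / (n * h₁) * (2 * (M * C) + M * L)) * couplingRemainder P ε J n q ω} with hB₃
  have hsub : {ω | ENNReal.ofReal (M / (n * h₁) * (2 * (M / h₂)) + 4 * u +
      2 * ((Λ * M / (h₁ ^ 2 * h₂) + Λ * M / (h₁ * h₂ ^ 2)) * (1 / (n : ℝ) ^ 4)) +
      M / h₁ * (M / h₂) * ρ) < supDeviation μ K n h₁ h₂ X ω} ⊆ B₁ ∪ B₂ ∪ B₃ := by
    intro ω hω
    by_contra hc
    simp only [Set.mem_union, not_or] at hc
    obtain ⟨⟨h1, h2⟩, h3⟩ := hc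
    simp only [hB₁, hB₂, Set.mem_iUnion, not_exists, Set.mem_union, not_or,
      Set.mem_ofPred_eq, not_lt] at h1 h2
    rw [hB₃, Set.mem_ofPred_eq, not_lt] at h3
    rw [Set.mem_ofPred_eq, ← not_le] at hω
    refine hω ?_
    refine supDeviation_le (measurable_bernoulliShift hε hJ n) hK hΛ hM hh₁ hh₂ hn hA hρ0 hρ
      (by positivity) h1 fun k hk l hl => ?_
    have h4 := abs_densityEstimator_sub_integral_le hε hJ hlaw hK hM hh₁ hh₂ hg hgC hC hgL
      (by omega) q (xk k) (xk l) h3 hu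
    obtain ⟨⟨h5, h6⟩, h7⟩ := h2 (k, l) (Finset.mem_product.2 ⟨hk, hl⟩)
    refine h4.trans ?_
    linarith
  refine (measure_mono hsub).trans ((measure_union_le _ _).trans (add_le_add
    ((measure_union_le _ _).trans (add_le_add ?_ ?_)) hrem))
  · refine (measure_biUnion_finset_le _ _).trans ((Finset.sum_le_sum hρ).trans ?_)
    simp
  · refine (measure_biUnion_finset_le _ _).trans ((Finset.sum_le_sum fun m _ =>
      (measure_union_le _ _).trans (add_le_add ((measure_union_le _ _).trans
        (add_le_add (hmart _ _) (hblock _ _ _))) (hblock _ _ _))).trans ?_)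
    rw [Finset.sum_const, nsmul_eq_mul]
    have hcard : G.card ≤ n ^ (2 * A + 12) := by
      rw [hG, Finset.card_product]
      refine (Nat.mul_le_mul (card_gridIndices_le A hn) (card_gridIndices_le A hn)).trans ?_
      rw [← pow_add]
      exact le_of_eq (by ring_nf)
    have h3 : ENNReal.ofReal π + ENNReal.ofReal π + ENNReal.ofReal π = 3 * ENNReal.ofReal π := by
      ring
    rw [h3]
    gcongr

end Row

/-! ### Rates -/

/-- `log n / (n h₁ h₂)`, the square of the rate of convergence. -/
noncomputable def rate (n : ℕ) (h₁ h₂ : ℝ) : ℝ := Real.log n / (n * h₁ * h₂)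

lemma one_le_log_natCast {n : ℕ} (hn : 3 ≤ n) : 1 ≤ Real.log n := by
  rw [Real.le_log_iff_exp_le (by positivity)]
  have : (3 : ℝ) ≤ n := by exact_mod_cast hn
  linarith [Real.exp_one_lt_d9]

section Rate
variable {n : ℕ} {h₁ h₂ B R : ℝ}

lemma rate_pos (hn : 3 ≤ n) (hh₁ : 0 < h₁) (hh₂ : 0 < h₂) : 0 < rate n h₁ h₂ := by
  have := one_le_log_natCast hn
  unfold rate
  positivity

lemma rate_div_log (hn : 3 ≤ n) : rate n h₁ h₂ / Real.log n = 1 / (n * h₁ * h₂) := by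
  have := one_le_log_natCast hn
  unfold rate
  field_simp

lemma one_div_le_rate_div_log (hn : 3 ≤ n) (hh₁ : 0 < h₁) (hh₂ : 0 < h₂) (hB : h₂ ≤ B) :
    1 / (n * h₁) ≤ B * (rate n h₁ h₂ / Real.log n) := by
  have h0 : (0 : ℝ) < n := by positivity
  rw [rate_div_log hn]
  calc 1 / (n * h₁) = h₂ * (1 / (n * h₁ * h₂)) := by field_simp
    _ ≤ _ := by gcongr

lemma rate_div_log_le (hn : 3 ≤ n) (hh₁ : 0 < h₁) (hh₂ : 0 < h₂) :
    rate n h₁ h₂ / Real.log n ≤ rate n h₁ h₂ :=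
  div_le_self (rate_pos hn hh₁ hh₂).le (one_le_log_natCast hn)

lemma rate_le_sqrt (hn : 3 ≤ n) (hh₁ : 0 < h₁) (hh₂ : 0 < h₂) (hR : rate n h₁ h₂ ≤ R) :
    rate n h₁ h₂ ≤ √R * √(rate n h₁ h₂) := by
  have h0 := rate_pos hn hh₁ hh₂
  calc rate n h₁ h₂ = √(rate n h₁ h₂) * √(rate n h₁ h₂) := (Real.mul_self_sqrt h0.le).symm
    _ ≤ _ := by gcongr

/-- Bandwidths shrink at most like `1 / n`, so a polynomially fine grid suffices. -/
lemma one_div_bandwidth_le (hn : 3 ≤ n) (hh₁ : 0 < h₁) (hh₂ : 0 < h₂)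
    (hB₂ : h₂ ≤ B) (hR : rate n h₁ h₂ ≤ R) : 1 / h₁ ≤ R * B * n := by
  have h0 : (0 : ℝ) < n := by positivity
  have hr := rate_pos hn hh₁ hh₂
  have hB0 : 0 < B := hh₂.trans_le hB₂
  calc 1 / h₁ = n * (1 / (n * h₁)) := by field_simp
    _ ≤ n * (B * R) := by
        gcongr
        exact (one_div_le_rate_div_log hn hh₁ hh₂ hB₂).trans
          (by gcongr; exact (rate_div_log_le hn hh₁ hh₂).trans hR)
    _ = _ := by ring

lemma rate_comm (n : ℕ) (h₁ h₂ : ℝ) : rate n h₁ h₂ = rate n h₂ h₁ := by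
  unfold rate; ring_nf

lemma one_div_le_sqrt_rate (hn : 3 ≤ n) (hh₁ : 0 < h₁) (hh₂ : 0 < h₂) (hB₁ : h₁ ≤ B)
    (hB₂ : h₂ ≤ B) : 1 / (n : ℝ) ≤ B * √(rate n h₁ h₂) := by
  have hn' : (1 : ℝ) ≤ n := by exact_mod_cast (by omega : 1 ≤ n)
  have hB0 : 0 < B := hh₂.trans_le hB₂
  have h1 : (1 / (n * B)) ^ 2 ≤ rate n h₁ h₂ := by
    rw [rate, div_pow, one_pow]
    have h3 : n * h₁ * h₂ ≤ (n * B) ^ 2 := by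
      calc n * h₁ * h₂ ≤ n * B * B := by gcongr
        _ = n * 1 * B ^ 2 := by ring
        _ ≤ n * n * B ^ 2 := by gcongr
        _ = _ := by ring
    have h4 := one_le_log_natCast hn
    gcongr
  have h2 := Real.le_sqrt_of_sq_le h1
  calc 1 / (n : ℝ) = B * (1 / (n * B)) := by field_simp
    _ ≤ _ := by gcongr

/-- The number of innovations kept in the averages, which is also the length of the blocks: the
smallest integer that is at least `rate ^ (-1/2)`. Larger blocks would spoil the range in the
Bernstein bound, smaller ones the coupling error. -/
noncomputable def blockLength (n : ℕ) (h₁ h₂ : ℝ) : ℕ := ⌈1 / √(rate n h₁ h₂)⌉₊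

lemma one_le_blockLength (hn : 3 ≤ n) (hh₁ : 0 < h₁) (hh₂ : 0 < h₂) :
    1 ≤ blockLength n h₁ h₂ := by
  have := rate_pos hn hh₁ hh₂
  exact Nat.one_le_ceil_iff.2 (by positivity)

lemma blockLength_le (hn : 3 ≤ n) (hh₁ : 0 < h₁) (hh₂ : 0 < h₂) (hR : rate n h₁ h₂ ≤ R) :
    (blockLength n h₁ h₂ : ℝ) ≤ (1 + √R) / √(rate n h₁ h₂) := by
  have h0 := Real.sqrt_pos.2 (rate_pos hn hh₁ hh₂)
  refine (Nat.ceil_lt_add_one (by positivity)).le.trans ?_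
  rw [add_div]
  gcongr
  rw [one_le_div h0]
  exact Real.sqrt_le_sqrt hR

/-- The order of the coupling error. -/
lemma blockLength_rpow_le (hn : 3 ≤ n) (hh₁ : 0 < h₁) (hh₂ : 0 < h₂) {θ : ℝ} (hθ : 0 < θ) :
    (blockLength n h₁ h₂ : ℝ) ^ (-(2 * θ + 1)) ≤ rate n h₁ h₂ ^ θ * √(rate n h₁ h₂) := by
  have hr := rate_pos hn hh₁ hh₂
  have h0 := Real.sqrt_pos.2 hr
  calc (blockLength n h₁ h₂ : ℝ) ^ (-(2 * θ + 1))
      ≤ (1 / √(rate n h₁ h₂)) ^ (-(2 * θ + 1)) :=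
        Real.rpow_le_rpow_of_nonpos (by positivity) (Nat.le_ceil _) (by linarith)
    _ = √(rate n h₁ h₂) ^ (2 * θ) * √(rate n h₁ h₂) := by
        rw [one_div, Real.inv_rpow h0.le, Real.rpow_neg h0.le, inv_inv, Real.rpow_add h0,
          Real.rpow_one]
    _ = _ := by
        rw [Real.rpow_mul h0.le, Real.rpow_two, Real.sq_sqrt hr.le]

lemma martingale_range_le {M : ℝ} (hn : 3 ≤ n) (hh₁ : 0 < h₁) (hh₂ : 0 < h₂)
    (hR : rate n h₁ h₂ ≤ R) :
    2 * (M / (n * h₁) * (M / h₂)) ≤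
      (2 * M ^ 2 * √R) * (√(rate n h₁ h₂) / Real.log n) := by
  have h1 := one_le_log_natCast hn
  have h0 : (0 : ℝ) < n := by positivity
  calc 2 * (M / (n * h₁) * (M / h₂)) = 2 * M ^ 2 * (rate n h₁ h₂ / Real.log n) := by
        rw [rate_div_log hn]; field_simp
    _ ≤ 2 * M ^ 2 * (√R * √(rate n h₁ h₂) / Real.log n) := by
        gcongr; exact rate_le_sqrt hn hh₁ hh₂ hR
    _ = _ := by ring

lemma martingale_variance_le {M C : ℝ} (hM : 0 ≤ M) (hC : 0 ≤ C) (hn : 3 ≤ n) (hh₁ : 0 < h₁)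
    (hh₂ : 0 < h₂) (hB : h₂ ≤ B) (hR : rate n h₁ h₂ ≤ R) :
    M / (n * h₁) * (M ^ 2 * C / h₂) * (M * (1 + 1 / (n * h₁))) ≤
      (M ^ 4 * C * (1 + B * R)) * (rate n h₁ h₂ / Real.log n) := by
  have h0 : (0 : ℝ) < n := by positivity
  have hB0 : 0 < B := hh₂.trans_le hB
  have hw : 1 / (n * h₁) ≤ B * R := (one_div_le_rate_div_log hn hh₁ hh₂ hB).trans
    (by gcongr; exact (rate_div_log_le hn hh₁ hh₂).trans hR)
  calc M / (n * h₁) * (M ^ 2 * C / h₂) * (M * (1 + 1 / (n * h₁)))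
      ≤ M / (n * h₁) * (M ^ 2 * C / h₂) * (M * (1 + B * R)) := by gcongr
    _ = _ := by rw [rate_div_log hn]; field_simp

lemma block_range_le {M C : ℝ} (hM : 0 ≤ M) (hC : 0 ≤ C) (hn : 3 ≤ n) (hh₁ : 0 < h₁)
    (hh₂ : 0 < h₂) (hB : h₂ ≤ B) (hR : rate n h₁ h₂ ≤ R) :
    blockLength n h₁ h₂ * (M / (n * h₁)) * (2 * (M * C)) ≤
      (2 * M ^ 2 * C * B * (1 + √R)) * (√(rate n h₁ h₂) / Real.log n) := by
  have h0 : (0 : ℝ) < n := by positivity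
  have hl := one_le_log_natCast hn
  have hr := rate_pos hn hh₁ hh₂
  have hsr := Real.sqrt_pos.2 hr
  calc blockLength n h₁ h₂ * (M / (n * h₁)) * (2 * (M * C))
      = blockLength n h₁ h₂ * (M * (1 / (n * h₁))) * (2 * (M * C)) := by ring
    _ ≤ ((1 + √R) / √(rate n h₁ h₂)) * (M * (B * (rate n h₁ h₂ / Real.log n))) *
          (2 * (M * C)) := by
        gcongr
        · exact blockLength_le hn hh₁ hh₂ hR
        · exact one_div_le_rate_div_log hn hh₁ hh₂ hB
    _ = (2 * M ^ 2 * C * B * (1 + √R)) *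
          (rate n h₁ h₂ / √(rate n h₁ h₂) / Real.log n) := by ring
    _ = _ := by rw [Real.div_sqrt]

lemma block_variance_le {M Γ : ℝ} (hM : 0 ≤ M) (hΓ : 0 ≤ Γ) (hn : 3 ≤ n) (hh₁ : 0 < h₁)
    (hh₂ : 0 < h₂) (hB : h₂ ≤ B) (hR : rate n h₁ h₂ ≤ R) :
    M / (n * h₁) * (2 * Γ) * (M * (1 + 1 / (n * h₁))) ≤
      (2 * M ^ 2 * Γ * B * (1 + B * R)) * (rate n h₁ h₂ / Real.log n) := by
  have h0 : (0 : ℝ) < n := by positivity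
  have hl := one_le_log_natCast hn
  have hr := rate_pos hn hh₁ hh₂
  have hB0 : 0 < B := hh₂.trans_le hB
  have hw := one_div_le_rate_div_log hn hh₁ hh₂ hB
  have hw' : 1 / (n * h₁) ≤ B * R := hw.trans
    (by gcongr; exact (rate_div_log_le hn hh₁ hh₂).trans hR)
  calc M / (n * h₁) * (2 * Γ) * (M * (1 + 1 / (n * h₁)))
      = M * (1 / (n * h₁)) * (2 * Γ) * (M * (1 + 1 / (n * h₁))) := by ring
    _ ≤ M * (B * (rate n h₁ h₂ / Real.log n)) * (2 * Γ) * (M * (1 + B * R)) := by gcongr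
    _ = _ := by ring

/-- The deterministic terms: the first summand of the estimator, the discretization, and the mean
of the estimator far out. -/
lemma deviation_bound_le {M T Λ C : ℝ} (hM : 0 ≤ M) (hΛ : 0 ≤ Λ) (hC : 0 ≤ C) (hn : 3 ≤ n)
    (hh₁ : 0 < h₁) (hh₂ : 0 < h₂) (hB₁ : h₁ ≤ B) (hB₂ : h₂ ≤ B) (hR : rate n h₁ h₂ ≤ R) :
    M / (n * h₁) * (2 * (M / h₂)) + 4 * (T * √(rate n h₁ h₂)) +
      2 * ((Λ * M / (h₁ ^ 2 * h₂) + Λ * M / (h₁ * h₂ ^ 2)) * (1 / (n : ℝ) ^ 4)) +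
      M / h₁ * (M / h₂) * (C / (n : ℝ) ^ 3) ≤
    (2 * M ^ 2 * √R + 4 * T + 4 * Λ * M * (R * B) ^ 3 * B + M ^ 2 * (R * B) ^ 2 * C * B) *
      √(rate n h₁ h₂) := by
  have h0 : (0 : ℝ) < n := by positivity
  have hr := rate_pos hn hh₁ hh₂
  have hR0 : 0 < R := hr.trans_le hR
  have hB0 : 0 < B := hh₂.trans_le hB₂
  have hi₁ := one_div_bandwidth_le hn hh₁ hh₂ hB₂ hR
  have hi₂ := one_div_bandwidth_le hn hh₂ hh₁ hB₁ ((rate_comm n h₂ h₁).trans_le hR)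
  have hs := one_div_le_sqrt_rate hn hh₁ hh₂ hB₁ hB₂
  have h1 : M / (n * h₁) * (2 * (M / h₂)) ≤ 2 * M ^ 2 * √R * √(rate n h₁ h₂) := by
    calc M / (n * h₁) * (2 * (M / h₂)) = 2 * M ^ 2 * (rate n h₁ h₂ / Real.log n) := by
          rw [rate_div_log hn]; field_simp
      _ ≤ 2 * M ^ 2 * (√R * √(rate n h₁ h₂)) := by
          gcongr; exact (rate_div_log_le hn hh₁ hh₂).trans (rate_le_sqrt hn hh₁ hh₂ hR)
      _ = _ := by ring
  have h2 : 2 * ((Λ * M / (h₁ ^ 2 * h₂) + Λ * M / (h₁ * h₂ ^ 2)) * (1 / (n : ℝ) ^ 4)) ≤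
      4 * Λ * M * (R * B) ^ 3 * B * √(rate n h₁ h₂) := by
    calc 2 * ((Λ * M / (h₁ ^ 2 * h₂) + Λ * M / (h₁ * h₂ ^ 2)) * (1 / (n : ℝ) ^ 4))
        = 2 * ((Λ * M * ((1 / h₁) ^ 2 * (1 / h₂)) + Λ * M * ((1 / h₁) * (1 / h₂) ^ 2)) *
            (1 / (n : ℝ) ^ 4)) := by field_simp
      _ ≤ 2 * ((Λ * M * ((R * B * n) ^ 2 * (R * B * n)) +
            Λ * M * ((R * B * n) * (R * B * n) ^ 2)) * (1 / (n : ℝ) ^ 4)) := by gcongr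
      _ = 4 * Λ * M * (R * B) ^ 3 * (1 / n) := by field_simp; ring
      _ ≤ 4 * Λ * M * (R * B) ^ 3 * (B * √(rate n h₁ h₂)) := by gcongr
      _ = _ := by ring
  have h3 : M / h₁ * (M / h₂) * (C / (n : ℝ) ^ 3) ≤
      M ^ 2 * (R * B) ^ 2 * C * B * √(rate n h₁ h₂) := by
    calc M / h₁ * (M / h₂) * (C / (n : ℝ) ^ 3)
        = M ^ 2 * ((1 / h₁) * (1 / h₂)) * (C / (n : ℝ) ^ 3) := by field_simp
      _ ≤ M ^ 2 * ((R * B * n) * (R * B * n)) * (C / (n : ℝ) ^ 3) := by gcongr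
      _ = M ^ 2 * (R * B) ^ 2 * C * (1 / n) := by field_simp
      _ ≤ M ^ 2 * (R * B) ^ 2 * C * (B * √(rate n h₁ h₂)) := by gcongr
      _ = _ := by ring
  linarith

end Rate

/-- The bandwidth condition, with `θ = α s - 1`, rewritten as `rate ^ θ = O(h₁)`; as `h₁` is
bounded, `rate` is bounded as well. -/
lemma eventually_rate_le {h₁ h₂ : ℕ → ℝ} {B θ : ℝ} (hh₁ : ∀ n, 0 < h₁ n) (hh₂ : ∀ n, 0 < h₂ n)
    (hB : ∀ n, h₁ n ≤ B) (hθ : 0 < θ)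
    (h : (fun n : ℕ => Real.log n * (n * h₂ n * h₁ n ^ ((θ + 1) / θ))⁻¹)
      =O[atTop] (fun _ => (1 : ℝ))) :
    ∃ R C : ℝ, 0 < R ∧ 0 < C ∧ ∀ᶠ n in atTop,
      rate n (h₁ n) (h₂ n) ≤ R ∧ rate n (h₁ n) (h₂ n) ^ θ ≤ C * h₁ n := by
  obtain ⟨c, hc, hb⟩ := h.exists_pos
  have hB0 : 0 < B := (hh₁ 0).trans_le (hB 0)
  refine ⟨c * B ^ (1 / θ), c ^ θ, by positivity, by positivity, ?_⟩
  filter_upwards [hb.bound, eventually_ge_atTop 3] with n hn hn3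
  have h1 := hh₁ n
  have h2 := hh₂ n
  have h0 : (0 : ℝ) < n := by positivity
  have hr := rate_pos hn3 h1 h2
  have hle : rate n (h₁ n) (h₂ n) ≤ c * h₁ n ^ (1 / θ) := by
    have hn' := (le_abs_self _).trans hn
    rw [norm_one, mul_one] at hn'
    calc rate n (h₁ n) (h₂ n)
        = (Real.log n * (n * h₂ n * h₁ n ^ ((θ + 1) / θ))⁻¹) * h₁ n ^ (1 / θ) := by
          rw [rate, show (θ + 1) / θ = 1 + 1 / θ by field_simp, Real.rpow_add h1, Real.rpow_one]
          have : h₁ n ^ (1 / θ) ≠ 0 := by positivity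
          field_simp
      _ ≤ _ := by gcongr
  refine ⟨hle.trans (by gcongr; exact hB n), ?_⟩
  calc rate n (h₁ n) (h₂ n) ^ θ ≤ (c * h₁ n ^ (1 / θ)) ^ θ := by gcongr
    _ = c ^ θ * h₁ n := by
        rw [Real.mul_rpow hc.le (by positivity), ← Real.rpow_mul h1.le, one_div_mul_cancel hθ.ne',
          Real.rpow_one]

/-! ### The deviation inequality at the rate of convergence -/

section Row
variable {Ω E : Type*} [MeasurableSpace Ω] [MeasurableSpace E] {μ : Measure Ω}
  [IsProbabilityMeasure μ] {P : Measure E} [IsProbabilityMeasure P] {ε : ℤ → Ω → E}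
  {J : ℕ → ℕ → (ℕ → E) → ℝ} {K : ℝ → ℝ} {M h₁ h₂ C : ℝ} {L : ℝ≥0} {n : ℕ} {g : ℕ → ℝ → ℝ → ℝ}

/-- The deviation inequality at level `√rate`, with explicit constants. The coupling remainder is
bounded by its expectation, the other random terms by the exponential inequalities. -/
lemma measure_supDeviation_gt_sqrt_rate_le (hε : ∀ k, Measurable (ε k)) (hind : iIndepFun ε μ)
    (hJ : ∀ n i, Measurable (J n i)) (hlaw : ∀ i, μ.map (pastInnovations ε i) = pathLaw P)
    (hK : IsKernel K) (hM : ∀ u, |K u| ≤ M) {Λ : ℝ≥0} (hΛ : LipschitzWith Λ K)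
    (hh₁ : 0 < h₁) (hh₂ : 0 < h₂)
    (hg : ∀ i ∈ Finset.Icc 2 n, IsTransitionDensity μ (bernoulliShift ε J n) i (g i))
    (hgC : ∀ i ∈ Finset.Icc 2 n, ∀ z x, g i z x ≤ C) (hC : 0 ≤ C)
    (hgL : ∀ i ∈ Finset.Icc 2 n, ∀ x, LipschitzWith L fun z => g i z x) (hn : 3 ≤ n)
    {D θ : ℝ} (hD0 : 0 ≤ D) (hθ : 0 < θ)
    (hD : ∀ j ∈ Finset.Icc 1 (n - 1), ∀ k : ℕ, 1 ≤ k →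
      updateDist P (J n j) k ≤ ENNReal.ofReal (D * (k : ℝ) ^ (-(2 * θ + 1 + 1))))
    {B R C₁ : ℝ} (hB₁ : h₁ ≤ B) (hB₂ : h₂ ≤ B) (hR : rate n h₁ h₂ ≤ R)
    (hrθ : rate n h₁ h₂ ^ θ ≤ C₁ * h₁) {A : ℕ} (hA : h₂ / 2 < (n : ℝ) ^ A)
    {Cρ : ℝ} (hCρ : 0 ≤ Cρ) (hρ : ∀ i ∈ Finset.Icc 1 n,
      μ {ω | (n : ℝ) ^ A < |bernoulliShift ε J n i ω|} ≤ ENNReal.ofReal (Cρ / (n : ℝ) ^ 3))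
    {Γ : ℝ} (hΓ : Γ = 4 * (M * C) ^ 2 + 2 * (M * C) *
      ((2 * (M * C) + M * L) * (D * 4) * ∑' k : ℕ, (k : ℝ) ^ (-(2 * θ + 1))))
    {β κ T : ℝ} (hβ0 : 0 < β) (hβ₁ : 2 * M ^ 2 * √R ≤ β)
    (hβ₂ : 2 * M ^ 2 * C * B * (1 + √R) ≤ β) (hκ₁ : M ^ 4 * C * (1 + B * R) ≤ κ)
    (hκ₂ : 2 * M ^ 2 * Γ * B * (1 + B * R) ≤ κ) (hT0 : 0 < T) :
    μ {ω | ENNReal.ofReal ((2 * M ^ 2 * √R + 4 * T + 4 * Λ * M * (R * B) ^ 3 * B +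
        M ^ 2 * (R * B) ^ 2 * Cρ * B) * √(rate n h₁ h₂)) <
        supDeviation μ K n h₁ h₂ (bernoulliShift ε J n) ω} ≤
      n * ENNReal.ofReal (Cρ / (n : ℝ) ^ 3) + (n ^ (2 * A + 12) : ℕ) *
        (3 * ENNReal.ofReal (2 * Real.exp ((κ / β ^ 2 - T / β) * Real.log n))) +
        ENNReal.ofReal (M * (2 * (M * C) + M * L) * (D * 4) * C₁ / T) := by
  have hM0 : 0 ≤ M := (abs_nonneg _).trans (hM 0)
  have hn' : (1 : ℝ) ≤ n := by exact_mod_cast (by omega : 1 ≤ n)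
  have hΓ0 : 0 ≤ Γ := by
    have : 0 ≤ ∑' k : ℕ, (k : ℝ) ^ (-(2 * θ + 1)) := tsum_nonneg fun k => by positivity
    rw [hΓ]
    positivity
  have hlog := one_le_log_natCast hn
  have hlog0 : 0 < Real.log n := by linarith
  have hr := rate_pos hn hh₁ hh₂
  have hsr := Real.sqrt_pos.2 hr
  set r := rate n h₁ h₂ with hrdef
  set q := blockLength n h₁ h₂ with hq
  have hq1 : 1 ≤ q := one_le_blockLength hn hh₁ hh₂
  have hratio : 0 ≤ √r / Real.log n := by positivity
  have hratio' : 0 ≤ r / Real.log n := by positivity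
  set π := 2 * Real.exp ((κ / β ^ 2 - T / β) * Real.log n) with hπ
  have hπ' : 2 * ENNReal.ofReal (Real.exp ((κ / β ^ 2 - T / β) * Real.log n)) =
      ENNReal.ofReal π := by
    rw [hπ, ENNReal.ofReal_mul (by norm_num)]; simp
  have hmart : ∀ x v, μ {ω | T * √r <
      |martingalePart K n h₁ h₂ (bernoulliShift ε J n) g x v ω|} ≤
      ENNReal.ofReal π := fun x v => by
    rw [← hπ']
    refine (hasBernsteinMGF_martingalePart hε hJ hK hM hh₁ hh₂ hg hgC hC
      (by omega) x v).measure_abs_gt_rate_le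
      (measurable_martingalePart hε hJ hK hg x v) hlog0 hr hβ0
      ((martingale_range_le hn hh₁ hh₂ hR).trans ?_)
      ((martingale_variance_le hM0 hC hn hh₁ hh₂ hB₂ hR).trans ?_)
    · exact mul_le_mul_of_nonneg_right hβ₁ hratio
    · exact mul_le_mul_of_nonneg_right hκ₁ hratio'
  have hblock : ∀ p x v, μ {ω | T * √r <
      |blockPart P K n h₁ h₂ ε J g q p x v ω|} ≤ ENNReal.ofReal π := fun p x v => by
    rw [← hπ']
    have hmgf := hasBernsteinMGF_blockPart hε hind hJ hlaw hK hM hh₁ hh₂ hg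
      hgC hC hgL (by omega) hD0 (by linarith) hD hq1 p x v
    rw [← hΓ] at hmgf
    refine hmgf.measure_abs_gt_rate_le
      (measurable_blockPart hε hJ hK hg q p x v) hlog0 hr hβ0
      ((block_range_le hM0 hC hn hh₁ hh₂ hB₂ hR).trans ?_)
      ((block_variance_le hM0 hΓ0 hn hh₁ hh₂ hB₂ hR).trans ?_)
    · exact mul_le_mul_of_nonneg_right hβ₂ hratio
    · exact mul_le_mul_of_nonneg_right hκ₂ hratio'
  have hrem : μ {ω | ENNReal.ofReal (T * √r) <
      ENNReal.ofReal (M / (n * h₁) * (2 * (M * C) + M * L)) * couplingRemainder P ε J n q ω} ≤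
      ENNReal.ofReal (M * (2 * (M * C) + M * L) * (D * 4) * C₁ / T) := by
    have hTs : 0 < T * √r := by positivity
    have hw : 0 ≤ M / (n * h₁) * (2 * (M * C) + M * L) := by
      positivity
    have hmeas : Measurable fun ω =>
        ENNReal.ofReal (M / (n * h₁) * (2 * (M * C) + M * L)) * couplingRemainder P ε J n q ω :=
      (Finset.measurable_sum _ fun j _ => (measurable_spliceErr P (hJ n j) q).comp
        (measurable_pastInnovations hε j)).const_mul _
    have hT' : ENNReal.ofReal (T * √r) ≠ 0 := (ENNReal.ofReal_pos.2 hTs).ne'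
    refine le_trans (measure_mono ?_)
      ((meas_ge_le_lintegral_div hmeas.aemeasurable hT' ENNReal.ofReal_ne_top).trans ?_)
    · intro ω hω
      rw [Set.mem_ofPred_eq] at hω ⊢
      exact hω.le
    rw [ENNReal.div_le_iff hT' ENNReal.ofReal_ne_top, ← ENNReal.ofReal_mul' hTs.le,
      lintegral_const_mul' _ _ ENNReal.ofReal_ne_top]
    refine (mul_le_mul' le_rfl (lintegral_couplingRemainder_le hε hJ hlaw hD0 (by linarith) hD
      hq1)).trans ?_
    rw [← ENNReal.ofReal_mul hw]
    refine ENNReal.ofReal_le_ofReal ?_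
    calc M / (n * h₁) * (2 * (M * C) + M * L) *
          (n * (D * (4 * (q : ℝ) ^ (-(2 * θ + 1)))))
        = M * (2 * (M * C) + M * L) * (D * 4) * ((q : ℝ) ^ (-(2 * θ + 1)) / h₁) := by
          field_simp
      _ ≤ M * (2 * (M * C) + M * L) * (D * 4) * ((C₁ * h₁ * √r) / h₁) := by
          have h2 : (q : ℝ) ^ (-(2 * θ + 1)) ≤ C₁ * h₁ * √r :=
            (blockLength_rpow_le hn hh₁ hh₂ hθ).trans (by gcongr)
          gcongr
      _ = M * (2 * (M * C) + M * L) * (D * 4) * C₁ / T * (T * √r) := by field_simp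
  have hsub := deviation_bound_le (T := T) hM0 Λ.coe_nonneg hCρ hn hh₁ hh₂ hB₁ hB₂ hR
  exact (measure_mono fun ω hω => lt_of_le_of_lt (ENNReal.ofReal_le_ofReal hsub) hω).trans
    (measure_supDeviation_gt_le hε hJ hlaw hK hM hΛ hh₁ hh₂ hg hgC hC hgL hn hA (by positivity)
      (by positivity) hρ hmart hblock hrem)

end Row

end KernelDensity

open KernelDensity in
theorem mainTheorem10 {Ω : Type*} [MeasurableSpace Ω] (μ : Measure Ω) [IsProbabilityMeasure μ]
    -- i.i.d. innovations and the Bernoulli shift array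
    (m : ℕ) (ε : ℤ → Ω → (Fin m → ℝ))
    (hε_meas : ∀ k, Measurable (ε k))
    (hε_indep : iIndepFun ε μ)
    (hε_ident : ∀ k, IdentDistrib (ε k) (ε 0) μ μ)
    (J : ℕ → ℕ → (ℕ → Fin m → ℝ) → ℝ)
    (hJ : ∀ n i, Measurable (J n i))
    -- kernel and bandwidths
    (K : ℝ → ℝ) (hK : KernelDensity.IsKernel K)
    (h₁ h₂ : ℕ → ℝ) (hh₁ : ∀ n, 0 < h₁ n) (hh₂ : ∀ n, 0 < h₂ n)
    (hh_bdd : ∃ B : ℝ, ∀ n, h₁ n ≤ B ∧ h₂ n ≤ B)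
    -- moments and polynomially decaying functional dependence
    (s α : ℝ) (hs₀ : 0 < s) (hs : s ≤ 1 / 2) (hα : s⁻¹ < α)
    (h_moment : ∃ C : ℝ, ∀ n, ∀ i ∈ Finset.Icc 1 n,
      eLpNorm (KernelDensity.bernoulliShift ε J n i) (ENNReal.ofReal (2 * s)) μ
        ≤ ENNReal.ofReal C)
    (h_dep : ∃ C : ℝ, ∀ n k : ℕ, 1 ≤ k →
      KernelDensity.functionalDependence μ ε J (2 * s) n k
        ≤ ENNReal.ofReal (C * (k : ℝ) ^ (-α)))
    -- bounded conditional density, Lipschitz in the conditioning value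
    (g : ℕ → ℕ → ℝ → ℝ → ℝ)
    (hg : ∀ n, ∀ i ∈ Finset.Icc 2 n,
      KernelDensity.IsTransitionDensity μ (KernelDensity.bernoulliShift ε J n) i (g n i))
    (hg_bdd : ∃ C : ℝ, ∀ n, ∀ i ∈ Finset.Icc 2 n, ∀ z x, g n i z x ≤ C)
    (hg_lip : ∃ L : ℝ≥0, ∀ n, ∀ i ∈ Finset.Icc 2 n, ∀ x, LipschitzWith L (fun z => g n i z x))
    -- bandwidth condition
    (h_bandwidth : (fun n : ℕ =>
        Real.log n * (n * h₂ n * h₁ n ^ (α * s / (α * s - 1)))⁻¹) =O[atTop] (fun _ => (1 : ℝ))) :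
    KernelDensity.IsBigOInProbability μ
      (fun n => KernelDensity.supDeviation μ K n (h₁ n) (h₂ n)
        (KernelDensity.bernoulliShift ε J n))
      (fun n => Real.sqrt (Real.log n / (n * h₁ n * h₂ n))) := by
  obtain ⟨M, hM⟩ := hK.bounded
  obtain ⟨Λ, hΛ⟩ := hK.lipschitz
  obtain ⟨B, hB⟩ := hh_bdd
  obtain ⟨Cm, hCm⟩ := h_moment
  obtain ⟨Cd, hCd⟩ := h_dep
  obtain ⟨C', hC'⟩ := hg_bdd
  obtain ⟨L, hL⟩ := hg_lip
  set C := max C' 0 with hCdef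
  have hC : 0 ≤ C := le_max_right _ _
  have hgC : ∀ n, ∀ i ∈ Finset.Icc 2 n, ∀ z x, g n i z x ≤ C := fun n i hi z x =>
    (hC' n i hi z x).trans (le_max_left _ _)
  have hM0 : 0 ≤ M := (abs_nonneg _).trans (hM 0)
  have hB0 : 0 < B := (hh₁ 0).trans_le (hB 0).1
  have hp : 0 < 2 * s := by linarith
  have hp1 : 2 * s ≤ 1 := by linarith
  -- With `θ = α s - 1`, the coupling coefficients in `L¹` are summable with tails of order
  -- `q ^ (-(2 θ + 1))`.
  set θ := α * s - 1 with hθdef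
  have hθ : 0 < θ := by
    have := (inv_lt_iff_one_lt_mul₀ hs₀).1 hα
    linarith
  set P := μ.map (ε 0) with hP
  have hPp : IsProbabilityMeasure P := Measure.isProbabilityMeasure_map (hε_meas 0).aemeasurable
  have hlaw : ∀ i, μ.map (pastInnovations ε i) = pathLaw P :=
    map_pastInnovations hε_meas hε_indep hε_ident
  set D := max Cd 0 ^ (2 * s) with hDdef
  have hD0 : 0 ≤ D := by positivity
  have hD : ∀ n, ∀ j ∈ Finset.Icc 1 (n - 1), ∀ k : ℕ, 1 ≤ k →
      updateDist P (J n j) k ≤ ENNReal.ofReal (D * (k : ℝ) ^ (-(2 * θ + 1 + 1))) := by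
    intro n j hj k hk
    have hj' : j ∈ Finset.Icc 1 n := by
      have := Finset.mem_Icc.1 hj
      rw [Finset.mem_Icc]; omega
    refine (updateDist_le_functionalDependence hε_meas hε_indep hε_ident (hJ n j) hj' hp hp1
      k).trans ?_
    have h1 : functionalDependence μ ε J (2 * s) n k ≤
        ENNReal.ofReal (max Cd 0 * (k : ℝ) ^ (-α)) :=
      (hCd n k hk).trans (ENNReal.ofReal_le_ofReal (by gcongr; exact le_max_left _ _))
    refine (ENNReal.rpow_le_rpow h1 hp.le).trans (le_of_eq ?_)
    rw [ENNReal.ofReal_rpow_of_nonneg (by positivity) hp.le,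
      Real.mul_rpow (le_max_right _ _) (by positivity), ← Real.rpow_mul (by positivity)]
    congr 3
    rw [hθdef]; ring
  obtain ⟨R, C₁, hR0, hC₁, hrate⟩ := eventually_rate_le hh₁ hh₂ (fun n => (hB n).1) hθ (by
    simpa only [hθdef, sub_add_cancel] using h_bandwidth)
  -- `n ^ A` exceeds all observations of the `n`-th row with probability tending to one.
  set A : ℕ := ⌈3 / (2 * s)⌉₊ with hA
  have hA3 : 3 ≤ 2 * s * A := by
    have := Nat.le_ceil (3 / (2 * s))
    rw [div_le_iff₀ hp] at this
    linarith
  have hA1 : A ≠ 0 := by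
    rintro h
    rw [h] at hA3
    norm_num at hA3
  set Cρ := max Cm 0 ^ (2 * s) with hCρ
  have hCρ0 : 0 ≤ Cρ := by positivity
  have hρ : ∀ n : ℕ, 3 ≤ n → ∀ i ∈ Finset.Icc 1 n,
      μ {ω | (n : ℝ) ^ A < |bernoulliShift ε J n i ω|} ≤ ENNReal.ofReal (Cρ / (n : ℝ) ^ 3) := by
    intro n hn i hi
    have hn' : (1 : ℝ) ≤ n := by exact_mod_cast (by omega : 1 ≤ n)
    refine (measure_abs_gt_le_of_eLpNorm_le (measurable_bernoulliShift hε_meas hJ n i) hp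
      (le_max_right Cm 0) (by positivity) ((hCm n i hi).trans
        (ENNReal.ofReal_le_ofReal (le_max_left _ _)))).trans (ENNReal.ofReal_le_ofReal ?_)
    rw [div_eq_mul_inv, ← Real.rpow_natCast (n : ℝ) A, ← Real.rpow_mul (by positivity),
      ← Real.rpow_natCast (n : ℝ) 3, ← Real.rpow_neg (by positivity)]
    gcongr
    push_cast
    linarith
  -- Constants of the two exponential inequalities.
  obtain ⟨Γ, hΓ⟩ : ∃ Γ, Γ = 4 * (M * C) ^ 2 + 2 * (M * C) *
    ((2 * (M * C) + M * L) * (D * 4) * ∑' k : ℕ, (k : ℝ) ^ (-(2 * θ + 1))) := ⟨_, rfl⟩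
  obtain ⟨β, hβ0, hβ₁, hβ₂⟩ : ∃ β : ℝ, 0 < β ∧ 2 * M ^ 2 * √R ≤ β ∧
      2 * M ^ 2 * C * B * (1 + √R) ≤ β :=
    ⟨max 1 (max (2 * M ^ 2 * √R) (2 * M ^ 2 * C * B * (1 + √R))),
      zero_lt_one.trans_le (le_max_left _ _), (le_max_left _ _).trans (le_max_right _ _),
      (le_max_right _ _).trans (le_max_right _ _)⟩
  obtain ⟨κ, hκ₁, hκ₂⟩ : ∃ κ : ℝ, M ^ 4 * C * (1 + B * R) ≤ κ ∧
      2 * M ^ 2 * Γ * B * (1 + B * R) ≤ κ := ⟨_, le_max_left _ _, le_max_right _ _⟩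
  obtain ⟨c, hc⟩ : ∃ c, c = M * (2 * (M * C) + M * L) * (D * 4) * C₁ := ⟨_, rfl⟩
  have hc0 : 0 ≤ c := by rw [hc]; positivity
  intro η hη
  -- `T` makes the exponent beat the cardinality `n ^ (2 A + 12)` of the grid, and makes the
  -- coupling error exceed `T √r` with probability at most `η / 2`.
  obtain ⟨T, hT0, hT₁, hT₂⟩ : ∃ T : ℝ, 0 < T ∧ β * (κ / β ^ 2 + (2 * A + 13)) ≤ T ∧
      2 * c / η ≤ T :=
    ⟨max 1 (max (β * (κ / β ^ 2 + (2 * A + 13))) (2 * c / η)),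
      zero_lt_one.trans_le (le_max_left _ _), (le_max_left _ _).trans (le_max_right _ _),
      (le_max_right _ _).trans (le_max_right _ _)⟩
  have hTβ : κ / β ^ 2 - T / β ≤ -(2 * A + 13) := by
    have h1 : (β * (κ / β ^ 2 + (2 * A + 13))) / β ≤ T / β := by gcongr
    rw [mul_div_cancel_left₀ _ hβ0.ne'] at h1
    linarith
  have hTη : c / T ≤ η / 2 := by
    rw [div_le_div_iff₀ hT0 two_pos]
    rw [div_le_iff₀ hη] at hT₂
    linarith
  refine ⟨2 * M ^ 2 * √R + 4 * T + 4 * Λ * M * (R * B) ^ 3 * B +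
    M ^ 2 * (R * B) ^ 2 * Cρ * B, by positivity, ?_⟩
  have hlim : ∀ᶠ n : ℕ in atTop, (Cρ + 6) / (n : ℝ) ≤ η / 2 :=
    (tendsto_const_div_atTop_nhds_zero_nat (Cρ + 6)).eventually_le_const (by positivity)
  filter_upwards [hrate, hlim, eventually_ge_atTop 3, eventually_ge_atTop ⌈B⌉₊]
    with n hrn hnη hn hnB
  obtain ⟨hR, hrθ⟩ := hrn
  have hn' : (1 : ℝ) ≤ n := by exact_mod_cast (by omega : 1 ≤ n)
  have hAn : h₂ n / 2 < (n : ℝ) ^ A := by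
    have h1 : B ≤ n := (Nat.le_ceil B).trans (by exact_mod_cast hnB)
    have h2 : (n : ℝ) ≤ (n : ℝ) ^ A := le_self_pow₀ hn' hA1
    linarith [hh₂ n, (hB n).2]
  have hmain := measure_supDeviation_gt_sqrt_rate_le hε_meas hε_indep hJ hlaw hK hM hΛ (hh₁ n)
    (hh₂ n) (hg n) (hgC n) hC (hL n) hn hD0 hθ (hD n) (hB n).1 (hB n).2 hR hrθ hAn hCρ0 (hρ n hn)
    hΓ hβ0 hβ₁ hβ₂ hκ₁ hκ₂ hT0
  refine hmain.trans ?_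
  set π := 2 * Real.exp ((κ / β ^ 2 - T / β) * Real.log n) with hπ
  have hπn : ((n ^ (2 * A + 12) : ℕ) : ℝ) * (3 * π) ≤ 6 / n := by
    have h1 : π ≤ 2 * ((n : ℝ) ^ (2 * A + 13))⁻¹ := by
      rw [hπ]
      gcongr
      calc Real.exp ((κ / β ^ 2 - T / β) * Real.log n)
          ≤ Real.exp (-((2 * A + 13 : ℕ) : ℝ) * Real.log n) := by
            gcongr
            push_cast
            linarith
        _ = ((n : ℝ) ^ (2 * A + 13))⁻¹ := by
            rw [neg_mul, Real.exp_neg, mul_comm, Real.exp_mul, Real.exp_log (by linarith),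
              Real.rpow_natCast]
    calc ((n ^ (2 * A + 12) : ℕ) : ℝ) * (3 * π)
        ≤ ((n ^ (2 * A + 12) : ℕ) : ℝ) * (3 * (2 * ((n : ℝ) ^ (2 * A + 13))⁻¹)) := by gcongr
      _ = 6 / n := by
        push_cast
        rw [pow_succ (n : ℝ) (2 * A + 12)]
        field_simp
        norm_num
  have h3 : (3 : ℝ≥0∞) * ENNReal.ofReal π = ENNReal.ofReal (3 * π) := by
    rw [ENNReal.ofReal_mul (p := 3) (q := π) (by norm_num), ENNReal.ofReal_ofNat]
  rw [h3, ← hc, ← ENNReal.ofReal_natCast, ← ENNReal.ofReal_natCast,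
    ← ENNReal.ofReal_mul (by positivity), ← ENNReal.ofReal_mul (by positivity),
    ← ENNReal.ofReal_add (by positivity) (by positivity),
    ← ENNReal.ofReal_add (by positivity) (by positivity)]
  refine ENNReal.ofReal_le_ofReal ?_
  have h4 : (n : ℝ) * (Cρ / (n : ℝ) ^ 3) ≤ Cρ / n := by
    calc (n : ℝ) * (Cρ / (n : ℝ) ^ 3) = Cρ / n * (1 / n) := by field_simp
      _ ≤ Cρ / n * 1 := by
          gcongr
          exact (div_le_one (by linarith)).2 hn'
      _ = _ := mul_one _
  have h5 : (Cρ + 6) / (n : ℝ) = Cρ / n + 6 / n := add_div _ _ _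
  linarith
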